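/- Let $n\ge 2$ and $\frac{2n}{n+2}<g_0\le g_1<\infty$. Let $g$ be a positive $C^1$ function on $(0,\infty)$ with $g_0-1\le \frac{s\,g'(s)}{g(s)}\le g_1-1$ for all $s>0$, and put $G(s)=\int_0^s g(r)\,dr$ for $s\ge 0$. Let $\mathcal A:\mathbb R^n\to\mathbb R^n$ be continuous, $C^1$ on $\mathbb R^n\setminus\{0\}$, and suppose that for some constants $0<\nu\le 1\le L$ $$\langle D\mathcal A(\xi)\zeta,\zeta\rangle\ge \nu\,\frac{g(|\xi|)}{|\xi|}\,|\zeta|^2,\qquad |D\mathcal A(\xi)|\le L\,\frac{g(|\xi|)}{|\xi|}\qquad\text{for all }\xi\in\mathbb R^n\setminus\{0\},\ \zeta\in\mathbb R^n .$$ Let $\Omega\subset\mathbb R^n$ be a bounded domain, $T>0$, $\Omega_T=\Omega\times(0,T)$, and let $Q\subset\Omega_T$ be open. For a cylinder $\mathcal K=\mathcal D\times(s,t)$ with $\mathcal D$ open and $s<t$ we write $\mathcal K\Subset Q$ if there is a cylinder $\mathcal D'\times(s',t)\subset Q$ with $\mathcal D'$ open, $\mathcal D\Subset\mathcal D'$ and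 $s'<s$ (for a cylinder $Q=\mathcal D_0\times(t_1,t_2)$ and nonempty $\mathcal D$ this means $\mathcal D\Subset\mathcal D_0$ and $t_1<s<t\le t_2$). The class $V^{2,G}_{\rm loc}(Q)$ consists of the functions $u$ on $Q$ with a weak spatial gradient $Du$ in $Q$ such that, for every cylinder $\mathcal K=\mathcal D\times(s,t)\Subset Q$, one has $u,Du\in L^1(\mathcal K)$, $\int_{\mathcal K}\big(G(|u|)+G(|Du|)\big)\,dx\,dt<\infty$ and $\operatorname*{ess\,sup}_{s<\tau<t}\int_{\mathcal D}|u(x,\tau)|^2\,dx<\infty$. A weak supersolution in $Q$ (of $\partial_t u-\operatorname{div}\mathcal A(Du)=0$) is a function $u\in V^{2,G}_{\rm loc}(Q)$ with $$-\int_Q u\,\partial_t\eta\,dx\,dt+\int_Q \mathcal A(Du)\cdot D\eta\,dx\,dt\ge 0\qquad\text{for every nonnegative }\eta\in C_c^\infty(Q).$$ Theorem. Let $M\ge 1$ and let $(u_i)_{i=1}^\infty$ be a sequence of weak supersolutions in $Q$ such that $|u_i|\le M$ almost everywhere in $Q$ for every $i$ and $u_i\to u$ almost everywhere in $Q$. Then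 $u$ is a weak supersolution in $Q$. -/

import Mathlib

open MeasureTheory Set Filter Topology
open scoped ContDiff NNReal

noncomputable section

/-- Euclidean space `ℝⁿ`. -/
abbrev Space (n : ℕ) : Type := EuclideanSpace ℝ (Fin n)

/-- Space-time `ℝⁿ × ℝ`; `volume` is the product Lebesgue measure. -/
abbrev SpaceTime (n : ℕ) : Type := Space n × ℝ

/-- `g` is positive and `C¹` on `(0, ∞)` with `g₀ - 1 ≤ s g'(s) / g(s) ≤ g₁ - 1` for `s > 0`. -/
structure HasOrliczGrowth (g : ℝ → ℝ) (g₀ g₁ : ℝ) : Prop where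
  contDiffOn : ContDiffOn ℝ 1 g (Ioi 0)
  pos : ∀ s, 0 < s → 0 < g s
  lower : ∀ s, 0 < s → g₀ - 1 ≤ s * deriv g s / g s
  upper : ∀ s, 0 < s → s * deriv g s / g s ≤ g₁ - 1

/-- Ellipticity and growth of the vector field: `A` is continuous, `C¹` away from the origin, and
`⟨DA(ξ)ζ, ζ⟩ ≥ ν g(|ξ|)/|ξ| |ζ|²`, `|DA(ξ)| ≤ L g(|ξ|)/|ξ|` for `ξ ≠ 0`. -/
structure HasOrliczStructure {n : ℕ} (A : Space n → Space n) (g : ℝ → ℝ) (ν L : ℝ) : Prop where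
  continuous : Continuous A
  contDiffOn : ContDiffOn ℝ 1 A {0}ᶜ
  elliptic : ∀ ξ ζ : Space n, ξ ≠ 0 →
    ν * (g ‖ξ‖ / ‖ξ‖) * ‖ζ‖ ^ 2 ≤ inner ℝ (fderiv ℝ A ξ ζ) ζ
  bounded : ∀ ξ : Space n, ξ ≠ 0 → ‖fderiv ℝ A ξ‖ ≤ L * (g ‖ξ‖ / ‖ξ‖)

/-- The Young function `G(s) = ∫₀ˢ g`. -/
def youngPrimitive (g : ℝ → ℝ) (s : ℝ) : ℝ := ∫ r in (0 : ℝ)..s, g r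

/-- `f ∈ L^G(K)`: `f` is measurable on `K` and `∫_K G(|f|) < ∞`. -/
def MemOrlicz {n : ℕ} {F : Type*} [NormedAddCommGroup F] (G : ℝ → ℝ) (f : SpaceTime n → F)
    (K : Set (SpaceTime n)) : Prop :=
  AEStronglyMeasurable f (volume.restrict K) ∧ ∫⁻ z in K, ENNReal.ofReal (G ‖f z‖) < ⊤

/-- `η ∈ C_c^∞(Q)`. -/
structure IsTestFunction {n : ℕ} (Q : Set (SpaceTime n)) (η : SpaceTime n → ℝ) : Prop where
  smooth : ContDiff ℝ ∞ η
  compact : HasCompactSupport η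
  support : tsupport η ⊆ Q

/-- The time derivative `∂ₜη`. -/
def timeDeriv {n : ℕ} (η : SpaceTime n → ℝ) (z : SpaceTime n) : ℝ :=
  deriv (fun s : ℝ => η (z.1, s)) z.2

/-- The spatial gradient `Dη`. -/
def spaceGrad {n : ℕ} (η : SpaceTime n → ℝ) (z : SpaceTime n) : Space n :=
  gradient (fun x : Space n => η (x, z.2)) z.1

/-- `Du` is the weak spatial gradient of `u` in `Q`. -/
structure IsWeakSpaceGrad {n : ℕ} (Q : Set (SpaceTime n)) (u : SpaceTime n → ℝ)
    (Du : SpaceTime n → Space n) : Prop where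
  locInt : LocallyIntegrableOn u Q
  locInt_grad : LocallyIntegrableOn Du Q
  byParts : ∀ φ : SpaceTime n → ℝ, IsTestFunction Q φ →
    ∫ z in Q, u z • spaceGrad φ z = - ∫ z in Q, φ z • Du z

/-- The cylinder `D × (s, t)`. -/
def timeCylinder {n : ℕ} (D : Set (Space n)) (s t : ℝ) : Set (SpaceTime n) := D ×ˢ Ioo s t

/-- `u ∈ V^{2,G}(D × (s, t)) = L^∞(s, t; L²(D)) ∩ V^G(D × (s, t))` with weak spatial gradient `Du`.
Here `u ∈ V^G` means `u, Du ∈ L^G` and `u ∈ L¹(s, t; W^{1,1}(D))`, that is, `u, Du ∈ L¹`. -/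
structure MemV2G {n : ℕ} (G : ℝ → ℝ) (D : Set (Space n)) (s t : ℝ) (u : SpaceTime n → ℝ)
    (Du : SpaceTime n → Space n) : Prop where
  weakGrad : IsWeakSpaceGrad (timeCylinder D s t) u Du
  memOrlicz : MemOrlicz G u (timeCylinder D s t)
  memOrlicz_grad : MemOrlicz G Du (timeCylinder D s t)
  integrable : IntegrableOn u (timeCylinder D s t)
  integrable_grad : IntegrableOn Du (timeCylinder D s t)
  sup_L2 : ∃ C : ℝ≥0, ∀ᵐ τ ∂(volume.restrict (Ioo s t)), ∫⁻ x in D, ‖u (x, τ)‖ₑ ^ 2 ≤ C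

/-- `D × (s, t) ⋐ Q` in the parabolic sense, where the top of the cylinder may touch the top of `Q`:
`D` is open, and some cylinder `D' × (s', t) ⊆ Q` has `D'` open, `D ⋐ D'` and `s' < s < t`.
If `Q = D₀ × (t₁, t₂)` and `D` is nonempty, this says `D ⋐ D₀` and `t₁ < s < t ≤ t₂`. -/
def ParabolicallyInside {n : ℕ} (D : Set (Space n)) (s t : ℝ) (Q : Set (SpaceTime n)) : Prop :=
  IsOpen D ∧ IsCompact (closure D) ∧ s < t ∧
    ∃ (D' : Set (Space n)) (s' : ℝ), IsOpen D' ∧ closure D ⊆ D' ∧ s' < s ∧ timeCylinder D' s' t ⊆ Q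

/-- `u ∈ V^{2,G}_loc(Q)` with weak spatial gradient `Du`. -/
def MemV2GLoc {n : ℕ} (G : ℝ → ℝ) (Q : Set (SpaceTime n)) (u : SpaceTime n → ℝ)
    (Du : SpaceTime n → Space n) : Prop :=
  IsWeakSpaceGrad Q u Du ∧ ∀ D s t, ParabolicallyInside D s t Q → MemV2G G D s t u Du

/-- `u` is a weak supersolution of `∂ₜu - div A(Du) = 0` in `Q`. -/
def IsWeakSupersolution {n : ℕ} (A : Space n → Space n) (g : ℝ → ℝ) (Q : Set (SpaceTime n))
    (u : SpaceTime n → ℝ) : Prop :=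
  ∃ Du : SpaceTime n → Space n, MemV2GLoc (youngPrimitive g) Q u Du ∧
    ∀ η : SpaceTime n → ℝ, IsTestFunction Q η → (∀ z, 0 ≤ η z) →
      0 ≤ - (∫ z in Q, u z * timeDeriv η z) + ∫ z in Q, inner ℝ (A (Du z)) (spaceGrad η z)

end

/-!
Two supersolutions `v₁`, `v₂` are compared by testing their inequalities, after mollification in
space-time, with `(δ - S(v₁ - v₂)) θ` and `(δ + S(v₁ - v₂)) θ`, where `|S| ≤ δ` on the range of
`v₁ - v₂`. In the sum the time derivatives combine to the exact derivative `∂ₜ W(v₁ - v₂)` with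
`W' = S`, which falls on `θ`; no time regularity of the supersolutions is needed. For `v₂ = 0` and
`S(x) = x` this bounds the energy of `v₁` by its supremum. If `S` is a smooth truncation at the
small level `δ`, it bounds the integral of `⟨A(Dv₁) - A(Dv₂), Dv₁ - Dv₂⟩` over the set where
`|v₁ - v₂|` is small by a multiple of `δ`. Applied to `vᵢ` and `vⱼ`, which are close outside a set
of small measure, strict monotonicity of `A` makes the gradients Cauchy in `L¹_loc`, and the
uniform energy bound carries the fluxes to the limit as well. Cutoff functions in time enter the
energy estimate only through an upper bound of their derivative, so the energy stays finite up to
the top of a cylinder.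
-/

section GrowthFunctions

/-- A continuous nondecreasing function `γ ≥ 0` on the line that tends to infinity and satisfies a
doubling condition of power type. The function `g`, extended by zero to `(-∞, 0]`, is of this kind
as soon as `g₀ > 1`, and only this is used of it away from the structure conditions for `A`. -/
structure IsGrowthFunction (γ : ℝ → ℝ) (P : ℕ) : Prop where
  continuous : Continuous γ
  monotone : Monotone γ
  nonneg : ∀ s, 0 ≤ γ s
  tendsto_atTop : Tendsto γ atTop atTop
  doubling : ∀ c s : ℝ, 1 ≤ c → 0 ≤ s → γ (c * s) ≤ c ^ P * γ s

namespace IsGrowthFunction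

variable {γ : ℝ → ℝ} {P : ℕ}

theorem exponent_ne_zero (hγ : IsGrowthFunction γ P) : P ≠ 0 := by
  rintro rfl
  obtain ⟨c, hc, hlt⟩ :=
    ((eventually_ge_atTop 1).and (hγ.tendsto_atTop.eventually_gt_atTop (γ 1))).exists
  have hle := hγ.doubling c 1 hc zero_le_one
  simp only [mul_one, pow_zero, one_mul] at hle
  exact hlt.not_ge hle

theorem integral_le_mul (hγ : IsGrowthFunction γ P) {s : ℝ} (hs : 0 ≤ s) :
    ∫ r in (0 : ℝ)..s, γ r ≤ s * γ s := by
  simpa using intervalIntegral.integral_mono_on (μ := volume) hs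
    (hγ.continuous.intervalIntegrable 0 s) (intervalIntegrable_const (c := γ s))
    fun r hr => hγ.monotone hr.2

theorem mul_le_integral (hγ : IsGrowthFunction γ P) {s : ℝ} (hs : 0 ≤ s) :
    s * γ s ≤ 2 ^ (P + 1) * ∫ r in (0 : ℝ)..s, γ r := by
  have hdoubling : γ s ≤ 2 ^ P * γ (s / 2) := by
    simpa [mul_div_cancel₀] using hγ.doubling 2 (s / 2) one_le_two (by positivity)
  have hupper_half : (s - s / 2) * γ (s / 2) ≤ ∫ r in (s / 2)..s, γ r := by
    simpa using intervalIntegral.integral_mono_on (μ := volume) (by linarith : s / 2 ≤ s)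
      (intervalIntegrable_const (c := γ (s / 2))) (hγ.continuous.intervalIntegrable (s / 2) s)
      fun r hr => hγ.monotone hr.1
  have hlower_half : 0 ≤ ∫ r in (0 : ℝ)..(s / 2), γ r :=
    intervalIntegral.integral_nonneg (by positivity) fun r _ => hγ.nonneg r
  have hsplit := intervalIntegral.integral_add_adjacent_intervals
    (hγ.continuous.intervalIntegrable (μ := volume) 0 (s / 2))
    (hγ.continuous.intervalIntegrable (s / 2) s)
  calc s * γ s ≤ s * (2 ^ P * γ (s / 2)) := by gcongr
    _ = 2 ^ (P + 1) * ((s - s / 2) * γ (s / 2)) := by ring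
    _ ≤ 2 ^ (P + 1) * ∫ r in (0 : ℝ)..s, γ r := by gcongr; linarith

end IsGrowthFunction

namespace HasOrliczGrowth

variable {g : ℝ → ℝ} {g₀ g₁ : ℝ}

theorem hasDerivAt (hg : HasOrliczGrowth g g₀ g₁) {s : ℝ} (hs : 0 < s) :
    HasDerivAt g (deriv g s) s :=
  ((hg.contDiffOn.differentiableOn one_ne_zero).differentiableAt (Ioi_mem_nhds hs)).hasDerivAt

theorem le_mul_deriv (hg : HasOrliczGrowth g g₀ g₁) {s : ℝ} (hs : 0 < s) :
    (g₀ - 1) * g s ≤ s * deriv g s :=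
  (le_div_iff₀ (hg.pos s hs)).1 (hg.lower s hs)

theorem mul_deriv_le (hg : HasOrliczGrowth g g₀ g₁) {s : ℝ} (hs : 0 < s) :
    s * deriv g s ≤ (g₁ - 1) * g s :=
  (div_le_iff₀ (hg.pos s hs)).1 (hg.upper s hs)

theorem lower_le_upper (hg : HasOrliczGrowth g g₀ g₁) : g₀ ≤ g₁ := by
  linarith [(hg.lower 1 one_pos).trans (hg.upper 1 one_pos)]

theorem hasDerivAt_mul_rpow (hg : HasOrliczGrowth g g₀ g₁) (q : ℝ) {s : ℝ} (hs : 0 < s) :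
    HasDerivAt (fun s => g s * s ^ (-q)) (s ^ (-q - 1) * (s * deriv g s - q * g s)) s := by
  refine ((hg.hasDerivAt hs).mul
    (Real.hasDerivAt_rpow_const (p := -q) (.inl hs.ne'))).congr_deriv ?_
  rw [Real.rpow_sub_one hs.ne']
  field_simp
  ring

theorem monotoneOn_mul_rpow (hg : HasOrliczGrowth g g₀ g₁) :
    MonotoneOn (fun s => g s * s ^ (-(g₀ - 1))) (Ioi 0) := by
  have hderiv := fun s hs => hg.hasDerivAt_mul_rpow (g₀ - 1) (s := s) hs
  refine monotoneOn_of_deriv_nonneg (convex_Ioi 0) (HasDerivAt.continuousOn hderiv)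
    (fun s hs => ?_) fun s hs => ?_ <;> rw [interior_Ioi] at hs
  · exact (hderiv s hs).differentiableAt.differentiableWithinAt
  · rw [(hderiv s hs).deriv]
    exact mul_nonneg (Real.rpow_nonneg (le_of_lt hs) _) (sub_nonneg.2 (hg.le_mul_deriv hs))

theorem antitoneOn_mul_rpow (hg : HasOrliczGrowth g g₀ g₁) :
    AntitoneOn (fun s => g s * s ^ (-(g₁ - 1))) (Ioi 0) := by
  have hderiv := fun s hs => hg.hasDerivAt_mul_rpow (g₁ - 1) (s := s) hs
  refine antitoneOn_of_deriv_nonpos (convex_Ioi 0) (HasDerivAt.continuousOn hderiv)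
    (fun s hs => ?_) fun s hs => ?_ <;> rw [interior_Ioi] at hs
  · exact (hderiv s hs).differentiableAt.differentiableWithinAt
  · rw [(hderiv s hs).deriv]
    exact mul_nonpos_of_nonneg_of_nonpos (Real.rpow_nonneg (le_of_lt hs) _)
      (sub_nonpos.2 (hg.mul_deriv_le hs))

theorem rpow_mul_le (hg : HasOrliczGrowth g g₀ g₁) {c s : ℝ} (hc : 1 ≤ c) (hs : 0 < s) :
    c ^ (g₀ - 1) * g s ≤ g (c * s) := by
  have hc₀ : 0 < c := one_pos.trans_le hc
  have h : g s * s ^ (-(g₀ - 1)) ≤ g (c * s) * (c * s) ^ (-(g₀ - 1)) :=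
    hg.monotoneOn_mul_rpow hs (mul_pos hc₀ hs) (le_mul_of_one_le_left hs.le hc)
  rw [Real.mul_rpow hc₀.le hs.le, ← mul_assoc,
    mul_le_mul_iff_left₀ (by positivity), Real.rpow_neg hc₀.le, ← div_eq_mul_inv,
    le_div_iff₀ (by positivity)] at h
  linarith

theorem le_rpow_mul (hg : HasOrliczGrowth g g₀ g₁) {c s : ℝ} (hc : 1 ≤ c) (hs : 0 < s) :
    g (c * s) ≤ c ^ (g₁ - 1) * g s := by
  have hc₀ : 0 < c := one_pos.trans_le hc
  have h : g (c * s) * (c * s) ^ (-(g₁ - 1)) ≤ g s * s ^ (-(g₁ - 1)) :=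
    hg.antitoneOn_mul_rpow hs (mul_pos hc₀ hs) (le_mul_of_one_le_left hs.le hc)
  rw [Real.mul_rpow hc₀.le hs.le, ← mul_assoc,
    mul_le_mul_iff_left₀ (by positivity), Real.rpow_neg hc₀.le, ← div_eq_mul_inv,
    div_le_iff₀ (by positivity)] at h
  linarith

theorem monotoneOn (hg : HasOrliczGrowth g g₀ g₁) (h₀ : 1 ≤ g₀) : MonotoneOn g (Ioi 0) := by
  intro s hs t _ hst
  have hs₀ : 0 < s := hs
  have h₁ : 1 ≤ t / s := (one_le_div hs₀).2 hst
  calc g s ≤ (t / s) ^ (g₀ - 1) * g s :=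
        le_mul_of_one_le_left (hg.pos s hs).le (Real.one_le_rpow h₁ (by linarith))
    _ ≤ g (t / s * s) := hg.rpow_mul_le h₁ hs
    _ = g t := by rw [div_mul_cancel₀ _ hs₀.ne']

theorem tendsto_atTop (hg : HasOrliczGrowth g g₀ g₁) (h₀ : 1 < g₀) : Tendsto g atTop atTop := by
  refine tendsto_atTop_mono' _ ?_
    ((tendsto_rpow_atTop (sub_pos.2 h₀)).atTop_mul_const (hg.pos 1 one_pos))
  filter_upwards [eventually_ge_atTop 1] with s hs
  simpa using hg.rpow_mul_le hs one_pos

theorem tendsto_zero (hg : HasOrliczGrowth g g₀ g₁) (h₀ : 1 < g₀) :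
    Tendsto g (𝓝[>] 0) (𝓝 0) := by
  have hpow : Tendsto (fun s : ℝ => g 1 * s ^ (g₀ - 1)) (𝓝[>] 0) (𝓝 0) := by
    have h := (Real.continuousAt_rpow_const 0 (g₀ - 1) (.inr (by linarith))).tendsto.const_mul (g 1)
    rw [Real.zero_rpow (by linarith), mul_zero] at h
    exact h.mono_left nhdsWithin_le_nhds
  refine squeeze_zero' ?_ ?_ hpow
  · filter_upwards [self_mem_nhdsWithin] with s hs using (hg.pos s hs).le
  · filter_upwards [Ioo_mem_nhdsGT one_pos] with s ⟨hs₀, hs₁⟩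
    have h := hg.rpow_mul_le (c := s⁻¹) ((one_le_inv₀ hs₀).2 hs₁.le) hs₀
    rwa [Real.inv_rpow hs₀.le, inv_mul_cancel₀ hs₀.ne', inv_mul_le_iff₀ (by positivity),
      mul_comm] at h

theorem continuous_indicator (hg : HasOrliczGrowth g g₀ g₁) (h₀ : 1 < g₀) :
    Continuous ((Ioi 0).indicator g) := by
  refine continuous_iff_continuousAt.2 fun s => ?_
  rcases lt_trichotomy s 0 with hs | rfl | hs
  · refine continuousAt_const.congr (f := fun _ => 0) ?_
    filter_upwards [Iio_mem_nhds hs] with t ht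
    exact (indicator_of_notMem (not_lt.2 (le_of_lt ht)) g).symm
  · have hzero : (Ioi 0).indicator g 0 = 0 := indicator_of_notMem self_notMem_Ioi g
    refine continuousAt_iff_continuous_left'_right'.2 ⟨?_, ?_⟩ <;>
      rw [ContinuousWithinAt, hzero]
    · refine tendsto_const_nhds.congr' ?_
      filter_upwards [self_mem_nhdsWithin] with t ht
      exact (indicator_of_notMem (not_lt.2 (le_of_lt ht)) g).symm
    · refine (hg.tendsto_zero h₀).congr' ?_
      filter_upwards [self_mem_nhdsWithin] with t ht using (indicator_of_mem ht g).symm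
  · refine (hg.hasDerivAt hs).continuousAt.congr ?_
    filter_upwards [Ioi_mem_nhds hs] with t ht using (indicator_of_mem ht g).symm

theorem isGrowthFunction (hg : HasOrliczGrowth g g₀ g₁) (h₀ : 1 < g₀) {P : ℕ}
    (hP : g₁ - 1 ≤ P) : IsGrowthFunction ((Ioi 0).indicator g) P where
  continuous := hg.continuous_indicator h₀
  monotone s t hst := by
    rcases le_or_gt s 0 with hs | hs
    · rw [indicator_of_notMem (notMem_Ioi.2 hs)]
      exact indicator_nonneg (fun r hr => (hg.pos r hr).le) t
    · have ht := hs.trans_le hst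
      rw [indicator_of_mem (mem_Ioi.2 hs), indicator_of_mem (mem_Ioi.2 ht)]
      exact hg.monotoneOn h₀.le hs ht hst
  nonneg := indicator_nonneg fun s hs => (hg.pos s hs).le
  tendsto_atTop := by
    refine (hg.tendsto_atTop h₀).congr' ?_
    filter_upwards [Ioi_mem_atTop 0] with s hs using (indicator_of_mem hs g).symm
  doubling c s hc hs := by
    rcases hs.eq_or_lt with rfl | hs
    · simp
    · have hcs : 0 < c * s := mul_pos (one_pos.trans_le hc) hs
      rw [indicator_of_mem (mem_Ioi.2 hs), indicator_of_mem (mem_Ioi.2 hcs)]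
      refine (hg.le_rpow_mul hc hs).trans (mul_le_mul_of_nonneg_right ?_ (hg.pos s hs).le)
      exact (Real.rpow_le_rpow_of_exponent_le hc hP).trans_eq (Real.rpow_natCast c P)

end HasOrliczGrowth

theorem youngPrimitive_eq_integral_indicator (g : ℝ → ℝ) {s : ℝ} (hs : 0 ≤ s) :
    youngPrimitive g s = ∫ r in (0 : ℝ)..s, (Ioi 0).indicator g r := by
  refine intervalIntegral.integral_congr_ae (.of_forall fun r hr => ?_)
  rw [uIoc_of_le hs] at hr
  exact (indicator_of_mem (mem_Ioi.2 hr.1) g).symm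

end GrowthFunctions

section MonotoneFields

/-- A continuous strictly monotone vector field vanishing at the origin, whose growth and coercivity
are those of the scalar function `γ`. -/
structure IsMonotoneField {E : Type*} [NormedAddCommGroup E] [InnerProductSpace ℝ E] (A : E → E)
    (γ : ℝ → ℝ) (C c : ℝ) : Prop where
  growth_nonneg : 0 ≤ C
  coercivity_pos : 0 < c
  continuous : Continuous A
  map_zero : A 0 = 0
  strictMono : ∀ ξ ζ, ξ ≠ ζ → 0 < inner ℝ (A ξ - A ζ) (ξ - ζ)
  growth : ∀ ξ, ‖A ξ‖ ≤ C * γ ‖ξ‖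
  coercive : ∀ ξ, c * (‖ξ‖ * γ ‖ξ‖) ≤ inner ℝ (A ξ) ξ

theorem strictMono_of_deriv_pos_of_ne {f : ℝ → ℝ} (hf : Continuous f) {t₀ : ℝ}
    (hf' : ∀ t, t ≠ t₀ → 0 < deriv f t) : StrictMono f := by
  refine StrictMonoOn.Iic_union_Ici (a := t₀) ?_ ?_
  · refine strictMonoOn_of_deriv_pos (convex_Iic t₀) hf.continuousOn fun t ht => hf' t ?_
    rw [interior_Iic] at ht
    exact ht.ne
  · refine strictMonoOn_of_deriv_pos (convex_Ici t₀) hf.continuousOn fun t ht => hf' t ?_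
    rw [interior_Ici] at ht
    exact ht.ne'

theorem exists_forall_add_smul_ne_zero {E : Type*} [AddCommGroup E] [Module ℝ E] (p : E)
    {d : E} (hd : d ≠ 0) : ∃ t₀ : ℝ, ∀ t, t ≠ t₀ → p + t • d ≠ 0 := by
  by_cases h : ∃ t₀ : ℝ, p + t₀ • d = 0
  · obtain ⟨t₀, ht₀⟩ := h
    refine ⟨t₀, fun t hne ht => hne (smul_left_injective ℝ hd ?_)⟩
    exact add_left_cancel (ht.trans ht₀.symm)
  · exact ⟨0, fun t _ ht => h ⟨t, ht⟩⟩

namespace HasOrliczStructure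

variable {n : ℕ} {A : Space n → Space n} {g : ℝ → ℝ} {g₀ g₁ ν L : ℝ}

theorem hasFDerivAt (hA : HasOrliczStructure A g ν L) {ξ : Space n} (hξ : ξ ≠ 0) :
    HasFDerivAt A (fderiv ℝ A ξ) ξ :=
  ((hA.contDiffOn.differentiableOn one_ne_zero).differentiableAt
    (isOpen_compl_singleton.mem_nhds hξ)).hasFDerivAt

theorem hasDerivAt_inner_line (hA : HasOrliczStructure A g ν L) (p d e : Space n) {t : ℝ}
    (ht : p + t • d ≠ 0) :
    HasDerivAt (fun t : ℝ => inner ℝ (A (p + t • d)) e)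
      (inner ℝ (fderiv ℝ A (p + t • d) d) e) t := by
  have hline : HasDerivAt (fun t : ℝ => p + t • d) d t := by
    simpa using ((hasDerivAt_id t).smul_const d).const_add p
  simpa using ((hA.hasFDerivAt ht).comp_hasDerivAt t hline).inner ℝ (hasDerivAt_const t e)

-- A line meets the origin at most once, so ellipticity makes `⟨A, d⟩` strictly increasing along
-- every line of direction `d`.
theorem inner_sub_pos (hA : HasOrliczStructure A g ν L) (hν : 0 < ν)
    (hpos : ∀ s, 0 < s → 0 < g s) {ξ ζ : Space n} (hne : ξ ≠ ζ) :
    0 < inner ℝ (A ξ - A ζ) (ξ - ζ) := by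
  have hd : ξ - ζ ≠ 0 := sub_ne_zero.2 hne
  obtain ⟨t₀, ht₀⟩ := exists_forall_add_smul_ne_zero ζ hd
  have hcont : Continuous fun t : ℝ => inner ℝ (A (ζ + t • (ξ - ζ))) (ξ - ζ) := by
    have := hA.continuous
    fun_prop
  have hmono := strictMono_of_deriv_pos_of_ne hcont (t₀ := t₀) fun t ht => by
    rw [(hA.hasDerivAt_inner_line _ _ _ (ht₀ t ht)).deriv]
    refine lt_of_lt_of_le ?_ (hA.elliptic _ _ (ht₀ t ht))
    have hnorm := norm_pos_iff.2 (ht₀ t ht)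
    have := hpos _ hnorm
    positivity
  simpa [inner_sub_left] using hmono zero_lt_one

-- Comparison, on the ray through `ξ`, of the radial function `γ(t|ξ|)` with a component of `A(tξ)`.
theorem nonneg_of_radial_deriv_nonneg (hA : HasOrliczStructure A g ν L)
    (hg : HasOrliczGrowth g g₀ g₁) (h₀ : 1 < g₀) {ξ : Space n} (hξ : ξ ≠ 0) (e : Space n) (a b : ℝ)
    (hderiv : ∀ t : ℝ, 0 < t →
      0 ≤ a * (deriv g (t * ‖ξ‖) * ‖ξ‖) + b * inner ℝ (fderiv ℝ A (t • ξ) ξ) e) :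
    0 ≤ a * g ‖ξ‖ + b * inner ℝ (A ξ - A 0) e := by
  have hnorm : 0 < ‖ξ‖ := norm_pos_iff.2 hξ
  set φ : ℝ → ℝ := fun t =>
    a * (Ioi 0).indicator g (t * ‖ξ‖) + b * inner ℝ (A ((0 : Space n) + t • ξ)) e with hφ
  have hφ_cont : Continuous φ := by
    have := hg.continuous_indicator h₀
    have := hA.continuous
    fun_prop
  have hφ_deriv : ∀ t : ℝ, 0 < t → HasDerivAt φ
      (a * (deriv g (t * ‖ξ‖) * ‖ξ‖) + b * inner ℝ (fderiv ℝ A (t • ξ) ξ) e) t := by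
    intro t ht
    have hg_ray : HasDerivAt (fun t => (Ioi 0).indicator g (t * ‖ξ‖))
        (deriv g (t * ‖ξ‖) * ‖ξ‖) t := by
      refine ((hg.hasDerivAt (mul_pos ht hnorm)).comp t
        (by simpa using (hasDerivAt_id t).mul_const ‖ξ‖)).congr_of_eventuallyEq ?_
      filter_upwards [Ioi_mem_nhds ht] with r hr
      exact indicator_of_mem (mem_Ioi.2 (mul_pos hr hnorm)) g
    have hA_ray := hA.hasDerivAt_inner_line 0 ξ e (t := t) (by simp [hξ, ht.ne'])
    exact ((hg_ray.const_mul a).add (hA_ray.const_mul b)).congr_deriv (by simp only [zero_add])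
  have hmono : MonotoneOn φ (Icc 0 1) := by
    refine monotoneOn_of_deriv_nonneg (convex_Icc 0 1) hφ_cont.continuousOn (fun t ht => ?_)
      fun t ht => ?_ <;> rw [interior_Icc] at ht
    · exact (hφ_deriv t ht.1).differentiableAt.differentiableWithinAt
    · exact (hφ_deriv t ht.1).deriv ▸ hderiv t ht.1
  have h := hmono (left_mem_Icc.2 zero_le_one) (right_mem_Icc.2 zero_le_one) zero_le_one
  simp only [hφ, zero_mul, zero_smul, zero_add, one_mul, one_smul,
    indicator_of_mem (mem_Ioi.2 hnorm), indicator_of_notMem self_notMem_Ioi, mul_zero] at h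
  rw [inner_sub_left]
  linarith

theorem norm_sub_zero_le (hA : HasOrliczStructure A g ν L) (hg : HasOrliczGrowth g g₀ g₁)
    (h₀ : 1 < g₀) (ξ : Space n) :
    ‖A ξ - A 0‖ ≤ L / (g₀ - 1) * (Ioi 0).indicator g ‖ξ‖ := by
  rcases eq_or_ne ξ 0 with rfl | hξ
  · simp
  have hnorm : 0 < ‖ξ‖ := norm_pos_iff.2 hξ
  have hg₀ : 0 < g₀ - 1 := sub_pos.2 h₀
  have hL : 0 ≤ L := by
    have := (norm_nonneg _).trans (hA.bounded ξ hξ)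
    exact nonneg_of_mul_nonneg_left this (div_pos (hg.pos _ hnorm) hnorm)
  set e := A ξ - A 0 with he
  have hradial : 0 ≤ ‖e‖ * (L / (g₀ - 1)) * g ‖ξ‖ + -1 * inner ℝ (A ξ - A 0) e := by
    refine hA.nonneg_of_radial_deriv_nonneg hg h₀ hξ e _ _ fun t ht => ?_
    have hs : 0 < t * ‖ξ‖ := mul_pos ht hnorm
    have hbound : ‖fderiv ℝ A (t • ξ)‖ ≤ L * (g (t * ‖ξ‖) / (t * ‖ξ‖)) := by
      simpa only [norm_smul, Real.norm_of_nonneg ht.le] using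
        hA.bounded (t • ξ) (smul_ne_zero ht.ne' hξ)
    have hdiv : g (t * ‖ξ‖) / (t * ‖ξ‖) ≤ deriv g (t * ‖ξ‖) / (g₀ - 1) := by
      rw [div_le_div_iff₀ hs hg₀]
      linarith [hg.le_mul_deriv hs]
    have hinner : inner ℝ (fderiv ℝ A (t • ξ) ξ) e
        ≤ ‖e‖ * (L / (g₀ - 1)) * (deriv g (t * ‖ξ‖) * ‖ξ‖) := calc
      _ ≤ ‖fderiv ℝ A (t • ξ) ξ‖ * ‖e‖ := real_inner_le_norm _ _
      _ ≤ L * (deriv g (t * ‖ξ‖) / (g₀ - 1)) * ‖ξ‖ * ‖e‖ := by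
        gcongr
        exact (fderiv ℝ A (t • ξ)).le_of_opNorm_le (hbound.trans (by gcongr)) ξ
      _ = ‖e‖ * (L / (g₀ - 1)) * (deriv g (t * ‖ξ‖) * ‖ξ‖) := by ring
    linarith
  rw [← he, real_inner_self_eq_norm_sq] at hradial
  rw [indicator_of_mem (mem_Ioi.2 hnorm)]
  rcases (norm_nonneg e).eq_or_lt with he₀ | he₀
  · rw [← he₀]
    have := hg.pos _ hnorm
    positivity
  · exact le_of_mul_le_mul_left (by linarith) he₀

theorem le_inner_sub_zero (hA : HasOrliczStructure A g ν L) (hg : HasOrliczGrowth g g₀ g₁)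
    (h₀ : 1 < g₀) (hν : 0 ≤ ν) (ξ : Space n) :
    ν / (g₁ - 1) * (‖ξ‖ * (Ioi 0).indicator g ‖ξ‖) ≤ inner ℝ (A ξ - A 0) ξ := by
  rcases eq_or_ne ξ 0 with rfl | hξ
  · simp
  have hnorm : 0 < ‖ξ‖ := norm_pos_iff.2 hξ
  have hg₁ : 0 < g₁ - 1 := sub_pos.2 (h₀.trans_le hg.lower_le_upper)
  have hradial : 0 ≤ -(ν / (g₁ - 1) * ‖ξ‖) * g ‖ξ‖ + 1 * inner ℝ (A ξ - A 0) ξ := by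
    refine hA.nonneg_of_radial_deriv_nonneg hg h₀ hξ ξ _ _ fun t ht => ?_
    have hs : 0 < t * ‖ξ‖ := mul_pos ht hnorm
    have helliptic : ν * (g (t * ‖ξ‖) / (t * ‖ξ‖)) * ‖ξ‖ ^ 2
        ≤ inner ℝ (fderiv ℝ A (t • ξ) ξ) ξ := by
      simpa only [norm_smul, Real.norm_of_nonneg ht.le] using
        hA.elliptic (t • ξ) ξ (smul_ne_zero ht.ne' hξ)
    have hdiv : deriv g (t * ‖ξ‖) / (g₁ - 1) ≤ g (t * ‖ξ‖) / (t * ‖ξ‖) := by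
      rw [div_le_div_iff₀ hg₁ hs]
      linarith [hg.mul_deriv_le hs]
    have hderiv : ν / (g₁ - 1) * ‖ξ‖ * (deriv g (t * ‖ξ‖) * ‖ξ‖)
        ≤ ν * (g (t * ‖ξ‖) / (t * ‖ξ‖)) * ‖ξ‖ ^ 2 := calc
      _ = ν * (deriv g (t * ‖ξ‖) / (g₁ - 1)) * ‖ξ‖ ^ 2 := by ring
      _ ≤ _ := by gcongr
    linarith
  rw [indicator_of_mem (mem_Ioi.2 hnorm)]
  linarith

theorem isMonotoneField (hA : HasOrliczStructure A g ν L) (hg : HasOrliczGrowth g g₀ g₁)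
    (h₀ : 1 < g₀) (hν : 0 < ν) :
    IsMonotoneField (fun ξ => A ξ - A 0) ((Ioi 0).indicator g) (|L| / (g₀ - 1))
      (ν / (g₁ - 1)) where
  growth_nonneg := div_nonneg (abs_nonneg L) (sub_pos.2 h₀).le
  coercivity_pos := div_pos hν (sub_pos.2 (h₀.trans_le hg.lower_le_upper))
  continuous := hA.continuous.sub continuous_const
  map_zero := sub_self _
  strictMono _ _ hne := by
    simpa only [sub_sub_sub_cancel_right] using hA.inner_sub_pos hν hg.pos hne
  growth ξ := by
    refine (hA.norm_sub_zero_le hg h₀ ξ).trans ?_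
    have := (hg.isGrowthFunction h₀ (Nat.le_ceil _)).nonneg ‖ξ‖
    have := sub_pos.2 h₀
    gcongr
    exact le_abs_self L
  coercive := hA.le_inner_sub_zero hg h₀ hν.le

end HasOrliczStructure

end MonotoneFields

section Limits

variable {α : Type*} [MeasurableSpace α] {μ : Measure α}

theorem integrable_and_integral_le_of_tendsto {h : ℕ → α → ℝ} {h₀ : α → ℝ} {c : ℕ → ℝ} {c₀ : ℝ}
    (hint : ∀ m, Integrable (h m) μ) (hnonneg : ∀ m, 0 ≤ᵐ[μ] h m)
    (hlim : ∀ᵐ x ∂μ, Tendsto (fun m => h m x) atTop (𝓝 (h₀ x)))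
    (hle : ∀ m, ∫ x, h m x ∂μ ≤ c m) (hc : Tendsto c atTop (𝓝 c₀)) :
    Integrable h₀ μ ∧ ∫ x, h₀ x ∂μ ≤ c₀ := by
  have hmeas : AEStronglyMeasurable h₀ μ :=
    aestronglyMeasurable_of_tendsto_ae atTop (fun m => (hint m).aestronglyMeasurable) hlim
  have h₀_nonneg : 0 ≤ᵐ[μ] h₀ := by
    filter_upwards [ae_all_iff.2 hnonneg, hlim] with x hx hx_lim using ge_of_tendsto' hx_lim hx
  have hc₀ : 0 ≤ c₀ :=
    ge_of_tendsto' hc fun m => (integral_nonneg_of_ae (hnonneg m)).trans (hle m)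
  have hlintegral : ∫⁻ x, ENNReal.ofReal (h₀ x) ∂μ ≤ ENNReal.ofReal c₀ := calc
    _ = ∫⁻ x, liminf (fun m => ENNReal.ofReal (h m x)) atTop ∂μ := by
      refine lintegral_congr_ae ?_
      filter_upwards [hlim] with x hx using (ENNReal.tendsto_ofReal hx).liminf_eq.symm
    _ ≤ liminf (fun m => ∫⁻ x, ENNReal.ofReal (h m x) ∂μ) atTop :=
      lintegral_liminf_le' fun m => (hint m).aemeasurable.ennreal_ofReal
    _ ≤ liminf (fun m => ENNReal.ofReal (c m)) atTop := by
      refine liminf_le_liminf (.of_forall fun m => ?_)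
      rw [← ofReal_integral_eq_lintegral_ofReal (hint m) (hnonneg m)]
      exact ENNReal.ofReal_le_ofReal (hle m)
    _ = ENNReal.ofReal c₀ := (ENNReal.tendsto_ofReal hc).liminf_eq
  have hint₀ : Integrable h₀ μ :=
    (lintegral_ofReal_ne_top_iff_integrable hmeas h₀_nonneg).1
      (hlintegral.trans_lt ENNReal.ofReal_lt_top).ne
  rw [← ofReal_integral_eq_lintegral_ofReal hint₀ h₀_nonneg,
    ENNReal.ofReal_le_ofReal_iff hc₀] at hlintegral
  exact ⟨hint₀, hlintegral⟩

theorem integral_nonneg_of_tendsto_of_le {f Φ : ℕ → α → ℝ} {f₀ Φ₀ : α → ℝ}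
    (hf : ∀ m, Integrable (f m) μ) (hΦ : ∀ m, Integrable (Φ m) μ) (hΦ₀ : Integrable Φ₀ μ)
    (hle : ∀ m, f m ≤ᵐ[μ] Φ m)
    (hlim : ∀ᵐ x ∂μ, Tendsto (fun m => f m x) atTop (𝓝 (f₀ x)))
    (hΦlim : ∀ᵐ x ∂μ, Tendsto (fun m => Φ m x) atTop (𝓝 (Φ₀ x)))
    (hΦint : Tendsto (fun m => ∫ x, Φ m x ∂μ) atTop (𝓝 (∫ x, Φ₀ x ∂μ)))
    (hnonneg : ∀ m, 0 ≤ ∫ x, f m x ∂μ) : Integrable f₀ μ ∧ 0 ≤ ∫ x, f₀ x ∂μ := by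
  obtain ⟨hint, hint_le⟩ := integrable_and_integral_le_of_tendsto (μ := μ)
    (h := fun m x => Φ m x - f m x) (h₀ := fun x => Φ₀ x - f₀ x) (fun m => (hΦ m).sub (hf m))
    (fun m => (hle m).mono fun x hx => sub_nonneg.2 hx)
    (by filter_upwards [hlim, hΦlim] with x hx hxΦ using hxΦ.sub hx)
    (fun m => by rw [integral_sub (hΦ m) (hf m)]; linarith [hnonneg m]) hΦint
  have hf₀ : Integrable f₀ μ :=
    (hΦ₀.sub hint).congr (.of_forall fun x => sub_sub_cancel _ _)
  rw [integral_sub hΦ₀ hf₀] at hint_le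
  exact ⟨hf₀, by linarith⟩

end Limits

theorem integral_fderiv_eq_zero {E : Type*} [NormedAddCommGroup E] [NormedSpace ℝ E]
    [FiniteDimensional ℝ E] [MeasurableSpace E] [BorelSpace E] (μ : Measure E)
    [μ.IsAddHaarMeasure] {ψ : E → ℝ} (hψ : ContDiff ℝ 1 ψ) (hsupp : HasCompactSupport ψ) (e : E) :
    ∫ z, fderiv ℝ ψ z e ∂μ = 0 := by
  have hint : Integrable (fun z => fderiv ℝ ψ z e) μ :=
    ((hψ.continuous_fderiv one_ne_zero).clm_apply continuous_const).integrable_of_hasCompactSupport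
      (hsupp.fderiv_apply ℝ e)
  simpa using integral_mul_fderiv_eq_neg_fderiv_mul_of_integrable (μ := μ)
    (f := fun _ => (1 : ℝ)) (g := ψ) (v := e) (by simp) (by simpa using hint)
    (by simpa using hψ.continuous.integrable_of_hasCompactSupport hsupp) (by simp)
    fun z _ => hψ.differentiable one_ne_zero z

section Mollification

open ContinuousLinearMap

/-- A sequence of bump functions whose supports shrink to the origin, all contained in the ball of
radius `r`. -/
noncomputable def shrinkingBump (E : Type*) [NormedAddCommGroup E] (r : ℝ) (hr : 0 < r) (m : ℕ) :
    ContDiffBump (0 : E) where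
  rIn := r / (2 * (m + 1))
  rOut := r / (m + 1)
  rIn_pos := by positivity
  rIn_lt_rOut := by
    have : (0 : ℝ) < m + 1 := by positivity
    exact div_lt_div_of_pos_left hr this (by linarith)

theorem shrinkingBump_rOut_le {E : Type*} [NormedAddCommGroup E] {r : ℝ} (hr : 0 < r) (m : ℕ) :
    (shrinkingBump E r hr m).rOut ≤ r :=
  div_le_self hr.le (by simp)

variable {E : Type*} [NormedAddCommGroup E] [NormedSpace ℝ E] [FiniteDimensional ℝ E]
  [MeasureSpace E]
  {F : Type*} [NormedAddCommGroup F] [NormedSpace ℝ F]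

/-- The mollification of `f` by the normalized bump function `φ`. -/
noncomputable def mollify (φ : ContDiffBump (0 : E)) (f : E → F) : E → F :=
  convolution (φ.normed volume) f (lsmul ℝ ℝ) volume

/-- The probability measure with density `φ(z - ·)`, against which the mollification by `φ` is an
average. -/
noncomputable def bumpMeasure (φ : ContDiffBump (0 : E)) (z : E) : Measure E :=
  volume.withDensity fun y => (φ.normed volume (z - y)).toNNReal

variable (φ : ContDiffBump (0 : E))

theorem continuous_normed_sub (z : E) : Continuous fun y => φ.normed volume (z - y) :=
  φ.continuous_normed.comp (continuous_const.sub continuous_id)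

theorem bumpMeasure_absolutelyContinuous (z : E) : bumpMeasure φ z ≪ volume :=
  withDensity_absolutelyContinuous _ _

variable [BorelSpace E] [(volume : Measure E).IsAddHaarMeasure]

theorem ae_tendsto_mollify_shrinkingBump [CompleteSpace F] {f : E → F}
    (hf : LocallyIntegrable f) {r : ℝ} (hr : 0 < r) :
    ∀ᵐ z, Tendsto (fun m => mollify (shrinkingBump E r hr m) f z) atTop (𝓝 (f z)) := by
  refine ContDiffBump.ae_convolution_tendsto_right_of_locallyIntegrable (K := 2) ?_
    (.of_forall fun m => le_of_eq ?_) hf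
  · have h := (tendsto_one_div_add_atTop_nhds_zero_nat (𝕜 := ℝ)).const_mul r
    simpa only [shrinkingBump, mul_zero, mul_one_div] using h
  · simp only [shrinkingBump]
    field_simp

theorem mollify_apply (f : E → F) (z : E) :
    mollify φ f z = ∫ y, φ.normed volume (z - y) • f y :=
  convolution_lsmul_swap

theorem integrable_normed_sub_smul {f : E → F} (hf : Integrable f) (z : E) :
    Integrable fun y => φ.normed volume (z - y) • f y := by
  obtain ⟨C, hC⟩ := φ.continuous_normed.bounded_above_of_compact_support
    (φ.hasCompactSupport_normed (μ := volume))
  exact hf.bdd_smul C (continuous_normed_sub φ z).aestronglyMeasurable (.of_forall fun y => hC _)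

theorem integral_bumpMeasure (f : E → F) (z : E) : ∫ y, f y ∂bumpMeasure φ z = mollify φ f z := by
  rw [bumpMeasure, integral_withDensity_eq_integral_smul
    (continuous_normed_sub φ z).measurable.real_toNNReal, mollify_apply]
  simp only [NNReal.smul_def, Real.coe_toNNReal _ (φ.nonneg_normed _)]

theorem integrable_bumpMeasure {f : E → F} (hf : Integrable f) (z : E) :
    Integrable f (bumpMeasure φ z) := by
  rw [bumpMeasure, integrable_withDensity_iff_integrable_smul
    (continuous_normed_sub φ z).measurable.real_toNNReal]
  simpa only [NNReal.smul_def, Real.coe_toNNReal _ (φ.nonneg_normed _)] using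
    integrable_normed_sub_smul φ hf z

instance (z : E) : IsProbabilityMeasure (bumpMeasure φ z) where
  measure_univ := by
    have hone : ∫ y, φ.normed volume (z - y) = 1 := by
      rw [integral_sub_left_eq_self (φ.normed volume ·) volume z, φ.integral_normed]
    rw [bumpMeasure, withDensity_apply _ .univ, setLIntegral_univ]
    change ∫⁻ y, ENNReal.ofReal (φ.normed volume (z - y)) = 1
    rw [← ofReal_integral_eq_lintegral_ofReal (φ.integrable_normed.comp_sub_left z)
      (.of_forall fun y => φ.nonneg_normed _), hone, ENNReal.ofReal_one]

theorem integrable_mollify {f : E → F} (hf : Integrable f) : Integrable (mollify φ f) :=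
  φ.integrable_normed.integrable_convolution (lsmul ℝ ℝ) hf

theorem integral_mollify [CompleteSpace F] {f : E → F} (hf : Integrable f) :
    ∫ z, mollify φ f z = ∫ z, f z := by
  rw [mollify, integral_convolution _ φ.integrable_normed hf]
  simp [φ.integral_normed]

theorem contDiff_mollify {f : E → F} (hf : LocallyIntegrable f) : ContDiff ℝ ∞ (mollify φ f) :=
  φ.hasCompactSupport_normed.contDiff_convolution_left _ φ.contDiff_normed hf

theorem norm_mollify_le {f : E → F} {M : ℝ} (hM : ∀ᵐ z, ‖f z‖ ≤ M) (z : E) :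
    ‖mollify φ f z‖ ≤ M := by
  rw [← integral_bumpMeasure]
  simpa using norm_integral_le_of_norm_le_const ((bumpMeasure_absolutelyContinuous φ z).ae_le hM)

theorem norm_mollify_le_mollify_norm (f : E → F) (z : E) :
    ‖mollify φ f z‖ ≤ mollify φ (fun y => ‖f y‖) z := by
  simpa only [integral_bumpMeasure] using norm_integral_le_integral_norm (μ := bumpMeasure φ z) f

theorem mollify_nonneg {f : E → ℝ} (hf : ∀ z, 0 ≤ f z) (z : E) : 0 ≤ mollify φ f z := by
  rw [← integral_bumpMeasure]
  exact integral_nonneg hf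

theorem mollify_fun_add {f g : E → F} (hf : Integrable f) (hg : Integrable g) (z : E) :
    mollify φ (fun y => f y + g y) z = mollify φ f z + mollify φ g z := by
  simp only [← integral_bumpMeasure]
  exact integral_add (integrable_bumpMeasure φ hf z) (integrable_bumpMeasure φ hg z)

theorem integral_mul_integral_le {α : Type*} [MeasurableSpace α] {μ : Measure α}
    [IsProbabilityMeasure μ] {a b h : α → ℝ} (ha : Integrable a μ) (hb : Integrable b μ)
    (hh : Integrable h μ) (hab : ∀ x y, a x * b y ≤ h x + h y) :
    (∫ x, a x ∂μ) * ∫ y, b y ∂μ ≤ 2 * ∫ x, h x ∂μ := by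
  have hinner : ∀ x, a x * ∫ y, b y ∂μ ≤ h x + ∫ y, h y ∂μ := fun x => calc
    a x * ∫ y, b y ∂μ = ∫ y, a x * b y ∂μ := (integral_const_mul _ _).symm
    _ ≤ ∫ y, (h x + h y) ∂μ :=
      integral_mono (hb.const_mul _) ((integrable_const _).add hh) (hab x)
    _ = h x + ∫ y, h y ∂μ := by simp [integral_add (integrable_const _) hh]
  calc (∫ x, a x ∂μ) * ∫ y, b y ∂μ = ∫ x, a x * ∫ y, b y ∂μ ∂μ := (integral_mul_const _ _).symm
    _ ≤ ∫ x, (h x + ∫ y, h y ∂μ) ∂μ :=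
      integral_mono (ha.mul_const _) (hh.add (integrable_const _)) hinner
    _ = 2 * ∫ x, h x ∂μ := by simp [integral_add hh (integrable_const _), two_mul]

theorem mollify_mul_mollify_le {a b h : E → ℝ} (ha : Integrable a) (hb : Integrable b)
    (hh : Integrable h) (hab : ∀ y y', a y * b y' ≤ h y + h y') (z : E) :
    mollify φ a z * mollify φ b z ≤ 2 * mollify φ h z := by
  simpa only [integral_bumpMeasure] using integral_mul_integral_le (integrable_bumpMeasure φ ha z)
    (integrable_bumpMeasure φ hb z) (integrable_bumpMeasure φ hh z) hab

theorem integral_inner_mollify {H : Type*} [NormedAddCommGroup H] [InnerProductSpace ℝ H]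
    [CompleteSpace H] {f ψ : E → H} (hf : Integrable f) (hψ : Integrable ψ) :
    ∫ y, inner ℝ (f y) (mollify φ ψ y) = ∫ z, inner ℝ (mollify φ f z) (ψ z) := by
  obtain ⟨C, hC⟩ := φ.continuous_normed.bounded_above_of_compact_support
    (φ.hasCompactSupport_normed (μ := volume))
  have hleft : ∀ y, inner ℝ (f y) (mollify φ ψ y)
      = ∫ z, φ.normed volume (y - z) * inner ℝ (f y) (ψ z) := fun y => by
    rw [mollify_apply, ← integral_inner (integrable_normed_sub_smul φ hψ y)]
    simp only [inner_smul_right]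
  have hright : ∀ z, inner ℝ (mollify φ f z) (ψ z)
      = ∫ y, φ.normed volume (y - z) * inner ℝ (f y) (ψ z) := fun z => by
    rw [mollify_apply, real_inner_comm, ← integral_inner (integrable_normed_sub_smul φ hf z)]
    refine integral_congr_ae (.of_forall fun y => ?_)
    simp only [inner_smul_right, real_inner_comm (f y), ← φ.normed_neg (z - y), neg_sub]
  have hprod : Integrable (fun p : E × E => inner ℝ (f p.1) (ψ p.2))
      ((volume : Measure E).prod volume) :=
    (hf.norm.mul_prod hψ.norm).mono'
      (hf.aestronglyMeasurable.comp_fst.inner hψ.aestronglyMeasurable.comp_snd)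
      (.of_forall fun p => norm_inner_le_norm _ _)
  simp only [hleft, hright]
  exact integral_integral_swap (hprod.bdd_mul (c := C)
    (φ.continuous_normed.comp (continuous_fst.sub continuous_snd)).aestronglyMeasurable
    (.of_forall fun p => hC _))

theorem fderiv_mollify {ψ : E → F} (hψ : ContDiff ℝ 1 ψ) (hsupp : HasCompactSupport ψ)
    (z : E) : fderiv ℝ (mollify φ ψ) z = mollify φ (fderiv ℝ ψ) z :=
  (hsupp.hasFDerivAt_convolution_right (lsmul ℝ ℝ)
    φ.continuous_normed.locallyIntegrable hψ z).fderiv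

theorem fderiv_mollify_eq_integral {f : E → ℝ} (hf : LocallyIntegrable f) (z : E) :
    fderiv ℝ (mollify φ f) z = ∫ y, f y • fderiv ℝ (φ.normed volume) (z - y) := by
  refine ((φ.hasCompactSupport_normed (μ := volume)).hasFDerivAt_convolution_left (lsmul ℝ ℝ)
    (μ := volume) (φ.contDiff_normed (n := 1)) hf z).fderiv.trans ?_
  rw [convolution_eq_swap]
  refine integral_congr_ae (.of_forall fun y => ContinuousLinearMap.ext fun e => ?_)
  simp [mul_comm]

theorem map_mollify {F' : Type*} [NormedAddCommGroup F'] [NormedSpace ℝ F'] [CompleteSpace F]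
    [CompleteSpace F'] (T : F →L[ℝ] F') {f : E → F} (hf : Integrable f) (z : E) :
    T (mollify φ f z) = mollify φ (fun y => T (f y)) z := by
  simp only [mollify_apply, ← T.integral_comp_comm (integrable_normed_sub_smul φ hf z),
    map_smul]

theorem tsupport_mollify_subset (ψ : E → F) :
    tsupport (mollify φ ψ) ⊆ Metric.cthickening φ.rOut (tsupport ψ) := by
  refine closure_minimal (fun z hz => ?_) Metric.isClosed_cthickening
  obtain ⟨x, hx, y, hy, rfl⟩ := support_convolution_subset (lsmul ℝ ℝ) hz
  rw [φ.support_normed_eq, mem_ball_zero_iff] at hx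
  exact Metric.mem_cthickening_of_dist_le _ y _ _ (subset_tsupport ψ hy) (by simpa using hx.le)

theorem tsupport_mollify_subset_of_forall_closedBall_subset {ψ : E → F}
    (hsupp : HasCompactSupport ψ) {U : Set E}
    (hU : ∀ z ∈ tsupport ψ, Metric.closedBall z φ.rOut ⊆ U) : tsupport (mollify φ ψ) ⊆ U := by
  refine (tsupport_mollify_subset φ ψ).trans ?_
  rw [hsupp.isCompact.cthickening_eq_biUnion_closedBall φ.rOut_pos.le]
  exact iUnion₂_subset hU

end Mollification

section SpaceTimeCalculus

variable {n : ℕ}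

instance : (volume : Measure (SpaceTime n)).IsAddHaarMeasure :=
  inferInstanceAs ((volume : Measure (Space n)).prod (volume : Measure ℝ)).IsAddHaarMeasure

/-- The vector in `ℝⁿ` that represents the restriction of a linear form on space-time to the
spatial directions; it turns the derivative of a function into its spatial gradient. -/
noncomputable def spatialPart (n : ℕ) : (SpaceTime n →L[ℝ] ℝ) →L[ℝ] Space n :=
  LinearMap.toContinuousLinearMap
    { toFun := fun ℓ => (InnerProductSpace.toDual ℝ (Space n)).symm
        (ℓ.comp (ContinuousLinearMap.inl ℝ (Space n) ℝ))
      map_add' := fun ℓ ℓ' => by rw [ContinuousLinearMap.add_comp, map_add]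
      map_smul' := fun c ℓ => by
        rw [ContinuousLinearMap.smul_comp, map_smulₛₗ, starRingEnd_apply, star_trivial,
          RingHom.id_apply] }

theorem inner_spatialPart (ℓ : SpaceTime n →L[ℝ] ℝ) (e : Space n) :
    inner ℝ (spatialPart n ℓ) e = ℓ (e, 0) := by
  simp [spatialPart]

theorem timeDeriv_eq {η : SpaceTime n → ℝ} {z : SpaceTime n} (hη : DifferentiableAt ℝ η z) :
    timeDeriv η z = fderiv ℝ η z (0, 1) :=
  (hη.hasFDerivAt.comp_hasDerivAt z.2
    ((hasDerivAt_const z.2 z.1).prodMk (hasDerivAt_id z.2))).deriv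

theorem spaceGrad_eq {η : SpaceTime n → ℝ} {z : SpaceTime n} (hη : DifferentiableAt ℝ η z) :
    spaceGrad η z = spatialPart n (fderiv ℝ η z) := by
  have hslice : HasFDerivAt (fun x : Space n => η (x, z.2))
      ((fderiv ℝ η z).comp (ContinuousLinearMap.inl ℝ (Space n) ℝ)) z.1 :=
    hη.hasFDerivAt.comp z.1 ((hasFDerivAt_id z.1).prodMk (hasFDerivAt_const z.2 z.1))
  simp [spaceGrad, gradient, spatialPart, hslice.fderiv]

theorem fderiv_eq_zero_of_notMem_tsupport {η : SpaceTime n → ℝ} {z : SpaceTime n}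
    (hz : z ∉ tsupport η) : fderiv ℝ η z = 0 :=
  image_eq_zero_of_notMem_tsupport fun h => hz (tsupport_fderiv_subset ℝ h)

theorem differentiableAt_of_notMem_tsupport {η : SpaceTime n → ℝ} {z : SpaceTime n}
    (hz : z ∉ tsupport η) : DifferentiableAt ℝ η z :=
  (differentiableAt_const (0 : ℝ)).congr_of_eventuallyEq (notMem_tsupport_iff_eventuallyEq.1 hz)

theorem timeDeriv_eq_zero {η : SpaceTime n → ℝ} {z : SpaceTime n} (hz : z ∉ tsupport η) :
    timeDeriv η z = 0 := by
  simp [timeDeriv_eq (differentiableAt_of_notMem_tsupport hz),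
    fderiv_eq_zero_of_notMem_tsupport hz]

theorem spaceGrad_eq_zero {η : SpaceTime n → ℝ} {z : SpaceTime n} (hz : z ∉ tsupport η) :
    spaceGrad η z = 0 := by
  simp [spaceGrad_eq (differentiableAt_of_notMem_tsupport hz),
    fderiv_eq_zero_of_notMem_tsupport hz]

namespace IsTestFunction

variable {Q Q' : Set (SpaceTime n)} {η : SpaceTime n → ℝ}

theorem mono (hη : IsTestFunction Q η) (hQ : Q ⊆ Q') : IsTestFunction Q' η :=
  ⟨hη.smooth, hη.compact, hη.support.trans hQ⟩

theorem differentiable (hη : IsTestFunction Q η) : Differentiable ℝ η :=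
  hη.smooth.differentiable (by simp)

theorem integrable (hη : IsTestFunction Q η) : Integrable η :=
  hη.smooth.continuous.integrable_of_hasCompactSupport hη.compact

theorem integrable_fderiv (hη : IsTestFunction Q η) : Integrable (fderiv ℝ η) :=
  (hη.smooth.continuous_fderiv (by simp)).integrable_of_hasCompactSupport (hη.compact.fderiv ℝ)

theorem timeDeriv_eq_fderiv (hη : IsTestFunction Q η) :
    timeDeriv η = fun z => fderiv ℝ η z (0, 1) :=
  funext fun z => timeDeriv_eq (hη.differentiable z)

theorem spaceGrad_eq_spatialPart (hη : IsTestFunction Q η) :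
    spaceGrad η = fun z => spatialPart n (fderiv ℝ η z) :=
  funext fun z => spaceGrad_eq (hη.differentiable z)

theorem continuous_timeDeriv (hη : IsTestFunction Q η) : Continuous (timeDeriv η) := by
  rw [hη.timeDeriv_eq_fderiv]
  exact (hη.smooth.continuous_fderiv (by simp)).clm_apply continuous_const

theorem continuous_spaceGrad (hη : IsTestFunction Q η) : Continuous (spaceGrad η) := by
  rw [hη.spaceGrad_eq_spatialPart]
  exact (spatialPart n).continuous.comp (hη.smooth.continuous_fderiv (by simp))

theorem integrable_timeDeriv (hη : IsTestFunction Q η) : Integrable (timeDeriv η) :=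
  hη.continuous_timeDeriv.integrable_of_hasCompactSupport
    (.intro hη.compact fun _ hz => timeDeriv_eq_zero hz)

theorem integrable_spaceGrad (hη : IsTestFunction Q η) : Integrable (spaceGrad η) :=
  hη.continuous_spaceGrad.integrable_of_hasCompactSupport
    (.intro hη.compact fun _ hz => spaceGrad_eq_zero hz)

theorem exists_norm_timeDeriv_le (hη : IsTestFunction Q η) : ∃ B, ∀ z, |timeDeriv η z| ≤ B :=
  hη.continuous_timeDeriv.bounded_above_of_compact_support
    (.intro hη.compact fun _ hz => timeDeriv_eq_zero hz)

theorem exists_norm_spaceGrad_le (hη : IsTestFunction Q η) : ∃ B, ∀ z, ‖spaceGrad η z‖ ≤ B :=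
  hη.continuous_spaceGrad.bounded_above_of_compact_support
    (.intro hη.compact fun _ hz => spaceGrad_eq_zero hz)

theorem integral_timeDeriv (hη : IsTestFunction Q η) : ∫ z, timeDeriv η z = 0 := by
  rw [hη.timeDeriv_eq_fderiv]
  exact integral_fderiv_eq_zero volume (hη.smooth.of_le (by simp)) hη.compact _

theorem integral_inner_spaceGrad (hη : IsTestFunction Q η) (e : Space n) :
    ∫ z, inner ℝ e (spaceGrad η z) = 0 := by
  simp only [hη.spaceGrad_eq_spatialPart, real_inner_comm _ e, inner_spatialPart]
  exact integral_fderiv_eq_zero volume (hη.smooth.of_le (by simp)) hη.compact _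

theorem setIntegral_eq_integral {F : Type*} [NormedAddCommGroup F] [NormedSpace ℝ F]
    (hη : IsTestFunction Q η) {f : SpaceTime n → F} (hf : ∀ z ∉ tsupport η, f z = 0) :
    ∫ z in Q, f z = ∫ z, f z :=
  setIntegral_eq_integral_of_forall_compl_eq_zero fun z hz => hf z fun h => hz (hη.support h)

theorem setIntegral_smul_spaceGrad (hη : IsTestFunction Q η) (u : SpaceTime n → ℝ) :
    ∫ z in Q, u z • spaceGrad η z = ∫ z, u z • spaceGrad η z :=
  hη.setIntegral_eq_integral fun z hz => by rw [spaceGrad_eq_zero hz, smul_zero]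

theorem setIntegral_smul {F : Type*} [NormedAddCommGroup F] [NormedSpace ℝ F]
    (hη : IsTestFunction Q η) (f : SpaceTime n → F) :
    ∫ z in Q, η z • f z = ∫ z, η z • f z :=
  hη.setIntegral_eq_integral fun z hz => by rw [image_eq_zero_of_notMem_tsupport hz, zero_smul]

theorem setIntegral_mul_timeDeriv (hη : IsTestFunction Q η) (u : SpaceTime n → ℝ) :
    ∫ z in Q, u z * timeDeriv η z = ∫ z, u z * timeDeriv η z :=
  hη.setIntegral_eq_integral fun z hz => by rw [timeDeriv_eq_zero hz, mul_zero]

theorem setIntegral_inner_spaceGrad (hη : IsTestFunction Q η) (f : SpaceTime n → Space n) :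
    ∫ z in Q, inner ℝ (f z) (spaceGrad η z) = ∫ z, inner ℝ (f z) (spaceGrad η z) :=
  hη.setIntegral_eq_integral fun z hz => by rw [spaceGrad_eq_zero hz, inner_zero_right]

theorem integrable_mul_timeDeriv (hη : IsTestFunction Q η) {u : SpaceTime n → ℝ}
    (hu : LocallyIntegrableOn u Q) : Integrable fun z => u z * timeDeriv η z := by
  obtain ⟨B, hB⟩ := hη.exists_norm_timeDeriv_le
  rw [← integrableOn_iff_integrable_of_support_subset (s := tsupport η)
    (Function.support_subset_iff'.2 fun z hz => by rw [timeDeriv_eq_zero hz, mul_zero])]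
  exact (hu.integrableOn_compact_subset hη.support hη.compact).mul_bdd (c := B)
    hη.continuous_timeDeriv.aestronglyMeasurable (.of_forall hB)

theorem integrable_inner_spaceGrad (hη : IsTestFunction Q η) {f : SpaceTime n → Space n}
    (hf : LocallyIntegrableOn f Q) : Integrable fun z => inner ℝ (f z) (spaceGrad η z) := by
  obtain ⟨B, hB⟩ := hη.exists_norm_spaceGrad_le
  rw [← integrableOn_iff_integrable_of_support_subset (s := tsupport η)
    (Function.support_subset_iff'.2 fun z hz => by rw [spaceGrad_eq_zero hz, inner_zero_right])]
  have hf' := hf.integrableOn_compact_subset hη.support hη.compact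
  refine (hf'.norm.mul_const B).mono'
    (hf'.aestronglyMeasurable.inner hη.continuous_spaceGrad.aestronglyMeasurable)
    (.of_forall fun z => (norm_inner_le_norm _ _).trans ?_)
  gcongr
  exact hB z

theorem mollify {φ : ContDiffBump (0 : SpaceTime n)}
    (hη : IsTestFunction {z | Metric.closedBall z φ.rOut ⊆ Q} η) :
    IsTestFunction Q (mollify φ η) where
  smooth := contDiff_mollify φ hη.integrable.locallyIntegrable
  compact := φ.hasCompactSupport_normed.convolution _ hη.compact
  support := tsupport_mollify_subset_of_forall_closedBall_subset φ hη.compact hη.support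

theorem timeDeriv_mollify (hη : IsTestFunction Q η) (φ : ContDiffBump (0 : SpaceTime n))
    (z : SpaceTime n) : timeDeriv (_root_.mollify φ η) z = _root_.mollify φ (timeDeriv η) z := by
  rw [timeDeriv_eq ((contDiff_mollify φ hη.integrable.locallyIntegrable).differentiable
      (by simp) z), fderiv_mollify φ (hη.smooth.of_le (by simp)) hη.compact,
    hη.timeDeriv_eq_fderiv]
  exact map_mollify φ (ContinuousLinearMap.apply ℝ ℝ ((0 : Space n), (1 : ℝ)))
    hη.integrable_fderiv z

theorem spaceGrad_mollify (hη : IsTestFunction Q η) (φ : ContDiffBump (0 : SpaceTime n))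
    (z : SpaceTime n) : spaceGrad (_root_.mollify φ η) z = _root_.mollify φ (spaceGrad η) z := by
  rw [spaceGrad_eq ((contDiff_mollify φ hη.integrable.locallyIntegrable).differentiable
      (by simp) z), fderiv_mollify φ (hη.smooth.of_le (by simp)) hη.compact,
    hη.spaceGrad_eq_spatialPart]
  exact map_mollify φ (spatialPart n) hη.integrable_fderiv z

end IsTestFunction

theorem isTestFunction_normed_sub {U : Set (SpaceTime n)} {φ : ContDiffBump (0 : SpaceTime n)}
    {z : SpaceTime n} (hz : Metric.closedBall z φ.rOut ⊆ U) :
    IsTestFunction U fun y => φ.normed volume (z - y) where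
  smooth := φ.contDiff_normed.comp (contDiff_const.sub contDiff_id)
  compact := φ.hasCompactSupport_normed.comp_homeomorph (Homeomorph.subLeft z)
  support := by
    refine (closure_minimal (fun y hy => ?_) Metric.isClosed_closedBall).trans hz
    have hball : z - y ∈ Function.support (φ.normed volume) := hy
    rw [φ.support_normed_eq, mem_ball_zero_iff, ← dist_eq_norm, dist_comm] at hball
    exact hball.le

theorem spaceGrad_normed_sub (φ : ContDiffBump (0 : SpaceTime n)) (z y : SpaceTime n) :
    spaceGrad (fun y => φ.normed volume (z - y)) y
      = -spatialPart n (fderiv ℝ (φ.normed volume) (z - y)) := by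
  have hφ : HasFDerivAt (φ.normed volume) (fderiv ℝ (φ.normed volume) (z - y)) (z - y) :=
    (φ.contDiff_normed.differentiable one_ne_zero _).hasFDerivAt
  have hcomp := hφ.comp y ((hasFDerivAt_id y).const_sub z)
  rw [← map_neg]
  refine (spaceGrad_eq hcomp.differentiableAt).trans (congrArg _ (hcomp.fderiv.trans ?_))
  exact ContinuousLinearMap.ext fun e => by simp

theorem IsWeakSpaceGrad.spaceGrad_mollify {U : Set (SpaceTime n)} {u : SpaceTime n → ℝ}
    {Du : SpaceTime n → Space n} (h : IsWeakSpaceGrad U u Du) (hu : Integrable u)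
    {φ : ContDiffBump (0 : SpaceTime n)} {z : SpaceTime n}
    (hz : Metric.closedBall z φ.rOut ⊆ U) :
    spaceGrad (mollify φ u) z = mollify φ Du z := by
  have htest := isTestFunction_normed_sub hz
  have hfderiv : Continuous (fderiv ℝ (φ.normed volume)) :=
    φ.contDiff_normed.continuous_fderiv one_ne_zero
  have hint : Integrable fun y => u y • fderiv ℝ (φ.normed volume) (z - y) := by
    obtain ⟨C, hC⟩ := hfderiv.bounded_above_of_compact_support
      (φ.hasCompactSupport_normed.fderiv ℝ)
    exact hu.smul_bdd C (hfderiv.comp (continuous_const.sub continuous_id)).aestronglyMeasurable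
      (.of_forall fun y => hC _)
  calc spaceGrad (mollify φ u) z
      = ∫ y, u y • spatialPart n (fderiv ℝ (φ.normed volume) (z - y)) := by
        rw [spaceGrad_eq ((contDiff_mollify φ hu.locallyIntegrable).differentiable (by simp) z),
          fderiv_mollify_eq_integral φ hu.locallyIntegrable,
          ← (spatialPart n).integral_comp_comm hint]
        simp only [map_smul]
    _ = -∫ y, u y • spaceGrad (fun y => φ.normed volume (z - y)) y := by
        simp only [spaceGrad_normed_sub, smul_neg, integral_neg, neg_neg]
    _ = -∫ y in U, u y • spaceGrad (fun y => φ.normed volume (z - y)) y := by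
        rw [htest.setIntegral_smul_spaceGrad]
    _ = ∫ y in U, φ.normed volume (z - y) • Du y := by rw [h.byParts _ htest, neg_neg]
    _ = ∫ y, φ.normed volume (z - y) • Du y := htest.setIntegral_smul Du
    _ = mollify φ Du z := (mollify_apply φ Du z).symm

end SpaceTimeCalculus

section Comparison

variable {n : ℕ} {Q U : Set (SpaceTime n)} {θ : SpaceTime n → ℝ}

/-- The supersolution property for a general flux: `v` has the weak spatial gradient `D` and
`∂ₜv - div F ≥ 0` in the sense of distributions on `Q`. Test functions vanish off `Q`, which allows
integrals over the whole space. -/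
structure IsFluxSupersolution (Q : Set (SpaceTime n)) (v : SpaceTime n → ℝ)
    (D F : SpaceTime n → Space n) : Prop where
  weakGrad : IsWeakSpaceGrad Q v D
  locInt_flux : LocallyIntegrableOn F Q
  nonneg : ∀ η, IsTestFunction Q η → (∀ z, 0 ≤ η z) →
    0 ≤ ∫ z, (inner ℝ (F z) (spaceGrad η z) - v z * timeDeriv η z)

/-- A smooth function `S` with primitive `W` and derivative `S'` such that `|S| ≤ δ` on `[-B, B]`.
The functions `(δ ∓ S(v₁ - v₂)) θ` are then admissible for two functions with `|v₁ - v₂| ≤ B`. -/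
structure IsTruncation (W S S' : ℝ → ℝ) (B δ : ℝ) : Prop where
  contDiff : ContDiff ℝ ∞ S
  hasDerivAt_primitive : ∀ x, HasDerivAt W (S x) x
  hasDerivAt : ∀ x, HasDerivAt S (S' x) x
  bounded : ∀ x, |x| ≤ B → |S x| ≤ δ

/-- The integrand obtained when the inequalities for two supersolutions with gradients `Da`, `Db`
and fluxes `Fa`, `Fb` are tested with `(δ - S(a - b)) θ` and `(δ + S(a - b)) θ` and added. -/
noncomputable def comparisonIntegrand (W S S' : ℝ → ℝ) (δ : ℝ) (θ a b : SpaceTime n → ℝ)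
    (Da Db Fa Fb : SpaceTime n → Space n) (z : SpaceTime n) : ℝ :=
  (W (a z - b z) - δ * (a z + b z)) * timeDeriv θ z
    + δ * inner ℝ (Fa z + Fb z) (spaceGrad θ z)
    - S (a z - b z) * inner ℝ (Fa z - Fb z) (spaceGrad θ z)
    - S' (a z - b z) * θ z * inner ℝ (Fa z - Fb z) (Da z - Db z)

theorem IsWeakSpaceGrad.mono {u : SpaceTime n → ℝ} {Du : SpaceTime n → Space n}
    (h : IsWeakSpaceGrad Q u Du) (hU : U ⊆ Q) : IsWeakSpaceGrad U u Du where
  locInt := h.locInt.mono_set hU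
  locInt_grad := h.locInt_grad.mono_set hU
  byParts φ hφ := by
    have hbyParts := h.byParts φ (hφ.mono hU)
    rwa [(hφ.mono hU).setIntegral_smul_spaceGrad, (hφ.mono hU).setIntegral_smul,
      ← hφ.setIntegral_smul_spaceGrad, ← hφ.setIntegral_smul] at hbyParts

theorem IsWeakSpaceGrad.indicator {u : SpaceTime n → ℝ} {Du : SpaceTime n → Space n}
    (h : IsWeakSpaceGrad U u Du) (hU : MeasurableSet U) :
    IsWeakSpaceGrad U (U.indicator u) (U.indicator Du) where
  locInt x hx := (h.locInt x hx).imp fun _ hs => ⟨hs.1, hs.2.indicator hU⟩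
  locInt_grad x hx := (h.locInt_grad x hx).imp fun _ hs => ⟨hs.1, hs.2.indicator hU⟩
  byParts φ hφ := by
    have hbyParts := h.byParts φ hφ
    rwa [setIntegral_congr_fun (g := fun z => U.indicator u z • spaceGrad φ z) hU
        fun z hz => by simp only [indicator_of_mem hz],
      setIntegral_congr_fun (f := fun z => φ z • Du z) (g := fun z => φ z • U.indicator Du z) hU
        fun z hz => by simp only [indicator_of_mem hz]] at hbyParts

namespace IsFluxSupersolution

variable {v : SpaceTime n → ℝ} {D F : SpaceTime n → Space n}

theorem mono (h : IsFluxSupersolution Q v D F) (hU : U ⊆ Q) : IsFluxSupersolution U v D F where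
  weakGrad := h.weakGrad.mono hU
  locInt_flux := h.locInt_flux.mono_set hU
  nonneg η hη := h.nonneg η (hη.mono hU)

theorem indicator (h : IsFluxSupersolution U v D F) (hU : MeasurableSet U) :
    IsFluxSupersolution U (U.indicator v) (U.indicator D) (U.indicator F) where
  weakGrad := h.weakGrad.indicator hU
  locInt_flux x hx := (h.locInt_flux x hx).imp fun _ hs => ⟨hs.1, hs.2.indicator hU⟩
  nonneg η hη hη₀ := by
    refine (h.nonneg η hη hη₀).trans_eq (integral_congr_ae (.of_forall fun z => ?_))
    by_cases hz : z ∈ U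
    · simp only [indicator_of_mem hz]
    · have hzη : z ∉ tsupport η := fun h => hz (hη.support h)
      simp only [spaceGrad_eq_zero hzη, timeDeriv_eq_zero hzη, inner_zero_right, mul_zero]

theorem nonneg_mollify (h : IsFluxSupersolution U v D F) (hv : Integrable v) (hF : Integrable F)
    {φ : ContDiffBump (0 : SpaceTime n)} {η : SpaceTime n → ℝ}
    (hη : IsTestFunction {z | Metric.closedBall z φ.rOut ⊆ U} η) (hη₀ : ∀ z, 0 ≤ η z) :
    0 ≤ ∫ z, (inner ℝ (mollify φ F z) (spaceGrad η z) - mollify φ v z * timeDeriv η z) := by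
  have hspace := integral_inner_mollify φ hF hη.integrable_spaceGrad
  have htime := integral_inner_mollify φ hv hη.integrable_timeDeriv
  simp only [Real.inner_apply, ← hη.spaceGrad_mollify, ← hη.timeDeriv_mollify] at hspace htime
  have hnonneg := h.nonneg _ hη.mollify (mollify_nonneg φ hη₀)
  rw [integral_sub (hη.mollify.integrable_inner_spaceGrad h.locInt_flux)
    (hη.mollify.integrable_mul_timeDeriv h.weakGrad.locInt), hspace, htime] at hnonneg
  have hF' := (integrable_mollify φ hF).locallyIntegrable.locallyIntegrableOn univ
  have hv' := (integrable_mollify φ hv).locallyIntegrable.locallyIntegrableOn univ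
  replace hη := hη.mono (subset_univ _)
  rwa [integral_sub (hη.integrable_inner_spaceGrad hF') (hη.integrable_mul_timeDeriv hv')]

end IsFluxSupersolution

theorem IsTestFunction.comp_mul (hθ : IsTestFunction U θ) {f : ℝ → ℝ} (hf : ContDiff ℝ ∞ f)
    {w : SpaceTime n → ℝ} (hw : ContDiff ℝ ∞ w) : IsTestFunction U fun z => f (w z) * θ z where
  smooth := (hf.comp hw).mul hθ.smooth
  compact := hθ.compact.mul_left
  support := (tsupport_mul_subset_right).trans hθ.support

theorem hasFDerivAt_comp_mul {f : ℝ → ℝ} {f' : ℝ} {w : SpaceTime n → ℝ} {z : SpaceTime n}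
    (hf : HasDerivAt f f' (w z)) (hw : DifferentiableAt ℝ w z) (hθ : DifferentiableAt ℝ θ z) :
    HasFDerivAt (fun z => f (w z) * θ z)
      (f (w z) • fderiv ℝ θ z + (f' * θ z) • fderiv ℝ w z) z := by
  refine ((hf.comp_hasFDerivAt z hw.hasFDerivAt).mul hθ.hasFDerivAt).congr_fderiv ?_
  simp only [Function.comp_apply, smul_smul, mul_comm]

theorem timeDeriv_comp_mul {f : ℝ → ℝ} {f' : ℝ} {w : SpaceTime n → ℝ} {z : SpaceTime n}
    (hf : HasDerivAt f f' (w z)) (hw : DifferentiableAt ℝ w z) (hθ : DifferentiableAt ℝ θ z) :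
    timeDeriv (fun z => f (w z) * θ z) z
      = f (w z) * timeDeriv θ z + f' * θ z * timeDeriv w z := by
  have h := hasFDerivAt_comp_mul hf hw hθ
  rw [timeDeriv_eq h.differentiableAt, h.fderiv, timeDeriv_eq hw, timeDeriv_eq hθ]
  rfl

theorem spaceGrad_comp_mul {f : ℝ → ℝ} {f' : ℝ} {w : SpaceTime n → ℝ} {z : SpaceTime n}
    (hf : HasDerivAt f f' (w z)) (hw : DifferentiableAt ℝ w z) (hθ : DifferentiableAt ℝ θ z) :
    spaceGrad (fun z => f (w z) * θ z) z
      = f (w z) • spaceGrad θ z + (f' * θ z) • spaceGrad w z := by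
  have h := hasFDerivAt_comp_mul hf hw hθ
  rw [spaceGrad_eq h.differentiableAt, h.fderiv, spaceGrad_eq hw, spaceGrad_eq hθ, map_add,
    map_smul, map_smul]

theorem spaceGrad_sub {a b : SpaceTime n → ℝ} {z : SpaceTime n} (ha : DifferentiableAt ℝ a z)
    (hb : DifferentiableAt ℝ b z) :
    spaceGrad (fun z => a z - b z) z = spaceGrad a z - spaceGrad b z := by
  rw [spaceGrad_eq (ha.fun_sub hb), fderiv_fun_sub ha hb, map_sub, spaceGrad_eq ha, spaceGrad_eq hb]

theorem comparisonIntegrand_congr {W S S' : ℝ → ℝ} {δ : ℝ} {a a' b b' : SpaceTime n → ℝ}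
    {Da Da' Db Db' Fa Fa' Fb Fb' : SpaceTime n → Space n} (ha : EqOn a a' (tsupport θ))
    (hb : EqOn b b' (tsupport θ)) (hDa : EqOn Da Da' (tsupport θ)) (hDb : EqOn Db Db' (tsupport θ))
    (hFa : EqOn Fa Fa' (tsupport θ)) (hFb : EqOn Fb Fb' (tsupport θ)) :
    comparisonIntegrand W S S' δ θ a b Da Db Fa Fb
      = comparisonIntegrand W S S' δ θ a' b' Da' Db' Fa' Fb' := by
  funext z
  by_cases hz : z ∈ tsupport θ
  · simp only [comparisonIntegrand, ha hz, hb hz, hDa hz, hDb hz, hFa hz, hFb hz]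
  · simp only [comparisonIntegrand, timeDeriv_eq_zero hz, spaceGrad_eq_zero hz,
      image_eq_zero_of_notMem_tsupport hz, inner_zero_right, mul_zero, zero_mul]

theorem abs_comparisonIntegrand_le {W S S' : ℝ → ℝ} {δ T m : ℝ} {a b : SpaceTime n → ℝ}
    {Da Db Fa Fb : SpaceTime n → Space n} {z : SpaceTime n} (hW : |W (a z - b z)| ≤ T)
    (hS : |S (a z - b z)| ≤ T) (hS' : |S' (a z - b z)| ≤ T) (hδ : |δ| ≤ T) (hθ : |θ z| ≤ T)
    (htime : |timeDeriv θ z| ≤ T) (hspace : ‖spaceGrad θ z‖ ≤ T) (hab : |a z + b z| ≤ m) :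
    |comparisonIntegrand W S S' δ θ a b Da Db Fa Fb z|
      ≤ (2 + m) * T ^ 2 * (1 + (‖Fa z‖ + ‖Fb z‖) * (1 + (‖Da z‖ + ‖Db z‖))) := by
  have hT : 0 ≤ T := (abs_nonneg _).trans hθ
  have hm : 0 ≤ m := (abs_nonneg _).trans hab
  have hinner {p q N : ℝ} {e f : Space n} (hp : |p| ≤ q) (he : ‖e‖ ≤ N) :
      |p * inner ℝ e f| ≤ q * (N * ‖f‖) := by
    rw [abs_mul]
    exact mul_le_mul hp ((abs_real_inner_le_norm _ _).trans (by gcongr)) (abs_nonneg _)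
      ((abs_nonneg _).trans hp)
  have htime_term : |(W (a z - b z) - δ * (a z + b z)) * timeDeriv θ z| ≤ (1 + m) * T ^ 2 := by
    calc _ ≤ (|W (a z - b z)| + |δ| * |a z + b z|) * |timeDeriv θ z| := by
          rw [abs_mul, ← abs_mul δ]
          gcongr
          exact abs_sub _ _
      _ ≤ (T + T * m) * T := by gcongr
      _ = (1 + m) * T ^ 2 := by ring
  have hsum_term := hinner (f := spaceGrad θ z) hδ (norm_add_le (Fa z) (Fb z))
  have hdiff_term := hinner (f := spaceGrad θ z) hS (norm_sub_le (Fa z) (Fb z))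
  have hgrad_term := hinner (f := Da z - Db z) (p := S' (a z - b z) * θ z) (q := T ^ 2)
    (by rw [abs_mul, sq]; gcongr) (norm_sub_le (Fa z) (Fb z))
  have hflux : T * ((‖Fa z‖ + ‖Fb z‖) * ‖spaceGrad θ z‖) ≤ T ^ 2 * (‖Fa z‖ + ‖Fb z‖) := by
    calc _ ≤ T * ((‖Fa z‖ + ‖Fb z‖) * T) := by gcongr
      _ = T ^ 2 * (‖Fa z‖ + ‖Fb z‖) := by ring
  have hgrad : T ^ 2 * ((‖Fa z‖ + ‖Fb z‖) * ‖Da z - Db z‖)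
      ≤ T ^ 2 * ((‖Fa z‖ + ‖Fb z‖) * (‖Da z‖ + ‖Db z‖)) := by
    gcongr
    exact norm_sub_le _ _
  calc |comparisonIntegrand W S S' δ θ a b Da Db Fa Fb z|
      ≤ (1 + m) * T ^ 2 + 2 * (T ^ 2 * (‖Fa z‖ + ‖Fb z‖))
        + T ^ 2 * ((‖Fa z‖ + ‖Fb z‖) * (‖Da z‖ + ‖Db z‖)) := by
        rw [comparisonIntegrand, abs_le]
        rw [abs_le] at htime_term hsum_term hdiff_term hgrad_term
        constructor <;> linarith
    _ ≤ _ := by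
        have hslack : 0 ≤ T ^ 2 * (1 + m * (‖Fa z‖ + ‖Fb z‖)
            + (1 + m) * ((‖Fa z‖ + ‖Fb z‖) * (‖Da z‖ + ‖Db z‖))) := by positivity
        linarith

namespace IsTruncation

variable {W S S' : ℝ → ℝ} {B δ : ℝ} {a b : SpaceTime n → ℝ}
  {Da Db Fa Fb : SpaceTime n → Space n} {z : SpaceTime n}

theorem contDiff_primitive (hS : IsTruncation W S S' B δ) : ContDiff ℝ ∞ W := by
  refine contDiff_infty_iff_deriv.2 ⟨fun x => (hS.hasDerivAt_primitive x).differentiableAt, ?_⟩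
  rw [funext fun x => (hS.hasDerivAt_primitive x).deriv]
  exact hS.contDiff

theorem continuous_deriv (hS : IsTruncation W S S' B δ) : Continuous S' := by
  rw [← funext fun x => (hS.hasDerivAt x).deriv]
  exact hS.contDiff.continuous_deriv (by simp)

-- With `w = a - b`, the time terms of the two tested inequalities add up to `w (S(w) θ)ₜ`, which
-- differs from `-W(w) θₜ` by the time derivative of `(w S(w) - W(w)) θ`.
theorem comparisonIntegrand_eq (hS : IsTruncation W S S' B δ) (ha : DifferentiableAt ℝ a z)
    (hb : DifferentiableAt ℝ b z) (hθ : DifferentiableAt ℝ θ z) :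
    comparisonIntegrand W S S' δ θ a b (spaceGrad a) (spaceGrad b) Fa Fb z
      = (inner ℝ (Fa z) (spaceGrad (fun z => (δ - S (a z - b z)) * θ z) z)
          - a z * timeDeriv (fun z => (δ - S (a z - b z)) * θ z) z)
        + (inner ℝ (Fb z) (spaceGrad (fun z => (δ + S (a z - b z)) * θ z) z)
          - b z * timeDeriv (fun z => (δ + S (a z - b z)) * θ z) z)
        - timeDeriv (fun z => ((a z - b z) * S (a z - b z) - W (a z - b z)) * θ z) z := by
  have hw := ha.fun_sub hb
  have hS' := hS.hasDerivAt (a z - b z)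
  have hW := ((hasDerivAt_id' (a z - b z)).fun_mul hS').fun_sub
    (hS.hasDerivAt_primitive (a z - b z))
  rw [spaceGrad_comp_mul (f := fun x => δ - S x) (hS'.const_sub δ) hw hθ,
    spaceGrad_comp_mul (f := fun x => δ + S x) (hS'.const_add δ) hw hθ,
    timeDeriv_comp_mul (f := fun x => δ - S x) (hS'.const_sub δ) hw hθ,
    timeDeriv_comp_mul (f := fun x => δ + S x) (hS'.const_add δ) hw hθ,
    timeDeriv_comp_mul (f := fun x => x * S x - W x) hW hw hθ, spaceGrad_sub ha hb]
  simp only [comparisonIntegrand, inner_add_right, inner_add_left, inner_sub_left, inner_sub_right,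
    inner_smul_right]
  ring

theorem integral_comparisonIntegrand_nonneg_of_contDiff (hS : IsTruncation W S S' B δ)
    (ha : ContDiff ℝ ∞ a) (hb : ContDiff ℝ ∞ b) (hab : ∀ z, |a z - b z| ≤ B)
    (hFa : Continuous Fa) (hFb : Continuous Fb)
    (hsuper_a : ∀ η, IsTestFunction U η → (∀ z, 0 ≤ η z) →
      0 ≤ ∫ z, (inner ℝ (Fa z) (spaceGrad η z) - a z * timeDeriv η z))
    (hsuper_b : ∀ η, IsTestFunction U η → (∀ z, 0 ≤ η z) →
      0 ≤ ∫ z, (inner ℝ (Fb z) (spaceGrad η z) - b z * timeDeriv η z))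
    (hθ : IsTestFunction U θ) (hθ₀ : ∀ z, 0 ≤ θ z) :
    Integrable (comparisonIntegrand W S S' δ θ a b (spaceGrad a) (spaceGrad b) Fa Fb) ∧
      0 ≤ ∫ z, comparisonIntegrand W S S' δ θ a b (spaceGrad a) (spaceGrad b) Fa Fb z := by
  have hw : ContDiff ℝ ∞ fun z => a z - b z := ha.sub hb
  have hS_le z := abs_le.1 (hS.bounded _ (hab z))
  have hη₁ := hθ.comp_mul (contDiff_const.sub hS.contDiff : ContDiff ℝ ∞ fun x => δ - S x) hw
  have hη₂ := hθ.comp_mul (contDiff_const.add hS.contDiff : ContDiff ℝ ∞ fun x => δ + S x) hw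
  have hη₃ := hθ.comp_mul (f := fun x => x * S x - W x)
    ((contDiff_id.mul hS.contDiff).sub hS.contDiff_primitive) hw
  have hint {f : SpaceTime n → ℝ} {F : SpaceTime n → Space n} (hf : Continuous f)
      (hF : Continuous F) {η : SpaceTime n → ℝ} (hη : IsTestFunction U η) :
      Integrable fun z => inner ℝ (F z) (spaceGrad η z) - f z * timeDeriv η z :=
    (hη.integrable_inner_spaceGrad (hF.locallyIntegrable.locallyIntegrableOn _)).sub
      (hη.integrable_mul_timeDeriv (hf.locallyIntegrable.locallyIntegrableOn _))
  have hint₁ := hint ha.continuous hFa hη₁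
  have hint₂ := hint hb.continuous hFb hη₂
  have h₁ := hsuper_a _ hη₁ fun z => mul_nonneg (sub_nonneg.2 (hS_le z).2) (hθ₀ z)
  have h₂ := hsuper_b _ hη₂ fun z => mul_nonneg (by linarith [(hS_le z).1]) (hθ₀ z)
  have heq : comparisonIntegrand W S S' δ θ a b (spaceGrad a) (spaceGrad b) Fa Fb = _ :=
    funext fun z => hS.comparisonIntegrand_eq (ha.differentiable (by simp) z)
      (hb.differentiable (by simp) z) (hθ.differentiable z)
  rw [heq]
  refine ⟨(hint₁.add hint₂).sub hη₃.integrable_timeDeriv, ?_⟩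
  rw [integral_sub (hint₁.fun_add hint₂) hη₃.integrable_timeDeriv, integral_add hint₁ hint₂,
    hη₃.integral_timeDeriv]
  linarith

theorem exists_abs_comparisonIntegrand_le (hS : IsTruncation W S S' B δ) (hθ : IsTestFunction U θ)
    (M : ℝ) : ∃ K, 0 ≤ K ∧ ∀ (a b : SpaceTime n → ℝ) (Da Db Fa Fb : SpaceTime n → Space n) z,
      |a z| ≤ M → |b z| ≤ M → |comparisonIntegrand W S S' δ θ a b Da Db Fa Fb z|
        ≤ K * ((tsupport θ).indicator 1 z
          + (‖Fa z‖ + ‖Fb z‖) * (1 + (‖Da z‖ + ‖Db z‖))) := by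
  obtain ⟨R, hR⟩ := (isCompact_Icc (a := -(2 * M)) (b := 2 * M)).exists_bound_of_continuousOn
    (hS.contDiff_primitive.continuous.prodMk
      (hS.contDiff.continuous.prodMk hS.continuous_deriv)).continuousOn
  obtain ⟨Bt, hBt⟩ := hθ.exists_norm_timeDeriv_le
  obtain ⟨Bx, hBx⟩ := hθ.exists_norm_spaceGrad_le
  obtain ⟨B₀, hB₀⟩ := hθ.smooth.continuous.bounded_above_of_compact_support hθ.compact
  let T := max (max R |δ|) (max Bt (max Bx B₀))
  refine ⟨(2 + 2 * |M|) * T ^ 2, by positivity, fun a b Da Db Fa Fb z ha hb => ?_⟩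
  by_cases hz : z ∈ tsupport θ
  · have hab : |a z + b z| ≤ 2 * |M| := by
      linarith [abs_add_le (a z) (b z), le_abs_self M]
    have hw : a z - b z ∈ Icc (-(2 * M)) (2 * M) :=
      abs_le.1 (by linarith [abs_sub (a z) (b z)])
    have hWSS := hR _ hw
    rw [Prod.norm_mk, Prod.norm_mk, max_le_iff, max_le_iff] at hWSS
    have hRT : R ≤ T := (le_max_left _ _).trans (le_max_left _ _)
    rw [indicator_of_mem hz, Pi.one_apply]
    exact (abs_comparisonIntegrand_le (hWSS.1.trans hRT) (hWSS.2.1.trans hRT)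
      (hWSS.2.2.trans hRT) ((le_max_right _ _).trans (le_max_left _ _))
      ((hB₀ z).trans (by simp [T])) ((hBt z).trans (by simp [T])) ((hBx z).trans (by simp [T]))
      hab)
  · simp only [comparisonIntegrand, timeDeriv_eq_zero hz, spaceGrad_eq_zero hz,
      image_eq_zero_of_notMem_tsupport hz, inner_zero_right, mul_zero, zero_mul, sub_zero, add_zero,
      abs_zero, indicator_of_notMem hz]
    positivity

theorem tendsto_comparisonIntegrand (hS : IsTruncation W S S' B δ) {a' b' : ℕ → SpaceTime n → ℝ}
    {Da' Db' Fa' Fb' : ℕ → SpaceTime n → Space n}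
    (ha : Tendsto (fun m => a' m z) atTop (𝓝 (a z)))
    (hb : Tendsto (fun m => b' m z) atTop (𝓝 (b z)))
    (hDa : Tendsto (fun m => Da' m z) atTop (𝓝 (Da z)))
    (hDb : Tendsto (fun m => Db' m z) atTop (𝓝 (Db z)))
    (hFa : Tendsto (fun m => Fa' m z) atTop (𝓝 (Fa z)))
    (hFb : Tendsto (fun m => Fb' m z) atTop (𝓝 (Fb z))) :
    Tendsto
      (fun m => comparisonIntegrand W S S' δ θ (a' m) (b' m) (Da' m) (Db' m) (Fa' m) (Fb' m) z)
      atTop (𝓝 (comparisonIntegrand W S S' δ θ a b Da Db Fa Fb z)) := by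
  have hw := ha.sub hb
  have hW := (hS.contDiff_primitive.continuous.tendsto _).comp hw
  have hSw := (hS.contDiff.continuous.tendsto _).comp hw
  have hSw' := (hS.continuous_deriv.tendsto _).comp hw
  have hgrad : Tendsto (fun _ : ℕ => spaceGrad θ z) atTop (𝓝 (spaceGrad θ z)) := tendsto_const_nhds
  exact ((((hW.sub ((ha.add hb).const_mul δ)).mul_const _).add
    (((hFa.add hFb).inner hgrad).const_mul δ)).sub (hSw.mul ((hFa.sub hFb).inner hgrad))).sub
    ((hSw'.mul_const _).mul ((hFa.sub hFb).inner (hDa.sub hDb)))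

end IsTruncation

theorem norm_mollify_mul_one_add_le {D₁ D₂ F₁ F₂ : SpaceTime n → Space n} {h : SpaceTime n → ℝ}
    (hD₁ : Integrable D₁) (hD₂ : Integrable D₂)
    (hF₁ : Integrable F₁) (hF₂ : Integrable F₂) (hh : Integrable h)
    (hprod : ∀ z z', (‖F₁ z‖ + ‖F₂ z‖) * (‖D₁ z'‖ + ‖D₂ z'‖) ≤ h z + h z')
    (φ : ContDiffBump (0 : SpaceTime n)) (z : SpaceTime n) :
    (‖mollify φ F₁ z‖ + ‖mollify φ F₂ z‖) * (1 + (‖mollify φ D₁ z‖ + ‖mollify φ D₂ z‖))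
      ≤ mollify φ (fun z => ‖F₁ z‖ + ‖F₂ z‖ + 2 * h z) z := by
  have hnorm {f g : SpaceTime n → Space n} (hf : Integrable f) (hg : Integrable g) :
      ‖mollify φ f z‖ + ‖mollify φ g z‖ ≤ mollify φ (fun y => ‖f y‖ + ‖g y‖) z := by
    rw [mollify_fun_add φ hf.norm hg.norm]
    gcongr <;> exact norm_mollify_le_mollify_norm φ _ z
  have hF := hnorm hF₁ hF₂
  have hD := hnorm hD₁ hD₂
  have htwo : mollify φ (fun y => 2 * h y) z = 2 * mollify φ h z := by
    simp only [← integral_bumpMeasure, integral_const_mul]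
  rw [mollify_fun_add φ (hF₁.norm.fun_add hF₂.norm) (hh.const_mul 2), htwo, mul_add, mul_one]
  refine add_le_add hF ((mul_le_mul hF hD (by positivity) ?_).trans
    (mollify_mul_mollify_le φ (hF₁.norm.add hF₂.norm) (hD₁.norm.add hD₂.norm) hh hprod z))
  exact mollify_nonneg φ (fun z => by positivity) z

namespace IsFluxSupersolution

variable {W S S' : ℝ → ℝ} {M δ : ℝ} {v₁ v₂ h : SpaceTime n → ℝ}
  {D₁ D₂ F₁ F₂ : SpaceTime n → Space n}

theorem integral_comparisonIntegrand_mollify_nonneg (h₁ : IsFluxSupersolution U v₁ D₁ F₁)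
    (h₂ : IsFluxSupersolution U v₂ D₂ F₂) (hS : IsTruncation W S S' (2 * M) δ)
    (hM₁ : ∀ᵐ z, ‖v₁ z‖ ≤ M) (hM₂ : ∀ᵐ z, ‖v₂ z‖ ≤ M) (hv₁ : Integrable v₁)
    (hv₂ : Integrable v₂) (hF₁ : Integrable F₁) (hF₂ : Integrable F₂)
    {φ : ContDiffBump (0 : SpaceTime n)}
    (hθ : IsTestFunction {z | Metric.closedBall z φ.rOut ⊆ U} θ) (hθ₀ : ∀ z, 0 ≤ θ z) :
    Integrable (comparisonIntegrand W S S' δ θ (mollify φ v₁) (mollify φ v₂) (mollify φ D₁)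
        (mollify φ D₂) (mollify φ F₁) (mollify φ F₂)) ∧
      0 ≤ ∫ z, comparisonIntegrand W S S' δ θ (mollify φ v₁) (mollify φ v₂) (mollify φ D₁)
        (mollify φ D₂) (mollify φ F₁) (mollify φ F₂) z := by
  have hbound (z) : |mollify φ v₁ z - mollify φ v₂ z| ≤ 2 * M := by
    have hbound₁ := norm_mollify_le φ hM₁ z
    have hbound₂ := norm_mollify_le φ hM₂ z
    rw [Real.norm_eq_abs] at hbound₁ hbound₂
    linarith [abs_sub (mollify φ v₁ z) (mollify φ v₂ z)]
  rw [comparisonIntegrand_congr (fun _ _ => rfl) (fun _ _ => rfl)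
    (fun z hz => (h₁.weakGrad.spaceGrad_mollify hv₁ (hθ.support hz)).symm)
    (fun z hz => (h₂.weakGrad.spaceGrad_mollify hv₂ (hθ.support hz)).symm)
    (fun _ _ => rfl) fun _ _ => rfl]
  exact hS.integral_comparisonIntegrand_nonneg_of_contDiff
    (contDiff_mollify φ hv₁.locallyIntegrable) (contDiff_mollify φ hv₂.locallyIntegrable) hbound
    (contDiff_mollify φ hF₁.locallyIntegrable).continuous
    (contDiff_mollify φ hF₂.locallyIntegrable).continuous
    (fun _ hη => h₁.nonneg_mollify hv₁ hF₁ hη) (fun _ hη => h₂.nonneg_mollify hv₂ hF₂ hη) hθ hθ₀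

-- The products `⟨F, D⟩` need not be dominated along the mollification. Instead `hprod` dominates
-- them by the mollification of an integrable function, whose integral does not depend on the scale.
theorem integral_comparisonIntegrand_nonneg_of_integrable (h₁ : IsFluxSupersolution U v₁ D₁ F₁)
    (h₂ : IsFluxSupersolution U v₂ D₂ F₂) (hU : IsOpen U) (hS : IsTruncation W S S' (2 * M) δ)
    (hM₁ : ∀ᵐ z, ‖v₁ z‖ ≤ M) (hM₂ : ∀ᵐ z, ‖v₂ z‖ ≤ M) (hv₁ : Integrable v₁)
    (hv₂ : Integrable v₂) (hD₁ : Integrable D₁) (hD₂ : Integrable D₂) (hF₁ : Integrable F₁)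
    (hF₂ : Integrable F₂) (hh : Integrable h)
    (hprod : ∀ z z', (‖F₁ z‖ + ‖F₂ z‖) * (‖D₁ z'‖ + ‖D₂ z'‖) ≤ h z + h z')
    (hθ : IsTestFunction U θ) (hθ₀ : ∀ z, 0 ≤ θ z) :
    Integrable (comparisonIntegrand W S S' δ θ v₁ v₂ D₁ D₂ F₁ F₂) ∧
      0 ≤ ∫ z, comparisonIntegrand W S S' δ θ v₁ v₂ D₁ D₂ F₁ F₂ z := by
  obtain ⟨r, hr, hrU⟩ := hθ.compact.isCompact.exists_cthickening_subset_open hU hθ.support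
  let φ m := shrinkingBump (SpaceTime n) r hr m
  have hθφ m : IsTestFunction {z | Metric.closedBall z (φ m).rOut ⊆ U} θ :=
    ⟨hθ.smooth, hθ.compact, fun z hz =>
      (Metric.closedBall_subset_closedBall (shrinkingBump_rOut_le hr m)).trans
        ((Metric.closedBall_subset_cthickening hz r).trans hrU)⟩
  have hmollified m := h₁.integral_comparisonIntegrand_mollify_nonneg h₂ hS hM₁ hM₂ hv₁ hv₂ hF₁ hF₂
    (hθφ m) hθ₀
  obtain ⟨K, hK, hle⟩ := hS.exists_abs_comparisonIntegrand_le hθ M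
  have hk : Integrable fun z => ‖F₁ z‖ + ‖F₂ z‖ + 2 * h z :=
    (hF₁.norm.add hF₂.norm).add (hh.const_mul 2)
  have hsupp : Integrable ((tsupport θ).indicator (1 : SpaceTime n → ℝ)) :=
    (integrable_indicator_iff hθ.compact.isCompact.measurableSet).2
      (integrableOn_const hθ.compact.isCompact.measure_ne_top)
  refine integral_nonneg_of_tendsto_of_le (fun m => (hmollified m).1)
    (fun m => (hsupp.add (integrable_mollify (φ m) hk)).const_mul K) ((hsupp.add hk).const_mul K)
    (fun m => .of_forall fun z => (le_abs_self _).trans <|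
      (hle _ _ _ _ _ _ z (norm_mollify_le _ hM₁ z) (norm_mollify_le _ hM₂ z)).trans <|
      mul_le_mul_of_nonneg_left (add_le_add_right
        (norm_mollify_mul_one_add_le hD₁ hD₂ hF₁ hF₂ hh hprod (φ m) z) _) hK)
    ?_ ?_ ?_ fun m => (hmollified m).2
  · filter_upwards [ae_tendsto_mollify_shrinkingBump hv₁.locallyIntegrable hr,
      ae_tendsto_mollify_shrinkingBump hv₂.locallyIntegrable hr,
      ae_tendsto_mollify_shrinkingBump hD₁.locallyIntegrable hr,
      ae_tendsto_mollify_shrinkingBump hD₂.locallyIntegrable hr,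
      ae_tendsto_mollify_shrinkingBump hF₁.locallyIntegrable hr,
      ae_tendsto_mollify_shrinkingBump hF₂.locallyIntegrable hr] with z using
      hS.tendsto_comparisonIntegrand
  · filter_upwards [ae_tendsto_mollify_shrinkingBump hk.locallyIntegrable hr] with z hz using
      (hz.const_add _).const_mul K
  · simp only [Pi.add_apply, integral_const_mul, integral_add hsupp (integrable_mollify _ hk),
      integral_add hsupp hk, integral_mollify _ hk]
    exact tendsto_const_nhds

theorem integral_comparisonIntegrand_nonneg (h₁ : IsFluxSupersolution Q v₁ D₁ F₁)
    (h₂ : IsFluxSupersolution Q v₂ D₂ F₂) (hQ : IsOpen Q) (hS : IsTruncation W S S' (2 * M) δ)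
    (hM : 0 ≤ M) (hM₁ : ∀ᵐ z ∂volume.restrict Q, ‖v₁ z‖ ≤ M)
    (hM₂ : ∀ᵐ z ∂volume.restrict Q, ‖v₂ z‖ ≤ M) (hh : LocallyIntegrableOn h Q)
    (hprod : ∀ z z', (‖F₁ z‖ + ‖F₂ z‖) * (‖D₁ z'‖ + ‖D₂ z'‖) ≤ h z + h z')
    (hθ : IsTestFunction Q θ) (hθ₀ : ∀ z, 0 ≤ θ z) :
    Integrable (comparisonIntegrand W S S' δ θ v₁ v₂ D₁ D₂ F₁ F₂) ∧
      0 ≤ ∫ z, comparisonIntegrand W S S' δ θ v₁ v₂ D₁ D₂ F₁ F₂ z := by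
  obtain ⟨U, hU, hθU, hUQ, hUc⟩ :=
    exists_open_between_and_isCompact_closure hθ.compact.isCompact hQ hθ.support
  have hUQ' : U ⊆ Q := subset_closure.trans hUQ
  have hint {F : Type} [NormedAddCommGroup F] {f : SpaceTime n → F} (hf : LocallyIntegrableOn f Q) :
      Integrable (U.indicator f) :=
    (integrable_indicator_iff hU.measurableSet).2
      ((hf.integrableOn_compact_subset hUQ hUc).mono_set subset_closure)
  have hbound {v : SpaceTime n → ℝ} (hv : ∀ᵐ z ∂volume.restrict Q, ‖v z‖ ≤ M) :
      ∀ᵐ z, ‖U.indicator v z‖ ≤ M := by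
    filter_upwards [(ae_restrict_iff' hQ.measurableSet).1 hv] with z hz
    by_cases hzU : z ∈ U
    · simpa only [indicator_of_mem hzU] using hz (hUQ' hzU)
    · simpa only [indicator_of_notMem hzU, norm_zero] using hM
  have hprodU z z' : (‖U.indicator F₁ z‖ + ‖U.indicator F₂ z‖)
      * (‖U.indicator D₁ z'‖ + ‖U.indicator D₂ z'‖) ≤ U.indicator h z + U.indicator h z' := by
    have hh₀ z : 0 ≤ h z := by
      have := (by positivity : 0 ≤ (‖F₁ z‖ + ‖F₂ z‖) * (‖D₁ z‖ + ‖D₂ z‖)).trans (hprod z z)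
      linarith
    by_cases hz : z ∈ U <;> by_cases hz' : z' ∈ U <;> simp [hz, hz', hh₀, hprod]
  have heq {F : Type} [Zero F] (f : SpaceTime n → F) : EqOn f (U.indicator f) (tsupport θ) :=
    fun z hz => (indicator_of_mem (hθU hz) f).symm
  rw [comparisonIntegrand_congr (heq v₁) (heq v₂) (heq D₁) (heq D₂) (heq F₁) (heq F₂)]
  have hind {v : SpaceTime n → ℝ} {D F} (h : IsFluxSupersolution Q v D F) :=
    (h.mono hUQ').indicator hU.measurableSet
  exact (hind h₁).integral_comparisonIntegrand_nonneg_of_integrable (hind h₂) hU hS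
    (hbound hM₁) (hbound hM₂)
    (hint h₁.weakGrad.locInt) (hint h₂.weakGrad.locInt) (hint h₁.weakGrad.locInt_grad)
    (hint h₂.weakGrad.locInt_grad) (hint h₁.locInt_flux) (hint h₂.locInt_flux) (hint hh) hprodU
    ⟨hθ.smooth, hθ.compact, hθU⟩ hθ₀

end IsFluxSupersolution

end Comparison

section Energy

namespace IsGrowthFunction

variable {γ : ℝ → ℝ} {P : ℕ}

theorem mul_nonneg (hγ : IsGrowthFunction γ P) {s : ℝ} (hs : 0 ≤ s) : 0 ≤ s * γ s :=
  _root_.mul_nonneg hs (hγ.nonneg s)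

theorem mul_le_add (hγ : IsGrowthFunction γ P) {s t : ℝ} (hs : 0 ≤ s) (ht : 0 ≤ t) :
    γ s * t ≤ s * γ s + t * γ t := by
  rcases le_total s t with h | h
  · linarith [hγ.mul_nonneg hs, mul_le_mul_of_nonneg_right (hγ.monotone h) ht]
  · linarith [hγ.mul_nonneg ht, mul_le_mul_of_nonneg_left h (hγ.nonneg s)]

theorem le_mul_add (hγ : IsGrowthFunction γ P) {s ε : ℝ} (hs : 0 ≤ s) (hε : 0 < ε) :
    γ s ≤ ε * (s * γ s) + γ ε⁻¹ := by
  rcases le_total s ε⁻¹ with h | h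
  · linarith [_root_.mul_nonneg hε.le (hγ.mul_nonneg hs), hγ.monotone h]
  · have hεs : 1 ≤ ε * s := by rwa [← inv_le_iff_one_le_mul₀' hε]
    nlinarith [hγ.nonneg s, hγ.nonneg ε⁻¹]

theorem exists_forall_le_mul (hγ : IsGrowthFunction γ P) {ε : ℝ} (hε : 0 < ε) :
    ∃ R, 0 ≤ R ∧ ∀ s, R ≤ s → s ≤ ε * (s * γ s) := by
  obtain ⟨R, hR⟩ := (hγ.tendsto_atTop.eventually_ge_atTop ε⁻¹).exists_forall_of_atTop
  refine ⟨max R 0, le_max_right _ _, fun s hs => ?_⟩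
  have hs₀ : 0 ≤ s := (le_max_right _ _).trans hs
  have hεγ : 1 ≤ ε * γ s := by
    rw [← inv_le_iff_one_le_mul₀' hε]
    exact hR s ((le_max_left _ _).trans hs)
  linarith [le_mul_of_one_le_right hs₀ hεγ]

theorem exists_le_mul_add (hγ : IsGrowthFunction γ P) {ε : ℝ} (hε : 0 < ε) :
    ∃ R, 0 ≤ R ∧ ∀ s, 0 ≤ s → s ≤ ε * (s * γ s) + R := by
  obtain ⟨R, hR₀, hR⟩ := hγ.exists_forall_le_mul hε
  refine ⟨R, hR₀, fun s hs => ?_⟩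
  rcases le_total R s with h | h
  · linarith [hR s h]
  · linarith [_root_.mul_nonneg hε.le (hγ.mul_nonneg hs)]

theorem mul_pow_le (hγ : IsGrowthFunction γ P) {s t φ : ℝ} (hφ : 0 < φ) (hφ₁ : φ ≤ 1)
    (ht : 0 ≤ t) (h : φ * s ≤ t) : γ s * φ ^ P ≤ γ t := by
  have hs : s ≤ φ⁻¹ * t := by rwa [le_inv_mul_iff₀ hφ]
  calc γ s * φ ^ P ≤ φ⁻¹ ^ P * γ t * φ ^ P := by
        gcongr
        exact (hγ.monotone hs).trans (hγ.doubling φ⁻¹ t ((one_le_inv₀ hφ).2 hφ₁) ht)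
    _ = γ t := by rw [inv_pow]; field_simp

-- The power of the cutoff function is the doubling exponent, so that Young's inequality returns
-- one more power of `φ` in front of the energy density.
theorem mul_pow_mul_le (hγ : IsGrowthFunction γ P) {s φ T ε : ℝ} (hs : 0 ≤ s)
    (hφ : 0 ≤ φ) (hφ₁ : φ ≤ 1) (hT : 0 ≤ T) (hε : 0 < ε) :
    γ s * φ ^ P * T ≤ ε * (s * γ s * φ ^ (P + 1)) + T * γ (T / ε) := by
  have hγs := hγ.nonneg s
  have hγT := _root_.mul_nonneg hT (hγ.nonneg (T / ε))
  rcases hφ.eq_or_lt with rfl | hφ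
  · simpa [zero_pow hγ.exponent_ne_zero] using hγT
  rcases le_total (T / ε) (φ * s) with h | h
  · calc γ s * φ ^ P * T ≤ γ s * φ ^ P * (φ * s * ε) := by
          gcongr
          rwa [← div_le_iff₀ hε]
      _ = ε * (s * γ s * φ ^ (P + 1)) := by ring
      _ ≤ ε * (s * γ s * φ ^ (P + 1)) + T * γ (T / ε) := le_add_of_nonneg_right hγT
  · calc γ s * φ ^ P * T ≤ γ (T / ε) * T := by
          gcongr
          exact hγ.mul_pow_le hφ hφ₁ (by positivity) h
      _ = T * γ (T / ε) := mul_comm _ _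
      _ ≤ ε * (s * γ s * φ ^ (P + 1)) + T * γ (T / ε) :=
          le_add_of_nonneg_left (by positivity)

end IsGrowthFunction

theorem locallyIntegrableOn_of_norm_le {X F F' : Type*} [TopologicalSpace X] [MeasurableSpace X]
    [NormedAddCommGroup F] [NormedAddCommGroup F'] {μ : Measure X} {Q : Set X} {f : X → F}
    {g : X → F'} (hf : LocallyIntegrableOn f Q μ) (hg : AEStronglyMeasurable g (μ.restrict Q))
    (h : ∀ z, ‖g z‖ ≤ ‖f z‖) : LocallyIntegrableOn g Q μ := by
  intro x hx
  obtain ⟨s, hs, hfs⟩ := hf x hx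
  exact ⟨s ∩ Q, inter_mem hs self_mem_nhdsWithin, Integrable.mono
    (hfs.mono_set inter_subset_left)
    (hg.mono_measure (Measure.restrict_mono inter_subset_right le_rfl)) (.of_forall h)⟩

variable {n : ℕ} {γ : ℝ → ℝ} {P : ℕ} {A : Space n → Space n} {C c M : ℝ} {Q : Set (SpaceTime n)}
  {v v₁ v₂ : SpaceTime n → ℝ} {D D₁ D₂ : SpaceTime n → Space n}

/-- A weak supersolution for the field `A` that is bounded by `M`, with locally integrable energy
density `|D| γ(|D|)`. -/
structure IsBoundedSupersolution (A : Space n → Space n) (γ : ℝ → ℝ) (Q : Set (SpaceTime n))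
    (M : ℝ) (v : SpaceTime n → ℝ) (D : SpaceTime n → Space n) : Prop extends
    IsFluxSupersolution Q v D fun z => A (D z) where
  locInt_energy : LocallyIntegrableOn (fun z => ‖D z‖ * γ ‖D z‖) Q
  bounded : ∀ᵐ z ∂volume.restrict Q, ‖v z‖ ≤ M

theorem IsMonotoneField.locallyIntegrableOn_comp (hA : IsMonotoneField A γ C c)
    (hγ : IsGrowthFunction γ P) (hD : AEStronglyMeasurable D (volume.restrict Q))
    (henergy : LocallyIntegrableOn (fun z => ‖D z‖ * γ ‖D z‖) Q) :
    LocallyIntegrableOn (fun z => A (D z)) Q := by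
  refine locallyIntegrableOn_of_norm_le
    ((henergy.add (locallyIntegrableOn_const (γ 1⁻¹))).smul C)
    (hA.continuous.comp_aestronglyMeasurable hD) fun z => ?_
  have hbound := hγ.le_mul_add (norm_nonneg (D z)) one_pos
  rw [one_mul] at hbound
  exact ((hA.growth _).trans (mul_le_mul_of_nonneg_left hbound hA.growth_nonneg)).trans
    (le_abs_self _)

theorem IsMonotoneField.norm_mul_norm_le (hA : IsMonotoneField A γ C c)
    (hγ : IsGrowthFunction γ P) (ξ₁ ξ₂ ζ₁ ζ₂ : Space n) :
    (‖A ξ₁‖ + ‖A ξ₂‖) * (‖ζ₁‖ + ‖ζ₂‖) ≤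
      2 * C * (‖ξ₁‖ * γ ‖ξ₁‖ + ‖ξ₂‖ * γ ‖ξ₂‖) + 2 * C * (‖ζ₁‖ * γ ‖ζ₁‖ + ‖ζ₂‖ * γ ‖ζ₂‖) := by
  have hC := hA.growth_nonneg
  have hproduct : (γ ‖ξ₁‖ + γ ‖ξ₂‖) * (‖ζ₁‖ + ‖ζ₂‖) ≤
      2 * (‖ξ₁‖ * γ ‖ξ₁‖ + ‖ξ₂‖ * γ ‖ξ₂‖) + 2 * (‖ζ₁‖ * γ ‖ζ₁‖ + ‖ζ₂‖ * γ ‖ζ₂‖) := by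
    linarith [hγ.mul_le_add (norm_nonneg ξ₁) (norm_nonneg ζ₁),
      hγ.mul_le_add (norm_nonneg ξ₁) (norm_nonneg ζ₂),
      hγ.mul_le_add (norm_nonneg ξ₂) (norm_nonneg ζ₁),
      hγ.mul_le_add (norm_nonneg ξ₂) (norm_nonneg ζ₂)]
  calc (‖A ξ₁‖ + ‖A ξ₂‖) * (‖ζ₁‖ + ‖ζ₂‖)
      ≤ (C * γ ‖ξ₁‖ + C * γ ‖ξ₂‖) * (‖ζ₁‖ + ‖ζ₂‖) := by
        gcongr
        exacts [hA.growth ξ₁, hA.growth ξ₂]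
    _ = C * ((γ ‖ξ₁‖ + γ ‖ξ₂‖) * (‖ζ₁‖ + ‖ζ₂‖)) := by ring
    _ ≤ C * (2 * (‖ξ₁‖ * γ ‖ξ₁‖ + ‖ξ₂‖ * γ ‖ξ₂‖) + 2 * (‖ζ₁‖ * γ ‖ζ₁‖ + ‖ζ₂‖ * γ ‖ζ₂‖)) := by
        gcongr
    _ = _ := by ring

theorem IsMonotoneField.isBoundedSupersolution_zero (hA : IsMonotoneField A γ C c) (hM : 0 ≤ M) :
    IsBoundedSupersolution A γ Q M (fun _ => 0) fun _ => 0 where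
  weakGrad := ⟨locallyIntegrableOn_const _, locallyIntegrableOn_const _, fun φ _ => by simp⟩
  locInt_flux := locallyIntegrableOn_const _
  nonneg η _ _ := by simp [hA.map_zero]
  locInt_energy := locallyIntegrableOn_const _
  bounded := .of_forall fun _ => by simpa using hM

theorem IsBoundedSupersolution.integral_comparisonIntegrand_nonneg
    (h₁ : IsBoundedSupersolution A γ Q M v₁ D₁) (h₂ : IsBoundedSupersolution A γ Q M v₂ D₂)
    (hQ : IsOpen Q) (hγ : IsGrowthFunction γ P) (hA : IsMonotoneField A γ C c) (hM : 0 ≤ M)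
    {W S S' : ℝ → ℝ} {δ : ℝ} (hS : IsTruncation W S S' (2 * M) δ) {θ : SpaceTime n → ℝ}
    (hθ : IsTestFunction Q θ) (hθ₀ : ∀ z, 0 ≤ θ z) :
    Integrable (comparisonIntegrand W S S' δ θ v₁ v₂ D₁ D₂ (fun z => A (D₁ z)) fun z => A (D₂ z)) ∧
      0 ≤ ∫ z, comparisonIntegrand W S S' δ θ v₁ v₂ D₁ D₂ (fun z => A (D₁ z))
        (fun z => A (D₂ z)) z :=
  h₁.toIsFluxSupersolution.integral_comparisonIntegrand_nonneg h₂.toIsFluxSupersolution hQ hS hM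
    h₁.bounded h₂.bounded ((h₁.locInt_energy.add h₂.locInt_energy).smul (2 * C))
    (fun _ _ => hA.norm_mul_norm_le hγ _ _ _ _) hθ hθ₀

namespace IsTestFunction

variable {φ : SpaceTime n → ℝ}

theorem integrable_smul {F : Type*} [NormedAddCommGroup F] [NormedSpace ℝ F]
    (hφ : IsTestFunction Q φ) {f : SpaceTime n → F} (hf : LocallyIntegrableOn f Q) :
    Integrable fun z => φ z • f z := by
  obtain ⟨B, hB⟩ := hφ.smooth.continuous.bounded_above_of_compact_support hφ.compact
  rw [← integrableOn_iff_integrable_of_support_subset (s := tsupport φ)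
    (Function.support_subset_iff'.2 fun z hz => by
      rw [image_eq_zero_of_notMem_tsupport hz, zero_smul])]
  exact (hf.integrableOn_compact_subset hφ.support hφ.compact).bdd_smul B
    hφ.smooth.continuous.aestronglyMeasurable (.of_forall hB)

theorem pow (hφ : IsTestFunction Q φ) (k : ℕ) : IsTestFunction Q fun z => φ z ^ (k + 1) := by
  simpa only [pow_succ] using hφ.comp_mul (contDiff_fun_id.pow k) hφ.smooth

theorem fderiv_pow (hφ : IsTestFunction Q φ) (k : ℕ) (z : SpaceTime n) :
    fderiv ℝ (fun z => φ z ^ (k + 1)) z = ((k + 1) * φ z ^ k) • fderiv ℝ φ z := by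
  simpa using ((hφ.differentiable z).hasFDerivAt.pow (k + 1)).fderiv

theorem timeDeriv_pow (hφ : IsTestFunction Q φ) (k : ℕ) (z : SpaceTime n) :
    timeDeriv (fun z => φ z ^ (k + 1)) z = (k + 1) * φ z ^ k * timeDeriv φ z := by
  rw [(hφ.pow k).timeDeriv_eq_fderiv, hφ.timeDeriv_eq_fderiv]
  simp [hφ.fderiv_pow]

theorem spaceGrad_pow (hφ : IsTestFunction Q φ) (k : ℕ) (z : SpaceTime n) :
    spaceGrad (fun z => φ z ^ (k + 1)) z = ((k + 1) * φ z ^ k) • spaceGrad φ z := by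
  rw [(hφ.pow k).spaceGrad_eq_spatialPart, hφ.spaceGrad_eq_spatialPart]
  simp only [hφ.fderiv_pow, map_smul]

theorem timeDeriv_pow_le (hφ : IsTestFunction Q φ) (k : ℕ) {κ : ℝ} (hκ : 0 ≤ κ) {z : SpaceTime n}
    (h₀ : 0 ≤ φ z) (h₁ : φ z ≤ 1) (h : timeDeriv φ z ≤ κ) :
    timeDeriv (fun z => φ z ^ (k + 1)) z ≤ (k + 1) * κ := by
  rw [hφ.timeDeriv_pow]
  calc (k + 1) * φ z ^ k * timeDeriv φ z ≤ (k + 1) * φ z ^ k * κ := by gcongr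
    _ ≤ (k + 1) * 1 * κ := by gcongr; exact pow_le_one₀ h₀ h₁
    _ = (k + 1) * κ := by rw [mul_one]

theorem norm_spaceGrad_pow_le (hφ : IsTestFunction Q φ) (k : ℕ) {κ : ℝ} {z : SpaceTime n}
    (h₀ : 0 ≤ φ z) (h : ‖spaceGrad φ z‖ ≤ κ) :
    ‖spaceGrad (fun z => φ z ^ (k + 1)) z‖ ≤ (k + 1) * κ * φ z ^ k := by
  rw [hφ.spaceGrad_pow, norm_smul, Real.norm_of_nonneg (by positivity)]
  calc (k + 1) * φ z ^ k * ‖spaceGrad φ z‖ ≤ (k + 1) * φ z ^ k * κ := by gcongr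
    _ = (k + 1) * κ * φ z ^ k := by ring

end IsTestFunction

theorem isTruncation_id (B : ℝ) :
    IsTruncation (fun x => x ^ 2 / 2) (fun x => x) (fun _ => 1) B B where
  contDiff := contDiff_id
  hasDerivAt_primitive x := by simpa using (hasDerivAt_pow 2 x).div_const 2
  hasDerivAt := hasDerivAt_id
  bounded _ hx := hx

theorem IsMonotoneField.exists_comparisonIntegrand_zero_le (hA : IsMonotoneField A γ C c)
    (hγ : IsGrowthFunction γ P) (hM : 0 ≤ M) {κ : ℝ} (hκ : 0 ≤ κ) :
    ∃ B, 0 ≤ B ∧ ∀ (v φ : SpaceTime n → ℝ) (D : SpaceTime n → Space n) (z : SpaceTime n),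
      |v z| ≤ M → 0 ≤ φ z → φ z ≤ 1 → timeDeriv (fun z => φ z ^ (P + 1)) z ≤ κ →
      ‖spaceGrad (fun z => φ z ^ (P + 1)) z‖ ≤ κ * φ z ^ P →
      comparisonIntegrand (fun x => x ^ 2 / 2) (fun x => x) (fun _ => 1) (2 * M)
          (fun z => φ z ^ (P + 1)) v (fun _ => 0) D (fun _ => 0) (fun z => A (D z))
          (fun _ => A 0) z ≤
        B - 2 * M ^ 2 * timeDeriv (fun z => φ z ^ (P + 1)) z
          - c / 2 * (φ z ^ (P + 1) * (‖D z‖ * γ ‖D z‖)) := by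
  have hC := hA.growth_nonneg
  set T : ℝ := 3 * M * C * κ with hT
  have hγT := hγ.nonneg (T / (c / 2))
  refine ⟨9 / 2 * M ^ 2 * κ + T * γ (T / (c / 2)), by positivity, ?_⟩
  intro v φ D z hv hφ₀ hφ₁ htime hspace
  have hv' := abs_le.1 hv
  have hγD := hγ.nonneg ‖D z‖
  have hyoung := hγ.mul_pow_mul_le (norm_nonneg (D z)) hφ₀ hφ₁ (by positivity : 0 ≤ T)
    (half_pos hA.coercivity_pos)
  have hcoercive := mul_le_mul_of_nonneg_left (hA.coercive (D z)) (pow_nonneg hφ₀ (P + 1))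
  set τ := timeDeriv (fun z => φ z ^ (P + 1)) z with hτ
  set X := spaceGrad (fun z => φ z ^ (P + 1)) z with hX
  have htime' : (v z - 2 * M) ^ 2 / 2 * τ ≤ 9 / 2 * M ^ 2 * κ := by
    calc (v z - 2 * M) ^ 2 / 2 * τ ≤ (v z - 2 * M) ^ 2 / 2 * κ := by gcongr
      _ ≤ 9 * M ^ 2 / 2 * κ := by
          gcongr
          nlinarith
      _ = 9 / 2 * M ^ 2 * κ := by ring
  have hspace' : (2 * M - v z) * inner ℝ (A (D z)) X ≤ γ ‖D z‖ * φ z ^ P * T := by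
    calc (2 * M - v z) * inner ℝ (A (D z)) X ≤ (2 * M - v z) * (‖A (D z)‖ * ‖X‖) :=
          mul_le_mul_of_nonneg_left (real_inner_le_norm _ _) (by linarith)
      _ ≤ 3 * M * (‖A (D z)‖ * ‖X‖) := by
          gcongr
          linarith
      _ ≤ 3 * M * (C * γ ‖D z‖ * (κ * φ z ^ P)) := by
          gcongr
          exact hA.growth _
      _ = γ ‖D z‖ * φ z ^ P * T := by rw [hT]; ring
  simp only [comparisonIntegrand, sub_zero, add_zero, hA.map_zero, ← hτ, ← hX]
  linarith

-- The time derivative of the cutoff function enters only through an upper bound, which makes the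
-- estimate uniform up to the final time.
theorem IsMonotoneField.exists_integral_energy_le (hA : IsMonotoneField A γ C c)
    (hγ : IsGrowthFunction γ P) (hM : 0 ≤ M) {κ : ℝ} (hκ : 0 ≤ κ) :
    ∃ B, 0 ≤ B ∧ ∀ (Q : Set (SpaceTime n)) (v φ : SpaceTime n → ℝ) (D : SpaceTime n → Space n),
      IsOpen Q → IsBoundedSupersolution A γ Q M v D → IsTestFunction Q φ → (∀ z, 0 ≤ φ z) →
      (∀ z, φ z ≤ 1) → (∀ z, ‖spaceGrad φ z‖ ≤ κ) → (∀ z, timeDeriv φ z ≤ κ) →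
      ∫ z, φ z ^ (P + 1) * (‖D z‖ * γ ‖D z‖) ≤ B * volume.real (tsupport φ) := by
  obtain ⟨B, hB₀, hB⟩ := hA.exists_comparisonIntegrand_zero_le hγ hM
    (κ := (P + 1) * κ) (by positivity)
  have hc := hA.coercivity_pos
  refine ⟨2 / c * B, by positivity, ?_⟩
  intro Q v φ D hQ h hφ hφ₀ hφ₁ hspace htime
  have hθ := hφ.pow P
  obtain ⟨hint, hnonneg⟩ := h.integral_comparisonIntegrand_nonneg
    (hA.isBoundedSupersolution_zero hM) hQ hγ hA hM (isTruncation_id (2 * M)) hθ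
    fun z => pow_nonneg (hφ₀ z) _
  have hmeas := (isClosed_tsupport φ).measurableSet
  have hsuppInt : Integrable ((tsupport φ).indicator fun _ => B) :=
    (integrable_indicator_iff hmeas).2 (integrableOn_const hφ.compact.isCompact.measure_lt_top.ne)
  have htimeInt := hθ.integrable_timeDeriv.const_mul (2 * M ^ 2)
  have henergyInt := (hθ.integrable_smul h.locInt_energy).const_mul (c / 2)
  have hdiffInt : Integrable fun z => (tsupport φ).indicator (fun _ => B) z
      - 2 * M ^ 2 * timeDeriv (fun z => φ z ^ (P + 1)) z := hsuppInt.sub htimeInt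
  have htotalInt : Integrable fun z => (tsupport φ).indicator (fun _ => B) z
      - 2 * M ^ 2 * timeDeriv (fun z => φ z ^ (P + 1)) z
      - c / 2 * (φ z ^ (P + 1) • (‖D z‖ * γ ‖D z‖)) := hdiffInt.sub henergyInt
  have hle := integral_mono_ae hint htotalInt ?_
  · rw [integral_sub hdiffInt henergyInt, integral_sub hsuppInt htimeInt,
      integral_const_mul, integral_const_mul, hθ.integral_timeDeriv, integral_indicator hmeas,
      setIntegral_const] at hle
    simp only [smul_eq_mul] at hle
    rw [div_mul_eq_mul_div, div_mul_eq_mul_div, le_div_iff₀ hc]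
    linarith
  · filter_upwards [(ae_restrict_iff' hQ.measurableSet).1 h.bounded] with z hz
    by_cases hzφ : z ∈ tsupport φ
    · simpa [indicator_of_mem hzφ] using hB v φ D z (hz (hφ.support hzφ)) (hφ₀ z) (hφ₁ z)
        (hφ.timeDeriv_pow_le P hκ (hφ₀ z) (hφ₁ z) (htime z))
        (hφ.norm_spaceGrad_pow_le P (hφ₀ z) (hspace z))
    · simp [comparisonIntegrand, hφ.timeDeriv_pow, hφ.spaceGrad_pow, timeDeriv_eq_zero hzφ,
        spaceGrad_eq_zero hzφ, image_eq_zero_of_notMem_tsupport hzφ, indicator_of_notMem hzφ]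

theorem exists_contDiff_cutoff {E : Type*} [NormedAddCommGroup E] [NormedSpace ℝ E]
    [FiniteDimensional ℝ E] {K U : Set E} (hK : IsCompact K) (hU : IsOpen U) (hKU : K ⊆ U) :
    ∃ φ : E → ℝ, ContDiff ℝ ∞ φ ∧ HasCompactSupport φ ∧ tsupport φ ⊆ U ∧ (∀ x, 0 ≤ φ x) ∧
      (∀ x, φ x ≤ 1) ∧ ∀ x ∈ K, φ x = 1 := by
  have : ProperSpace E := FiniteDimensional.proper_real E
  obtain ⟨K', hK', hKK', hK'U⟩ := exists_compact_between hK hU hKU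
  obtain ⟨φ, hφ, hrange, hsupp, hone⟩ := exists_contMDiff_support_eq_eq_one_iff
    (modelWithCornersSelf ℝ E) (n := ⊤) isOpen_interior hK.isClosed hKK'
  have htsupp : tsupport φ ⊆ K' :=
    closure_minimal (hsupp.trans_subset interior_subset) hK'.isClosed
  exact ⟨φ, hφ.contDiff, hK'.of_isClosed_subset (isClosed_tsupport φ) htsupp, htsupp.trans hK'U,
    fun x => (hrange ⟨x, rfl⟩).1, fun x => (hrange ⟨x, rfl⟩).2, fun x hx => (hone x).1 hx⟩

theorem exists_isTestFunction_eq_one {K Q : Set (SpaceTime n)} (hK : IsCompact K) (hQ : IsOpen Q)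
    (hKQ : K ⊆ Q) : ∃ φ : SpaceTime n → ℝ, IsTestFunction Q φ ∧ (∀ z, 0 ≤ φ z) ∧ (∀ z, φ z ≤ 1) ∧
      ∀ z ∈ K, φ z = 1 := by
  obtain ⟨φ, hsmooth, hcompact, hsupport, hφ⟩ := exists_contDiff_cutoff hK hQ hKQ
  exact ⟨φ, ⟨hsmooth, hcompact, hsupport⟩, hφ⟩

theorem IsMonotoneField.exists_setIntegral_energy_le (hA : IsMonotoneField A γ C c)
    (hγ : IsGrowthFunction γ P) (hM : 0 ≤ M) {K : Set (SpaceTime n)} (hK : IsCompact K)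
    (hQ : IsOpen Q) (hKQ : K ⊆ Q) :
    ∃ B : ℝ, ∀ v D, IsBoundedSupersolution A γ Q M v D → ∫ z in K, ‖D z‖ * γ ‖D z‖ ≤ B := by
  obtain ⟨φ, hφ, hφ₀, hφ₁, hφK⟩ := exists_isTestFunction_eq_one hK hQ hKQ
  obtain ⟨T, hT⟩ := hφ.exists_norm_timeDeriv_le
  obtain ⟨X, hX⟩ := hφ.exists_norm_spaceGrad_le
  have hmax : 0 ≤ max T X := ((abs_nonneg _).trans (hT 0)).trans (le_max_left _ _)
  obtain ⟨B, -, hB⟩ := hA.exists_integral_energy_le hγ hM hmax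
  refine ⟨B * volume.real (tsupport φ), fun v D h => ?_⟩
  have henergy₀ z : 0 ≤ φ z ^ (P + 1) * (‖D z‖ * γ ‖D z‖) :=
    mul_nonneg (pow_nonneg (hφ₀ z) _) (hγ.mul_nonneg (norm_nonneg _))
  calc ∫ z in K, ‖D z‖ * γ ‖D z‖ = ∫ z in K, φ z ^ (P + 1) * (‖D z‖ * γ ‖D z‖) :=
        setIntegral_congr_fun hK.measurableSet fun z hz => by simp [hφK z hz]
    _ ≤ ∫ z, φ z ^ (P + 1) * (‖D z‖ * γ ‖D z‖) :=
        setIntegral_le_integral ((hφ.pow P).integrable_smul h.locInt_energy) (.of_forall henergy₀)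
    _ ≤ B * volume.real (tsupport φ) := hB Q v φ D hQ h hφ hφ₀ hφ₁
        (fun z => (hX z).trans (le_max_right _ _))
        fun z => (le_abs_self _).trans ((hT z).trans (le_max_left _ _))

end Energy

section Truncation

/-- The primitive of `trunc δ`, a smooth substitute for `δ |x|`. -/
noncomputable def truncPrimitive (δ x : ℝ) : ℝ := δ * √(δ ^ 2 + x ^ 2)

/-- A smooth substitute for the truncation of `x` at height `δ`. -/
noncomputable def trunc (δ x : ℝ) : ℝ := δ * x / √(δ ^ 2 + x ^ 2)

/-- The derivative of `trunc δ`, comparable to `1` on `[-δ, δ]`. -/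
noncomputable def truncDeriv (δ x : ℝ) : ℝ := δ ^ 3 / √(δ ^ 2 + x ^ 2) ^ 3

variable {δ : ℝ}

theorem sqrt_sq_add_sq_pos (hδ : 0 < δ) (x : ℝ) : 0 < √(δ ^ 2 + x ^ 2) := by positivity

theorem hasDerivAt_sqrt_sq_add_sq (hδ : 0 < δ) (x : ℝ) :
    HasDerivAt (fun x => √(δ ^ 2 + x ^ 2)) (x / √(δ ^ 2 + x ^ 2)) x := by
  have h := ((hasDerivAt_pow 2 x).const_add (δ ^ 2)).sqrt (by positivity)
  refine h.congr_deriv ?_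
  norm_num
  rw [mul_div_mul_left _ _ two_ne_zero]

theorem hasDerivAt_truncPrimitive (hδ : 0 < δ) (x : ℝ) :
    HasDerivAt (truncPrimitive δ) (trunc δ x) x :=
  ((hasDerivAt_sqrt_sq_add_sq hδ x).const_mul δ).congr_deriv (by rw [trunc, mul_div_assoc])

theorem hasDerivAt_trunc (hδ : 0 < δ) (x : ℝ) : HasDerivAt (trunc δ) (truncDeriv δ x) x := by
  have hpos := sqrt_sq_add_sq_pos hδ x
  have hsq := Real.sq_sqrt (add_nonneg (sq_nonneg δ) (sq_nonneg x))
  refine (((hasDerivAt_id' x).const_mul δ).fun_div (hasDerivAt_sqrt_sq_add_sq hδ x)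
    hpos.ne').congr_deriv ?_
  rw [truncDeriv]
  field_simp
  rw [hsq]
  ring

theorem contDiff_trunc (hδ : 0 < δ) : ContDiff ℝ ∞ (trunc δ) :=
  ContDiff.div (by fun_prop) (ContDiff.sqrt (by fun_prop) fun x => by positivity)
    fun x => (sqrt_sq_add_sq_pos hδ x).ne'

theorem abs_trunc_le (hδ : 0 < δ) (x : ℝ) : |trunc δ x| ≤ δ := by
  have hpos := sqrt_sq_add_sq_pos hδ x
  rw [trunc, abs_div, abs_mul, abs_of_pos hδ, abs_of_pos hpos, div_le_iff₀ hpos]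
  gcongr
  exact Real.abs_le_sqrt (le_add_of_nonneg_left (sq_nonneg δ))

theorem isTruncation_trunc (hδ : 0 < δ) (B : ℝ) :
    IsTruncation (truncPrimitive δ) (trunc δ) (truncDeriv δ) B δ where
  contDiff := contDiff_trunc hδ
  hasDerivAt_primitive := hasDerivAt_truncPrimitive hδ
  hasDerivAt := hasDerivAt_trunc hδ
  bounded x _ := abs_trunc_le hδ x

theorem truncPrimitive_nonneg (hδ : 0 ≤ δ) (x : ℝ) : 0 ≤ truncPrimitive δ x := by
  unfold truncPrimitive
  positivity

theorem truncPrimitive_le (hδ : 0 ≤ δ) (x : ℝ) : truncPrimitive δ x ≤ δ * (δ + |x|) := by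
  unfold truncPrimitive
  gcongr
  rw [Real.sqrt_le_left (by positivity)]
  nlinarith [sq_abs x, mul_nonneg hδ (abs_nonneg x)]

theorem truncDeriv_nonneg (hδ : 0 ≤ δ) (x : ℝ) : 0 ≤ truncDeriv δ x := by
  unfold truncDeriv
  positivity

theorem truncDeriv_le_one (hδ : 0 ≤ δ) (x : ℝ) : truncDeriv δ x ≤ 1 := by
  unfold truncDeriv
  apply div_le_one_of_le₀ _ (by positivity)
  gcongr
  exact Real.le_sqrt_of_sq_le (le_add_of_nonneg_right (sq_nonneg x))

theorem one_le_truncDeriv (hδ : 0 < δ) {x : ℝ} (hx : |x| ≤ δ) : 1 ≤ 8 * truncDeriv δ x := by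
  have hsqrt : √(δ ^ 2 + x ^ 2) ≤ 2 * δ := by
    rw [Real.sqrt_le_left (by positivity)]
    nlinarith [sq_abs x, abs_nonneg x]
  rw [truncDeriv, ← mul_div_assoc, one_le_div (by positivity)]
  calc √(δ ^ 2 + x ^ 2) ^ 3 ≤ (2 * δ) ^ 3 := by gcongr
    _ = 8 * δ ^ 3 := by ring

end Truncation

section QuantitativeMonotonicity

theorem IsGrowthFunction.max_mul_le {γ : ℝ → ℝ} {P : ℕ} (hγ : IsGrowthFunction γ P) {s t : ℝ}
    (hs : 0 ≤ s) (ht : 0 ≤ t) : max s t * γ (max s t) ≤ s * γ s + t * γ t := by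
  rcases max_choice s t with h | h <;> rw [h]
  · exact le_add_of_nonneg_right (hγ.mul_nonneg ht)
  · exact le_add_of_nonneg_left (hγ.mul_nonneg hs)

namespace IsMonotoneField

variable {E : Type*} [NormedAddCommGroup E] [InnerProductSpace ℝ E] {A : E → E} {γ : ℝ → ℝ}
  {P : ℕ} {C c η : ℝ}

theorem inner_nonneg (hA : IsMonotoneField A γ C c) (ξ ζ : E) :
    0 ≤ inner ℝ (A ξ - A ζ) (ξ - ζ) := by
  rcases eq_or_ne ξ ζ with rfl | h
  · simp
  · exact (hA.strictMono ξ ζ h).le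

theorem norm_sub_map_le (hA : IsMonotoneField A γ C c) (hγ : IsGrowthFunction γ P) (ξ ζ : E) :
    ‖A ξ - A ζ‖ ≤ 2 * (C * γ (max ‖ξ‖ ‖ζ‖)) := by
  have hC := hA.growth_nonneg
  calc ‖A ξ - A ζ‖ ≤ C * γ ‖ξ‖ + C * γ ‖ζ‖ :=
        (norm_sub_le _ _).trans (add_le_add (hA.growth ξ) (hA.growth ζ))
    _ ≤ C * γ (max ‖ξ‖ ‖ζ‖) + C * γ (max ‖ξ‖ ‖ζ‖) := by
        gcongr <;> apply hγ.monotone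
        exacts [le_max_left _ _, le_max_right _ _]
    _ = 2 * (C * γ (max ‖ξ‖ ‖ζ‖)) := (two_mul _).symm

variable [ProperSpace E]

theorem exists_le_inner (hA : IsMonotoneField A γ C c) (R : ℝ) (hη : 0 < η) :
    ∃ m, 0 < m ∧ ∀ ξ ζ : E, ‖ξ‖ ≤ R → ‖ζ‖ ≤ R → η ≤ ‖ξ - ζ‖ →
      m ≤ inner ℝ (A ξ - A ζ) (ξ - ζ) := by
  have hcompact : IsCompact ((Metric.closedBall (0 : E) R ×ˢ Metric.closedBall (0 : E) R) ∩
      {p | η ≤ ‖p.1 - p.2‖}) :=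
    ((isCompact_closedBall _ _).prod (isCompact_closedBall _ _)).inter_right
      (isClosed_le continuous_const (by fun_prop))
  have hcont : Continuous fun p : E × E => inner ℝ (A p.1 - A p.2) (p.1 - p.2) := by
    have := hA.continuous
    fun_prop
  obtain ⟨m, hm₀, hm⟩ := hcompact.exists_forall_le' (a := 0) hcont.continuousOn fun p hp =>
    hA.strictMono _ _ fun heq => hη.not_ge (by simpa [heq] using hp.2)
  exact ⟨m, hm₀, fun ξ ζ hξ hζ h => hm (ξ, ζ) ⟨⟨by simpa using hξ, by simpa using hζ⟩, h⟩⟩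

theorem exists_norm_sub_le (hA : IsMonotoneField A γ C c) (hγ : IsGrowthFunction γ P)
    (hη : 0 < η) : ∃ B, 0 ≤ B ∧ ∀ ξ ζ : E, ‖ξ - ζ‖ ≤ η * (1 + ‖ξ‖ * γ ‖ξ‖ + ‖ζ‖ * γ ‖ζ‖)
      + B * inner ℝ (A ξ - A ζ) (ξ - ζ) := by
  obtain ⟨R, hR₀, hR⟩ := hγ.exists_forall_le_mul (half_pos hη)
  obtain ⟨m, hm₀, hm⟩ := hA.exists_le_inner R hη
  refine ⟨2 * R / m, by positivity, fun ξ ζ => ?_⟩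
  have henergy := mul_le_mul_of_nonneg_left
    (hγ.max_mul_le (norm_nonneg ξ) (norm_nonneg ζ)) hη.le
  have henergy₀ := mul_nonneg hη.le (hγ.mul_nonneg (le_max_of_le_left (norm_nonneg ξ) :
    0 ≤ max ‖ξ‖ ‖ζ‖))
  have hinner₀ := mul_nonneg (by positivity : 0 ≤ 2 * R / m) (hA.inner_nonneg ξ ζ)
  have hnorm : ‖ξ - ζ‖ ≤ 2 * max ‖ξ‖ ‖ζ‖ := by
    linarith [norm_sub_le ξ ζ, le_max_left ‖ξ‖ ‖ζ‖, le_max_right ‖ξ‖ ‖ζ‖]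
  rcases lt_or_ge ‖ξ - ζ‖ η with hclose | hfar
  · linarith
  rcases le_total R (max ‖ξ‖ ‖ζ‖) with hlarge | hsmall
  · linarith [hR _ hlarge]
  · have hle : 2 * R ≤ 2 * R / m * inner ℝ (A ξ - A ζ) (ξ - ζ) := by
      rw [div_mul_eq_mul_div, le_div_iff₀ hm₀]
      gcongr
      exact hm ξ ζ ((le_max_left _ _).trans hsmall) ((le_max_right _ _).trans hsmall) hfar
    linarith

theorem exists_norm_sub_map_le (hA : IsMonotoneField A γ C c) (hγ : IsGrowthFunction γ P)
    (hη : 0 < η) : ∃ B, 0 ≤ B ∧ ∀ ξ ζ : E,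
      ‖A ξ - A ζ‖ ≤ η * (1 + ‖ξ‖ * γ ‖ξ‖ + ‖ζ‖ * γ ‖ζ‖) + B * ‖ξ - ζ‖ := by
  have hC := hA.growth_nonneg
  set R : ℝ := 2 * C / η with hR
  have hγR := hγ.nonneg R
  obtain ⟨d, hd, huniform⟩ := Metric.uniformContinuousOn_iff.1
    ((isCompact_closedBall (0 : E) R).uniformContinuousOn_of_continuous
      hA.continuous.continuousOn) η hη
  refine ⟨2 * (C * γ R) / d, by positivity, fun ξ ζ => ?_⟩
  have henergy := mul_le_mul_of_nonneg_left
    (hγ.max_mul_le (norm_nonneg ξ) (norm_nonneg ζ)) hη.le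
  have henergy₀ := mul_nonneg hη.le (hγ.mul_nonneg (le_max_of_le_left (norm_nonneg ξ) :
    0 ≤ max ‖ξ‖ ‖ζ‖))
  have hdist₀ : 0 ≤ 2 * (C * γ R) / d * ‖ξ - ζ‖ := by positivity
  have hnorm := hA.norm_sub_map_le hγ ξ ζ
  rcases le_total R (max ‖ξ‖ ‖ζ‖) with hlarge | hsmall
  · rw [hR, div_le_iff₀ hη] at hlarge
    linarith [mul_le_mul_of_nonneg_right hlarge (hγ.nonneg (max ‖ξ‖ ‖ζ‖))]
  rcases lt_or_ge ‖ξ - ζ‖ d with hclose | hfar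
  · have h := huniform ξ (by simpa using (le_max_left _ _).trans hsmall) ζ
      (by simpa using (le_max_right _ _).trans hsmall) (by rwa [dist_eq_norm])
    rw [dist_eq_norm] at h
    linarith
  · have hle : 2 * (C * γ R) ≤ 2 * (C * γ R) / d * ‖ξ - ζ‖ := by
      rw [div_mul_eq_mul_div, le_div_iff₀ hd]
      gcongr
    linarith [mul_le_mul_of_nonneg_left (hγ.monotone hsmall) hC]

end IsMonotoneField

end QuantitativeMonotonicity

section Comparability

variable {n : ℕ} {γ : ℝ → ℝ} {P : ℕ} {A : Space n → Space n} {C c M : ℝ} {Q : Set (SpaceTime n)}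
  {v₁ v₂ : SpaceTime n → ℝ} {D₁ D₂ : SpaceTime n → Space n}

theorem IsBoundedSupersolution.locallyIntegrableOn_truncDeriv_mul_inner
    (h₁ : IsBoundedSupersolution A γ Q M v₁ D₁) (h₂ : IsBoundedSupersolution A γ Q M v₂ D₂)
    (hγ : IsGrowthFunction γ P) (hA : IsMonotoneField A γ C c) {δ : ℝ} (hδ : 0 < δ) :
    LocallyIntegrableOn (fun z => truncDeriv δ (v₁ z - v₂ z)
      * inner ℝ (A (D₁ z) - A (D₂ z)) (D₁ z - D₂ z)) Q := by
  have hcont := (isTruncation_trunc hδ 0).continuous_deriv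
  refine locallyIntegrableOn_of_norm_le ((h₁.locInt_energy.add h₂.locInt_energy).smul (4 * C))
    ((hcont.comp_aestronglyMeasurable (h₁.weakGrad.locInt.aestronglyMeasurable.sub
      h₂.weakGrad.locInt.aestronglyMeasurable)).mul
      ((h₁.locInt_flux.aestronglyMeasurable.sub h₂.locInt_flux.aestronglyMeasurable).inner
        (h₁.weakGrad.locInt_grad.aestronglyMeasurable.sub
          h₂.weakGrad.locInt_grad.aestronglyMeasurable))) fun z => ?_
  refine le_trans ?_ (le_abs_self _)
  calc ‖truncDeriv δ (v₁ z - v₂ z) * inner ℝ (A (D₁ z) - A (D₂ z)) (D₁ z - D₂ z)‖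
      ≤ 1 * ((‖A (D₁ z)‖ + ‖A (D₂ z)‖) * (‖D₁ z‖ + ‖D₂ z‖)) := by
        rw [norm_mul, Real.norm_of_nonneg (truncDeriv_nonneg hδ.le _)]
        gcongr
        · exact truncDeriv_le_one hδ.le _
        · exact (norm_inner_le_norm _ _).trans (by gcongr <;> exact norm_sub_le _ _)
    _ ≤ 2 * C * (‖D₁ z‖ * γ ‖D₁ z‖ + ‖D₂ z‖ * γ ‖D₂ z‖)
        + 2 * C * (‖D₁ z‖ * γ ‖D₁ z‖ + ‖D₂ z‖ * γ ‖D₂ z‖) := by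
        rw [one_mul]
        exact hA.norm_mul_norm_le hγ _ _ _ _
    _ = 4 * C * (‖D₁ z‖ * γ ‖D₁ z‖ + ‖D₂ z‖ * γ ‖D₂ z‖) := by ring

theorem abs_truncPrimitive_sub_le {δ a b : ℝ} (hδ : 0 ≤ δ) (hδ₁ : δ ≤ 1) (ha : |a| ≤ M)
    (hb : |b| ≤ M) : |truncPrimitive δ (a - b) - δ * (a + b)| ≤ δ * (1 + 4 * M) := by
  calc |truncPrimitive δ (a - b) - δ * (a + b)| ≤ |truncPrimitive δ (a - b)| + |δ * (a + b)| :=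
        abs_sub _ _
    _ ≤ δ * (δ + |a - b|) + δ * |a + b| := by
        rw [abs_of_nonneg (truncPrimitive_nonneg hδ _), abs_mul, abs_of_nonneg hδ]
        gcongr
        exact truncPrimitive_le hδ _
    _ ≤ δ * (1 + 2 * M) + δ * (2 * M) := by
        gcongr
        · exact (abs_sub _ _).trans (by linarith)
        · exact (abs_add_le _ _).trans (by linarith)
    _ = δ * (1 + 4 * M) := by ring

theorem comparisonIntegrand_trunc_le {Fa Fb : SpaceTime n → Space n} {θ a b : SpaceTime n → ℝ}
    {Da Db : SpaceTime n → Space n} {δ T X : ℝ} {z : SpaceTime n} (hδ : 0 < δ) (hδ₁ : δ ≤ 1)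
    (ha : |a z| ≤ M) (hb : |b z| ≤ M) (htime : |timeDeriv θ z| ≤ T) (hspace : ‖spaceGrad θ z‖ ≤ X) :
    comparisonIntegrand (truncPrimitive δ) (trunc δ) (truncDeriv δ) δ θ a b Da Db Fa Fb z ≤
      δ * ((1 + 4 * M) * T + 2 * X * (‖Fa z‖ + ‖Fb z‖))
        - θ z * (truncDeriv δ (a z - b z) * inner ℝ (Fa z - Fb z) (Da z - Db z)) := by
  have hM : 0 ≤ M := (abs_nonneg _).trans ha
  have htime_term : (truncPrimitive δ (a z - b z) - δ * (a z + b z)) * timeDeriv θ z ≤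
      δ * (1 + 4 * M) * T := by
    refine (le_abs_self _).trans ?_
    rw [abs_mul]
    gcongr
    exact abs_truncPrimitive_sub_le hδ.le hδ₁ ha hb
  have hsum_term : δ * inner ℝ (Fa z + Fb z) (spaceGrad θ z) ≤ δ * ((‖Fa z‖ + ‖Fb z‖) * X) := by
    gcongr
    exact (real_inner_le_norm _ _).trans (by gcongr; exact norm_add_le _ _)
  have hdiff_term : -(trunc δ (a z - b z) * inner ℝ (Fa z - Fb z) (spaceGrad θ z)) ≤
      δ * ((‖Fa z‖ + ‖Fb z‖) * X) := by
    refine (neg_le_abs _).trans ?_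
    rw [abs_mul]
    gcongr
    · exact abs_trunc_le hδ _
    · exact (abs_real_inner_le_norm _ _).trans (by gcongr; exact norm_sub_le _ _)
  unfold comparisonIntegrand
  linarith

theorem IsBoundedSupersolution.integral_mul_truncDeriv_mul_inner_le
    (h₁ : IsBoundedSupersolution A γ Q M v₁ D₁) (h₂ : IsBoundedSupersolution A γ Q M v₂ D₂)
    (hQ : IsOpen Q) (hγ : IsGrowthFunction γ P) (hA : IsMonotoneField A γ C c) (hM : 0 ≤ M)
    {θ : SpaceTime n → ℝ} (hθ : IsTestFunction Q θ) (hθ₀ : ∀ z, 0 ≤ θ z) {T X δ : ℝ}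
    (htime : ∀ z, |timeDeriv θ z| ≤ T) (hspace : ∀ z, ‖spaceGrad θ z‖ ≤ X)
    (hδ : 0 < δ) (hδ₁ : δ ≤ 1) :
    ∫ z, θ z * (truncDeriv δ (v₁ z - v₂ z) * inner ℝ (A (D₁ z) - A (D₂ z)) (D₁ z - D₂ z)) ≤
      δ * ∫ z in tsupport θ, ((1 + 4 * M) * T + 2 * X * (‖A (D₁ z)‖ + ‖A (D₂ z)‖)) := by
  obtain ⟨hint, hnonneg⟩ := h₁.integral_comparisonIntegrand_nonneg h₂ hQ hγ hA hM
    (isTruncation_trunc hδ (2 * M)) hθ hθ₀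
  have hmeas := (isClosed_tsupport θ).measurableSet
  set J := fun z => (1 + 4 * M) * T + 2 * X * (‖A (D₁ z)‖ + ‖A (D₂ z)‖)
  have hfluxInt := (h₁.locInt_flux.norm.add h₂.locInt_flux.norm).integrableOn_compact_subset
    hθ.support hθ.compact
  have hJInt : Integrable ((tsupport θ).indicator J) := (integrable_indicator_iff hmeas).2
    ((integrableOn_const hθ.compact.isCompact.measure_lt_top.ne).add (hfluxInt.const_mul (2 * X)))
  have hinnerInt := hθ.integrable_smul
    (h₁.locallyIntegrableOn_truncDeriv_mul_inner h₂ hγ hA hδ)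
  have hle := integral_mono_ae hint ((hJInt.const_mul δ).sub hinnerInt) ?_
  · rw [integral_sub' (hJInt.const_mul δ) hinnerInt, integral_const_mul,
      integral_indicator hmeas] at hle
    simp only [smul_eq_mul] at hle
    linarith
  · filter_upwards [(ae_restrict_iff' hQ.measurableSet).1 h₁.bounded,
      (ae_restrict_iff' hQ.measurableSet).1 h₂.bounded] with z hz₁ hz₂
    by_cases hz : z ∈ tsupport θ
    · simpa [indicator_of_mem hz] using comparisonIntegrand_trunc_le hδ hδ₁
        (hz₁ (hθ.support hz)) (hz₂ (hθ.support hz)) (htime z) (hspace z)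
    · simp [comparisonIntegrand, timeDeriv_eq_zero hz, spaceGrad_eq_zero hz,
        image_eq_zero_of_notMem_tsupport hz, indicator_of_notMem hz]

theorem IsMonotoneField.exists_setIntegral_norm_flux_le (hA : IsMonotoneField A γ C c)
    (hγ : IsGrowthFunction γ P) (hM : 0 ≤ M) {K : Set (SpaceTime n)} (hK : IsCompact K)
    (hQ : IsOpen Q) (hKQ : K ⊆ Q) :
    ∃ B : ℝ, ∀ v D, IsBoundedSupersolution A γ Q M v D → ∫ z in K, ‖A (D z)‖ ≤ B := by
  obtain ⟨B, hB⟩ := hA.exists_setIntegral_energy_le hγ hM hK hQ hKQ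
  have hC := hA.growth_nonneg
  refine ⟨C * (B + volume.real K * γ 1), fun v D h => ?_⟩
  have henergyInt := h.locInt_energy.integrableOn_compact_subset hKQ hK
  have hconstInt : IntegrableOn (fun _ : SpaceTime n => γ 1) K :=
    integrableOn_const hK.measure_lt_top.ne
  calc ∫ z in K, ‖A (D z)‖ ≤ ∫ z in K, C * (‖D z‖ * γ ‖D z‖ + γ 1) := by
        refine setIntegral_mono (h.locInt_flux.integrableOn_compact_subset hKQ hK).norm
          ((henergyInt.add hconstInt).const_mul C) fun z => (hA.growth _).trans ?_
        gcongr
        simpa using hγ.le_mul_add (norm_nonneg (D z)) one_pos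
    _ = C * (∫ z in K, ‖D z‖ * γ ‖D z‖) + C * (volume.real K * γ 1) := by
        rw [integral_const_mul, integral_add henergyInt hconstInt, setIntegral_const, smul_eq_mul,
          mul_add]
    _ ≤ C * (B + volume.real K * γ 1) := by
        rw [mul_add]
        gcongr
        exact hB v D h

theorem IsMonotoneField.exists_integral_truncDeriv_mul_le (hA : IsMonotoneField A γ C c)
    (hγ : IsGrowthFunction γ P) (hM : 0 ≤ M) {K : Set (SpaceTime n)} (hK : IsCompact K)
    (hQ : IsOpen Q) (hKQ : K ⊆ Q) :
    ∃ B, 0 ≤ B ∧ ∀ v₁ v₂ D₁ D₂ δ, IsBoundedSupersolution A γ Q M v₁ D₁ →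
      IsBoundedSupersolution A γ Q M v₂ D₂ → 0 < δ → δ ≤ 1 →
      ∫ z in K, truncDeriv δ (v₁ z - v₂ z) * inner ℝ (A (D₁ z) - A (D₂ z)) (D₁ z - D₂ z) ≤
        B * δ := by
  obtain ⟨θ, hθ, hθ₀, -, hθK⟩ := exists_isTestFunction_eq_one hK hQ hKQ
  obtain ⟨T, hT⟩ := hθ.exists_norm_timeDeriv_le
  obtain ⟨X, hX⟩ := hθ.exists_norm_spaceGrad_le
  have hX₀ : 0 ≤ X := (norm_nonneg _).trans (hX 0)
  obtain ⟨B, hB⟩ := hA.exists_setIntegral_norm_flux_le hγ hM hθ.compact.isCompact hQ hθ.support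
  refine ⟨max 0 (volume.real (tsupport θ) * ((1 + 4 * M) * T) + 2 * X * (B + B)),
    le_max_left _ _, fun v₁ v₂ D₁ D₂ δ h₁ h₂ hδ hδ₁ => ?_⟩
  have hflux₁ := h₁.locInt_flux.norm.integrableOn_compact_subset hθ.support hθ.compact
  have hflux₂ := h₂.locInt_flux.norm.integrableOn_compact_subset hθ.support hθ.compact
  have hflux : IntegrableOn (fun z => 2 * X * (‖A (D₁ z)‖ + ‖A (D₂ z)‖)) (tsupport θ) :=
    (hflux₁.add hflux₂).const_mul (2 * X)
  have hconst : IntegrableOn (fun _ : SpaceTime n => (1 + 4 * M) * T) (tsupport θ) :=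
    integrableOn_const hθ.compact.isCompact.measure_lt_top.ne
  set I := fun z => truncDeriv δ (v₁ z - v₂ z) * inner ℝ (A (D₁ z) - A (D₂ z)) (D₁ z - D₂ z)
  have hI₀ z : 0 ≤ I z := mul_nonneg (truncDeriv_nonneg hδ.le _) (hA.inner_nonneg _ _)
  calc ∫ z in K, I z = ∫ z in K, θ z * I z :=
        setIntegral_congr_fun hK.measurableSet fun z hz => by simp [hθK z hz]
    _ ≤ ∫ z, θ z * I z :=
        setIntegral_le_integral (hθ.integrable_smul
          (h₁.locallyIntegrableOn_truncDeriv_mul_inner h₂ hγ hA hδ))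
          (.of_forall fun z => mul_nonneg (hθ₀ z) (hI₀ z))
    _ ≤ δ * ∫ z in tsupport θ, ((1 + 4 * M) * T + 2 * X * (‖A (D₁ z)‖ + ‖A (D₂ z)‖)) :=
        h₁.integral_mul_truncDeriv_mul_inner_le h₂ hQ hγ hA hM hθ hθ₀ hT hX hδ hδ₁
    _ ≤ δ * max 0 (volume.real (tsupport θ) * ((1 + 4 * M) * T) + 2 * X * (B + B)) := by
        rw [integral_add hconst hflux, setIntegral_const, smul_eq_mul, integral_const_mul,
          integral_add hflux₁ hflux₂]
        gcongr
        refine le_max_of_le_right ?_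
        gcongr
        exacts [hB v₁ D₁ h₁, hB v₂ D₂ h₂]
    _ = _ := mul_comm _ _

end Comparability

section LocalConvergence

theorem exists_forall_eqOn_of_pairwise_disjoint {ι α β : Type*} [Nonempty β] {E : ι → Set α}
    (hE : Pairwise (Function.onFun Disjoint E)) (f : ι → α → β) : ∃ g, ∀ i, EqOn g (f i) (E i) := by
  classical
  refine ⟨fun x => if h : ∃ i, x ∈ E i then f h.choose x else Classical.arbitrary β,
    fun i x hx => ?_⟩
  have h : ∃ i, x ∈ E i := ⟨i, hx⟩
  have hi : h.choose = i := hE.eq (not_disjoint_iff.2 ⟨x, h.choose_spec, hx⟩)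
  simp only [dif_pos h, hi]

theorem exists_monotone_isCompact_exhaustion {X : Type*} [TopologicalSpace X]
    [LocallyCompactSpace X] [SecondCountableTopology X] {Q : Set X} (hQ : IsOpen Q) :
    ∃ K : ℕ → Set X, Monotone K ∧ (∀ m, IsCompact (K m)) ∧ (∀ m, K m ⊆ Q) ∧
      ∀ L ⊆ Q, IsCompact L → ∃ m, L ⊆ K m := by
  have := hQ.locallyCompactSpace
  obtain ⟨Y⟩ : Nonempty (CompactExhaustion Q) := inferInstance
  refine ⟨fun m => Subtype.val '' Y m, fun i j hij => image_mono (Y.subset hij),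
    fun m => (Y.isCompact m).image continuous_subtype_val, fun m => Subtype.coe_image_subset Q _,
    fun L hLQ hL => ?_⟩
  have hL' : IsCompact (Subtype.val ⁻¹' L : Set Q) := by
    rwa [Subtype.isCompact_iff, Subtype.image_preimage_coe, inter_eq_right.2 hLQ]
  obtain ⟨m, hm⟩ := Y.exists_superset_of_isCompact hL'
  exact ⟨m, fun x hx => ⟨⟨x, hLQ hx⟩, hm hx, rfl⟩⟩

variable {X F : Type*} [MeasurableSpace X] [NormedAddCommGroup F]

theorem tendsto_zero_of_le_mul_add {ι : Type*} {l : Filter ι} {f : ι → ℝ} {E : ℝ}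
    (hf : ∀ i, 0 ≤ f i)
    (h : ∀ η > 0, ∃ G : ι → ℝ, Tendsto G l (𝓝 0) ∧ ∀ i, f i ≤ η * E + G i) :
    Tendsto f l (𝓝 0) := by
  refine Metric.tendsto_nhds.2 fun ε hε => ?_
  obtain ⟨G, hG, hle⟩ := h (ε / (2 * (|E| + 1))) (by positivity)
  filter_upwards [hG.eventually_lt_const (half_pos hε)] with i hi
  have hE : ε / (2 * (|E| + 1)) * E ≤ ε / 2 := by
    calc ε / (2 * (|E| + 1)) * E ≤ ε / (2 * (|E| + 1)) * (|E| + 1) := by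
          gcongr
          linarith [le_abs_self E]
      _ = ε / 2 := by field_simp
  rw [Real.dist_eq, sub_zero, abs_of_nonneg (hf i)]
  linarith [hle i]

theorem exists_tendsto_integral_norm_sub {μ : Measure X} [CompleteSpace F]
    {f : ℕ → X → F} (hf : ∀ i, Integrable (f i) μ)
    (hcauchy : Tendsto (fun p : ℕ × ℕ => ∫ x, ‖f p.1 x - f p.2 x‖ ∂μ) atTop (𝓝 0)) :
    ∃ g, Integrable g μ ∧ Tendsto (fun i => ∫ x, ‖f i x - g x‖ ∂μ) atTop (𝓝 0) := by
  have hdist i {g : X → F} (hg : Integrable g μ) :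
      dist ((hf i).toL1 (f i)) (hg.toL1 g) = ∫ x, ‖f i x - g x‖ ∂μ := by
    rw [dist_eq_norm, ← Integrable.toL1_sub (f i) g (hf i) hg, L1.norm_of_fun_eq_integral_norm]
    rfl
  have hseq : CauchySeq fun i => (hf i).toL1 (f i) :=
    cauchySeq_iff_tendsto_dist_atTop_0.2 (by simpa only [hdist] using hcauchy)
  obtain ⟨g, hg⟩ := cauchySeq_tendsto_of_complete hseq
  refine ⟨g, L1.integrable_coeFn g, (tendsto_iff_dist_tendsto_zero.1 hg).congr fun i => ?_⟩
  rw [← hdist i (L1.integrable_coeFn g), Integrable.toL1_coeFn]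

theorem tendsto_integral_norm_sub_of_norm_le {μ : Measure X} [IsFiniteMeasure μ] {f : ℕ → X → F}
    {g : X → F} {M : ℝ} (hf : ∀ i, AEStronglyMeasurable (f i) μ) (hM : ∀ i, ∀ᵐ x ∂μ, ‖f i x‖ ≤ M)
    (hlim : ∀ᵐ x ∂μ, Tendsto (fun i => f i x) atTop (𝓝 (g x))) :
    Tendsto (fun i => ∫ x, ‖f i x - g x‖ ∂μ) atTop (𝓝 0) := by
  have hg := aestronglyMeasurable_of_tendsto_ae atTop hf hlim
  rw [← integral_zero X ℝ (μ := μ)]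
  refine tendsto_integral_of_dominated_convergence (fun _ => M + M)
    (fun i => ((hf i).sub hg).norm) (integrable_const _) (fun i => ?_) ?_
  · filter_upwards [hM i, ae_all_iff.2 hM, hlim] with x hfx hbound hx
    rw [norm_norm]
    exact (norm_sub_le _ _).trans (add_le_add hfx (le_of_tendsto' hx.norm hbound))
  · filter_upwards [hlim] with x hx using tendsto_iff_norm_sub_tendsto_zero.1 hx

theorem lintegral_comp_le_of_tendsto_integral_norm_sub {μ : Measure X} {f : ℕ → X → F} {g : X → F}
    (hf : ∀ i, Integrable (f i) μ) (hg : Integrable g μ)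
    (hlim : Tendsto (fun i => ∫ x, ‖f i x - g x‖ ∂μ) atTop (𝓝 0)) {e : F → ENNReal}
    (he : Continuous e) {b : ENNReal} (hb : ∀ i, ∫⁻ x, e (f i x) ∂μ ≤ b) :
    ∫⁻ x, e (g x) ∂μ ≤ b := by
  have hnorm : Tendsto (fun i => eLpNorm (f i - g) 1 μ) atTop (𝓝 0) := by
    rw [← ENNReal.ofReal_zero]
    refine ((ENNReal.continuous_ofReal.tendsto 0).comp hlim).congr fun i => ?_
    rw [eLpNorm_one_eq_lintegral_enorm]
    exact ofReal_integral_norm_eq_lintegral_enorm ((hf i).sub hg)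
  obtain ⟨ns, -, hns⟩ := (tendstoInMeasure_of_tendsto_eLpNorm one_ne_zero
    (fun i => (hf i).aestronglyMeasurable) hg.aestronglyMeasurable hnorm).exists_seq_tendsto_ae
  calc ∫⁻ x, e (g x) ∂μ = ∫⁻ x, liminf (fun k => e (f (ns k) x)) atTop ∂μ := by
        refine lintegral_congr_ae ?_
        filter_upwards [hns] with x hx
        exact ((he.tendsto _).comp hx).liminf_eq.symm
    _ ≤ liminf (fun k => ∫⁻ x, e (f (ns k) x) ∂μ) atTop :=
        lintegral_liminf_le' fun k =>
          (he.comp_aestronglyMeasurable (hf (ns k)).aestronglyMeasurable).aemeasurable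
    _ ≤ b := liminf_le_of_le (by isBoundedDefault) fun a ha =>
        let ⟨k, hk⟩ := ha.exists; hk.trans (hb _)

variable [TopologicalSpace X]

/-- Convergence in `L¹_loc(Q)`. Local integrability of the functions is not part of the notion and
has to be assumed separately: the integral of a function that is not integrable is `0`. -/
def TendstoL1LocOn (f : ℕ → X → F) (g : X → F) (Q : Set X)
    (μ : Measure X := by volume_tac) : Prop :=
  ∀ K ⊆ Q, IsCompact K → Tendsto (fun i => ∫ x in K, ‖f i x - g x‖ ∂μ) atTop (𝓝 0)

theorem tendstoL1LocOn_of_norm_le {μ : Measure X} [IsFiniteMeasureOnCompacts μ] {Q : Set X}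
    {f : ℕ → X → F} {g : X → F} {M : ℝ} (hf : ∀ i, AEStronglyMeasurable (f i) (μ.restrict Q))
    (hM : ∀ i, ∀ᵐ x ∂μ.restrict Q, ‖f i x‖ ≤ M)
    (hlim : ∀ᵐ x ∂μ.restrict Q, Tendsto (fun i => f i x) atTop (𝓝 (g x))) :
    TendstoL1LocOn f g Q μ := by
  intro K hKQ hK
  have hle : μ.restrict K ≤ μ.restrict Q := Measure.restrict_mono hKQ le_rfl
  have : IsFiniteMeasure (μ.restrict K) := isFiniteMeasure_restrict.2 hK.measure_lt_top.ne
  exact tendsto_integral_norm_sub_of_norm_le (fun i => (hf i).mono_measure hle)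
    (fun i => ae_mono hle (hM i)) (ae_mono hle hlim)

-- The `L¹` limits on the members of a compact exhaustion are glued along successive differences.
theorem exists_tendstoL1LocOn [T2Space X] [OpensMeasurableSpace X] [LocallyCompactSpace X]
    [SecondCountableTopology X] [CompleteSpace F] {μ : Measure X} {Q : Set X}
    (hQ : IsOpen Q) {f : ℕ → X → F} (hf : ∀ i, LocallyIntegrableOn (f i) Q μ)
    (hcauchy : ∀ K ⊆ Q, IsCompact K →
      Tendsto (fun p : ℕ × ℕ => ∫ x in K, ‖f p.1 x - f p.2 x‖ ∂μ) atTop (𝓝 0)) :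
    ∃ g, LocallyIntegrableOn g Q μ ∧ TendstoL1LocOn f g Q μ := by
  obtain ⟨K, hmono, hK, hKQ, hexh⟩ := exists_monotone_isCompact_exhaustion hQ
  have hfK m i : IntegrableOn (f i) (K m) μ := (hf i).integrableOn_compact_subset (hKQ m) (hK m)
  choose h hh hlim using fun m =>
    exists_tendsto_integral_norm_sub (hfK m) (hcauchy (K m) (hKQ m) (hK m))
  have hE m : MeasurableSet (disjointed K m) := .disjointed (fun i => (hK i).measurableSet) m
  obtain ⟨g, hg⟩ := exists_forall_eqOn_of_pairwise_disjoint (disjoint_disjointed K) h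
  have hunion m : K m = ⋃ i ∈ Finset.range (m + 1), disjointed K i := by
    rw [biUnion_range_succ_disjointed, hmono.partialSups_eq]
  have hgE m : IntegrableOn g (disjointed K m) μ :=
    (integrableOn_congr_fun (hg m) (hE m)).2 (IntegrableOn.mono_set (hh m) (disjointed_subset K m))
  have hgK m : IntegrableOn g (K m) μ := by
    rw [hunion m, integrableOn_finset_iUnion]
    exact fun i _ => hgE i
  have hlimE m : Tendsto (fun i => ∫ x in disjointed K m, ‖f i x - g x‖ ∂μ) atTop (𝓝 0) := by
    refine squeeze_zero (fun i => integral_nonneg fun x => norm_nonneg _) (fun i => ?_) (hlim m)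
    rw [setIntegral_congr_fun (g := fun x => ‖f i x - h m x‖) (hE m) fun x hx => by
      simp only [hg m hx]]
    exact setIntegral_mono_set ((hfK m i).sub (hh m)).norm (.of_forall fun x => norm_nonneg _)
      (disjointed_subset K m).eventuallyLE
  have hlimK m : Tendsto (fun i => ∫ x in K m, ‖f i x - g x‖ ∂μ) atTop (𝓝 0) := by
    have hsum := tendsto_finsetSum (Finset.range (m + 1)) fun k _ => hlimE k
    rw [Finset.sum_const_zero] at hsum
    refine hsum.congr fun i => ?_
    rw [hunion m, integral_biUnion_finset _ (fun k _ => hE k)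
      fun k _ l _ hkl => disjoint_disjointed K hkl]
    exact fun k _ => (((hfK k i).mono_set (disjointed_subset K k)).sub (hgE k)).norm
  refine ⟨g, (locallyIntegrableOn_iff hQ.isLocallyClosed).2 fun L hLQ hL => ?_,
    fun L hLQ hL => ?_⟩
  · obtain ⟨m, hm⟩ := hexh L hLQ hL
    exact (hgK m).mono_set hm
  · obtain ⟨m, hm⟩ := hexh L hLQ hL
    exact squeeze_zero (fun i => integral_nonneg fun x => norm_nonneg _)
      (fun i => setIntegral_mono_set ((hfK m i).sub (hgK m)).norm
        (.of_forall fun x => norm_nonneg _) hm.eventuallyLE) (hlimK m)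

theorem TendstoL1LocOn.tendsto_integral_bilinear {E H : Type*} [OpensMeasurableSpace X] [T2Space X]
    [NormedAddCommGroup E] [NormedSpace ℝ E] [NormedSpace ℝ F] [NormedAddCommGroup H]
    [NormedSpace ℝ H] [SecondCountableTopologyEither X E] {μ : Measure X} {Q : Set X}
    {f : ℕ → X → F} {g : X → F} (hlim : TendstoL1LocOn f g Q μ)
    (hf : ∀ i, LocallyIntegrableOn (f i) Q μ) (hg : LocallyIntegrableOn g Q μ)
    (B : F →L[ℝ] E →L[ℝ] H) {K : Set X} (hK : IsCompact K) (hKQ : K ⊆ Q) {ψ : X → E}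
    (hψ : Continuous ψ) (hψK : ∀ x ∉ K, ψ x = 0) :
    Tendsto (fun i => ∫ x, B (f i x) (ψ x) ∂μ) atTop (𝓝 (∫ x, B (g x) (ψ x) ∂μ)) := by
  obtain ⟨κ, hκ⟩ := hψ.bounded_above_of_compact_support (.intro hK hψK)
  have hle (w : F) (x : X) : ‖B w (ψ x)‖ ≤ ‖B‖ * κ * ‖w‖ :=
    calc ‖B w (ψ x)‖ ≤ ‖B‖ * ‖w‖ * ‖ψ x‖ := B.le_opNorm₂ w (ψ x)
      _ ≤ ‖B‖ * ‖w‖ * κ := by gcongr; exact hκ x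
      _ = _ := by ring
  have hint {w : X → F} (hw : LocallyIntegrableOn w Q μ) :
      IntegrableOn w K μ ∧ IntegrableOn (fun x => B (w x) (ψ x)) K μ := by
    have hw' := hw.integrableOn_compact_subset hKQ hK
    exact ⟨hw', (hw'.norm.const_mul (‖B‖ * κ)).mono' (B.aestronglyMeasurable_comp₂
      hw'.aestronglyMeasurable hψ.aestronglyMeasurable) (.of_forall fun x => hle _ x)⟩
  have hsupp (w : X → F) : ∫ x in K, B (w x) (ψ x) ∂μ = ∫ x, B (w x) (ψ x) ∂μ :=
    setIntegral_eq_integral_of_forall_compl_eq_zero fun x hx => by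
      rw [hψK x hx, map_zero]
  simp only [← hsupp]
  rw [tendsto_iff_norm_sub_tendsto_zero]
  have hzero := (hlim K hKQ hK).const_mul (‖B‖ * κ)
  rw [mul_zero] at hzero
  refine squeeze_zero (fun i => norm_nonneg _) (fun i => ?_) hzero
  rw [← integral_sub (hint (hf i)).2 (hint hg).2, ← integral_const_mul]
  refine norm_integral_le_of_norm_le (((hint (hf i)).1.sub (hint hg).1).norm.const_mul _)
    (.of_forall fun x => ?_)
  rw [← sub_apply, ← map_sub]
  exact hle _ x

end LocalConvergence

section LimitPassage

theorem setIntegral_le_mul_add {X : Type*} [MeasurableSpace X] {μ : Measure X} {K : Set X}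
    {f e₁ e₂ w : X → ℝ} {η B₁ B₂ : ℝ} (hK : μ K ≠ ⊤) (hη : 0 ≤ η) (he₁ : IntegrableOn e₁ K μ)
    (he₂ : IntegrableOn e₂ K μ) (hw : IntegrableOn w K μ) (hB₁ : ∫ x in K, e₁ x ∂μ ≤ B₁)
    (hB₂ : ∫ x in K, e₂ x ∂μ ≤ B₂) (hf₀ : ∀ x, 0 ≤ f x)
    (hf : ∀ x, f x ≤ η * (1 + e₁ x + e₂ x) + w x) :
    ∫ x in K, f x ∂μ ≤ η * (μ.real K + B₁ + B₂) + ∫ x in K, w x ∂μ := by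
  have hone : IntegrableOn (fun _ => (1 : ℝ)) K μ := integrableOn_const hK
  have hone₁ : IntegrableOn (fun x => 1 + e₁ x) K μ := hone.add he₁
  have hsum : IntegrableOn (fun x => η * (1 + e₁ x + e₂ x)) K μ := (hone₁.add he₂).const_mul η
  calc ∫ x in K, f x ∂μ ≤ ∫ x in K, (η * (1 + e₁ x + e₂ x) + w x) ∂μ :=
        integral_mono_of_nonneg (.of_forall hf₀) (hsum.add hw) (.of_forall hf)
    _ = η * (μ.real K + (∫ x in K, e₁ x ∂μ) + ∫ x in K, e₂ x ∂μ) + ∫ x in K, w x ∂μ := by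
        rw [integral_add hsum hw, integral_const_mul, integral_add hone₁ he₂, integral_add hone he₁,
          setIntegral_const, smul_eq_mul, mul_one]
    _ ≤ η * (μ.real K + B₁ + B₂) + ∫ x in K, w x ∂μ := by gcongr

namespace IsMonotoneField

variable {E : Type*} [NormedAddCommGroup E] [InnerProductSpace ℝ E] [ProperSpace E] {A : E → E}
  {γ : ℝ → ℝ} {C c : ℝ} {P : ℕ}

-- Where `|x| ≤ δ` the monotonicity term is comparable to the inner product; elsewhere
-- `1 ≤ |x| / δ` absorbs the constant.
theorem exists_norm_sub_le_truncDeriv (hA : IsMonotoneField A γ C c) (hγ : IsGrowthFunction γ P)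
    {η : ℝ} (hη : 0 < η) :
    ∃ B R, 0 ≤ B ∧ 0 ≤ R ∧ ∀ ξ ζ δ x, 0 < δ →
      ‖ξ - ζ‖ ≤ η * (1 + ‖ξ‖ * γ ‖ξ‖ + ‖ζ‖ * γ ‖ζ‖) +
        B * (truncDeriv δ x * inner ℝ (A ξ - A ζ) (ξ - ζ)) + R / δ * |x| := by
  obtain ⟨B, hB₀, hB⟩ := hA.exists_norm_sub_le hγ hη
  obtain ⟨R, hR₀, hR⟩ := hγ.exists_le_mul_add hη
  refine ⟨8 * B, 2 * R, by positivity, by positivity, fun ξ ζ δ x hδ => ?_⟩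
  have hinner := hA.inner_nonneg ξ ζ
  have hS := truncDeriv_nonneg hδ.le x
  rcases le_or_gt |x| δ with hx | hx
  · have hmul := mul_le_mul_of_nonneg_right (one_le_truncDeriv hδ hx) (mul_nonneg hB₀ hinner)
    have hrest : 0 ≤ 2 * R / δ * |x| := by positivity
    linarith [hB ξ ζ]
  · have hmul : 2 * R ≤ 2 * R / δ * |x| := by
      rw [div_mul_eq_mul_div, le_div_iff₀ hδ]
      gcongr
    have hterm : 0 ≤ 8 * B * (truncDeriv δ x * inner ℝ (A ξ - A ζ) (ξ - ζ)) := by positivity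
    linarith [hR ‖ξ‖ (norm_nonneg _), hR ‖ζ‖ (norm_nonneg _), norm_sub_le ξ ζ]

end IsMonotoneField

variable {n : ℕ} {γ : ℝ → ℝ} {P : ℕ} {A : Space n → Space n} {C c M : ℝ}
  {Q K : Set (SpaceTime n)}

theorem IsMonotoneField.exists_setIntegral_norm_grad_sub_le (hA : IsMonotoneField A γ C c)
    (hγ : IsGrowthFunction γ P) (hM : 0 ≤ M) (hK : IsCompact K) (hQ : IsOpen Q) (hKQ : K ⊆ Q) :
    ∃ S, ∀ η > 0, ∃ R, ∀ v₁ v₂ D₁ D₂, IsBoundedSupersolution A γ Q M v₁ D₁ →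
      IsBoundedSupersolution A γ Q M v₂ D₂ →
      ∫ z in K, ‖D₁ z - D₂ z‖ ≤ η * S + R * ∫ z in K, |v₁ z - v₂ z| := by
  obtain ⟨B₁, hB₁⟩ := hA.exists_setIntegral_energy_le hγ hM hK hQ hKQ
  obtain ⟨B₂, hB₂₀, hB₂⟩ := hA.exists_integral_truncDeriv_mul_le hγ hM hK hQ hKQ
  refine ⟨volume.real K + B₁ + B₁ + 1, fun η hη => ?_⟩
  obtain ⟨B, R, hB₀, -, hBR⟩ := hA.exists_norm_sub_le_truncDeriv hγ hη
  obtain ⟨δ, hδ, hδ₁, hδη⟩ : ∃ δ, 0 < δ ∧ δ ≤ 1 ∧ B * (B₂ * δ) ≤ η := by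
    refine ⟨min 1 (η / (B * B₂ + 1)), by positivity, min_le_left _ _, ?_⟩
    calc B * (B₂ * min 1 (η / (B * B₂ + 1))) ≤ (B * B₂ + 1) * (η / (B * B₂ + 1)) := by
          rw [← mul_assoc]
          gcongr
          exacts [by linarith, min_le_right _ _]
      _ = η := by field_simp
  refine ⟨R / δ, fun v₁ v₂ D₁ D₂ h₁ h₂ => ?_⟩
  have hint {F : Type} [NormedAddCommGroup F] {f : SpaceTime n → F}
      (hf : LocallyIntegrableOn f Q) : IntegrableOn f K := hf.integrableOn_compact_subset hKQ hK
  have hmono := (hint (h₁.locallyIntegrableOn_truncDeriv_mul_inner h₂ hγ hA hδ)).const_mul B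
  have hv : IntegrableOn (fun z => R / δ * |v₁ z - v₂ z|) K :=
    (hint (h₁.weakGrad.locInt.sub h₂.weakGrad.locInt)).abs.const_mul (R / δ)
  calc ∫ z in K, ‖D₁ z - D₂ z‖
      ≤ η * (volume.real K + B₁ + B₁) + ∫ z in K, (B * (truncDeriv δ (v₁ z - v₂ z)
          * inner ℝ (A (D₁ z) - A (D₂ z)) (D₁ z - D₂ z)) + R / δ * |v₁ z - v₂ z|) :=
        setIntegral_le_mul_add hK.measure_lt_top.ne hη.le (hint h₁.locInt_energy)
          (hint h₂.locInt_energy) (hmono.add hv) (hB₁ _ _ h₁) (hB₁ _ _ h₂)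
          (fun z => norm_nonneg _) fun z => by
            rw [← add_assoc]
            exact hBR (D₁ z) (D₂ z) δ (v₁ z - v₂ z) hδ
    _ = η * (volume.real K + B₁ + B₁) + B * (∫ z in K, truncDeriv δ (v₁ z - v₂ z)
          * inner ℝ (A (D₁ z) - A (D₂ z)) (D₁ z - D₂ z)) + R / δ * ∫ z in K, |v₁ z - v₂ z| := by
        rw [integral_add hmono hv, integral_const_mul, integral_const_mul, ← add_assoc]
    _ ≤ η * (volume.real K + B₁ + B₁) + η + R / δ * ∫ z in K, |v₁ z - v₂ z| := by
        gcongr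
        exact (mul_le_mul_of_nonneg_left (hB₂ v₁ v₂ D₁ D₂ δ h₁ h₂ hδ hδ₁) hB₀).trans hδη
    _ = _ := by ring

variable {v : ℕ → SpaceTime n → ℝ} {D : ℕ → SpaceTime n → Space n} {u : SpaceTime n → ℝ}
  {Du : SpaceTime n → Space n}

theorem IsMonotoneField.exists_tendstoL1LocOn_grad (hA : IsMonotoneField A γ C c)
    (hγ : IsGrowthFunction γ P) (hM : 0 ≤ M) (hQ : IsOpen Q)
    (hv : ∀ i, IsBoundedSupersolution A γ Q M (v i) (D i)) (hu : LocallyIntegrableOn u Q)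
    (hlim : TendstoL1LocOn v u Q) :
    ∃ Du, LocallyIntegrableOn Du Q ∧ TendstoL1LocOn D Du Q := by
  refine exists_tendstoL1LocOn hQ (fun i => (hv i).weakGrad.locInt_grad) fun K hKQ hK => ?_
  rw [← prod_atTop_atTop_eq]
  obtain ⟨S, hS⟩ := hA.exists_setIntegral_norm_grad_sub_le hγ hM hK hQ hKQ
  have hint i : IntegrableOn (fun z => |v i z - u z|) K :=
    (((hv i).weakGrad.locInt.sub hu).integrableOn_compact_subset hKQ hK).abs
  have hpair : Tendsto (fun p : ℕ × ℕ => ∫ z in K, |v p.1 z - v p.2 z|)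
      (atTop ×ˢ atTop) (𝓝 0) := by
    have hsum := ((hlim K hKQ hK).comp tendsto_fst).add
      ((hlim K hKQ hK).comp tendsto_snd)
    rw [add_zero] at hsum
    refine squeeze_zero (fun p => integral_nonneg fun z => abs_nonneg _) (fun p => ?_) hsum
    refine (integral_mono_of_nonneg (.of_forall fun z => abs_nonneg _)
      ((hint p.1).add (hint p.2)) (.of_forall fun z => ?_)).trans
      (integral_add (hint p.1) (hint p.2)).le
    simpa only [Pi.add_apply, abs_sub_comm (u z)] using abs_sub_le (v p.1 z) (u z) (v p.2 z)
  refine tendsto_zero_of_le_mul_add (E := S) (fun p => integral_nonneg fun z => norm_nonneg _)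
    fun η hη => ?_
  obtain ⟨R, hR⟩ := hS η hη
  refine ⟨fun p => R * ∫ z in K, |v p.1 z - v p.2 z|, ?_, fun p => hR _ _ _ _ (hv p.1) (hv p.2)⟩
  simpa only [mul_zero] using hpair.const_mul R

theorem IsGrowthFunction.integrableOn_energy_of_tendsto (hγ : IsGrowthFunction γ P)
    (hD : ∀ i, IntegrableOn (D i) K) (hDu : IntegrableOn Du K)
    (hlim : Tendsto (fun i => ∫ z in K, ‖D i z - Du z‖) atTop (𝓝 0))
    (henergy : ∀ i, IntegrableOn (fun z => ‖D i z‖ * γ ‖D i z‖) K) {B : ℝ}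
    (hB : ∀ i, ∫ z in K, ‖D i z‖ * γ ‖D i z‖ ≤ B) :
    IntegrableOn (fun z => ‖Du z‖ * γ ‖Du z‖) K := by
  have hcont : Continuous fun ξ : Space n => ‖ξ‖ * γ ‖ξ‖ :=
    continuous_norm.mul (hγ.continuous.comp continuous_norm)
  have hnonneg (ξ : Space n) : 0 ≤ ‖ξ‖ * γ ‖ξ‖ := hγ.mul_nonneg (norm_nonneg ξ)
  refine ⟨hcont.comp_aestronglyMeasurable hDu.aestronglyMeasurable, ?_⟩
  rw [hasFiniteIntegral_iff_ofReal (.of_forall fun z => hnonneg _)]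
  refine (lintegral_comp_le_of_tendsto_integral_norm_sub hD hDu hlim
    (ENNReal.continuous_ofReal.comp hcont) (b := ENNReal.ofReal B) fun i => ?_).trans_lt
      ENNReal.ofReal_lt_top
  simp only [Function.comp_apply]
  rw [← ofReal_integral_eq_lintegral_ofReal (henergy i) (.of_forall fun z => hnonneg _)]
  exact ENNReal.ofReal_le_ofReal (hB i)

theorem IsMonotoneField.tendsto_setIntegral_norm_comp_sub (hA : IsMonotoneField A γ C c)
    (hγ : IsGrowthFunction γ P) (hK : volume K ≠ ⊤) (hD : ∀ i, IntegrableOn (D i) K)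
    (hDu : IntegrableOn Du K) (hlim : Tendsto (fun i => ∫ z in K, ‖D i z - Du z‖) atTop (𝓝 0))
    (henergy : ∀ i, IntegrableOn (fun z => ‖D i z‖ * γ ‖D i z‖) K) {B : ℝ}
    (hB : ∀ i, ∫ z in K, ‖D i z‖ * γ ‖D i z‖ ≤ B) :
    Tendsto (fun i => ∫ z in K, ‖A (D i z) - A (Du z)‖) atTop (𝓝 0) := by
  refine tendsto_zero_of_le_mul_add (E := volume.real K + B + ∫ z in K, ‖Du z‖ * γ ‖Du z‖)
    (fun i => integral_nonneg fun z => norm_nonneg _) fun η hη => ?_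
  obtain ⟨R, -, hR⟩ := hA.exists_norm_sub_map_le hγ hη
  refine ⟨fun i => R * ∫ z in K, ‖D i z - Du z‖, by simpa only [mul_zero] using hlim.const_mul R,
    fun i => ?_⟩
  simp only [← integral_const_mul]
  exact setIntegral_le_mul_add hK hη.le (henergy i)
    (hγ.integrableOn_energy_of_tendsto hD hDu hlim henergy hB)
    (((hD i).sub hDu).norm.const_mul R) (hB i) le_rfl (fun z => norm_nonneg _) fun z => hR _ _

theorem IsWeakSpaceGrad.of_tendstoL1LocOn (hv : ∀ i, IsWeakSpaceGrad Q (v i) (D i))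
    (hu : LocallyIntegrableOn u Q) (hDu : LocallyIntegrableOn Du Q) (hlim : TendstoL1LocOn v u Q)
    (hlimD : TendstoL1LocOn D Du Q) : IsWeakSpaceGrad Q u Du where
  locInt := hu
  locInt_grad := hDu
  byParts φ hφ := by
    have hleft := hlim.tendsto_integral_bilinear (fun i => (hv i).locInt) hu
      (ContinuousLinearMap.lsmul ℝ ℝ) hφ.compact hφ.support hφ.continuous_spaceGrad
      fun z => spaceGrad_eq_zero
    have hright := hlimD.tendsto_integral_bilinear (fun i => (hv i).locInt_grad) hDu
      (ContinuousLinearMap.lsmul ℝ ℝ).flip hφ.compact hφ.support hφ.smooth.continuous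
      fun z => image_eq_zero_of_notMem_tsupport
    simp only [ContinuousLinearMap.flip_apply, ContinuousLinearMap.lsmul_apply] at hleft hright
    rw [hφ.setIntegral_smul_spaceGrad, hφ.setIntegral_smul]
    refine tendsto_nhds_unique hleft (hright.neg.congr fun i => ?_)
    rw [← hφ.setIntegral_smul_spaceGrad, ← hφ.setIntegral_smul, (hv i).byParts φ hφ]

theorem IsFluxSupersolution.of_tendstoL1LocOn {F : ℕ → SpaceTime n → Space n}
    {Fu : SpaceTime n → Space n} (hv : ∀ i, IsFluxSupersolution Q (v i) (D i) (F i))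
    (hDu : IsWeakSpaceGrad Q u Du) (hFu : LocallyIntegrableOn Fu Q) (hlim : TendstoL1LocOn v u Q)
    (hlimF : TendstoL1LocOn F Fu Q) : IsFluxSupersolution Q u Du Fu where
  weakGrad := hDu
  locInt_flux := hFu
  nonneg η hη hη₀ := by
    have htime := hlim.tendsto_integral_bilinear (fun i => (hv i).weakGrad.locInt) hDu.locInt
      (ContinuousLinearMap.mul ℝ ℝ) hη.compact hη.support hη.continuous_timeDeriv
      fun z => timeDeriv_eq_zero
    have hspace := hlimF.tendsto_integral_bilinear (fun i => (hv i).locInt_flux) hFu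
      (innerSL ℝ) hη.compact hη.support hη.continuous_spaceGrad fun z => spaceGrad_eq_zero
    have hsplit {w : SpaceTime n → ℝ} {f : SpaceTime n → Space n}
        (hw : LocallyIntegrableOn w Q) (hf : LocallyIntegrableOn f Q) :
        ∫ z, (inner ℝ (f z) (spaceGrad η z) - w z * timeDeriv η z) =
          (∫ z, inner ℝ (f z) (spaceGrad η z)) - ∫ z, w z * timeDeriv η z :=
      integral_sub (hη.integrable_inner_spaceGrad hf) (hη.integrable_mul_timeDeriv hw)
    rw [hsplit hDu.locInt hFu]
    refine ge_of_tendsto' (hspace.sub htime) fun i => ?_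
    exact ((hv i).nonneg η hη hη₀).trans_eq (hsplit (hv i).weakGrad.locInt (hv i).locInt_flux)

theorem IsMonotoneField.exists_isBoundedSupersolution_of_tendsto (hA : IsMonotoneField A γ C c)
    (hγ : IsGrowthFunction γ P) (hM : 0 ≤ M) (hQ : IsOpen Q)
    (hv : ∀ i, IsBoundedSupersolution A γ Q M (v i) (D i))
    (hlim : ∀ᵐ z ∂volume.restrict Q, Tendsto (fun i => v i z) atTop (𝓝 (u z))) :
    ∃ Du, IsBoundedSupersolution A γ Q M u Du := by
  have hmeas i := (hv i).weakGrad.locInt.aestronglyMeasurable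
  have hbound : ∀ᵐ z ∂volume.restrict Q, ‖u z‖ ≤ M := by
    filter_upwards [ae_all_iff.2 fun i => (hv i).bounded, hlim] with z hz hlimz
    exact le_of_tendsto' hlimz.norm hz
  have hu : LocallyIntegrableOn u Q :=
    locallyIntegrableOn_of_locallyIntegrable_restrict ((locallyIntegrable_const M).mono
      (aestronglyMeasurable_of_tendsto_ae atTop hmeas hlim)
      (hbound.mono fun z hz => hz.trans (le_abs_self M)))
  have hlimv := tendstoL1LocOn_of_norm_le hmeas (fun i => (hv i).bounded) hlim
  obtain ⟨Du, hDu, hlimD⟩ := hA.exists_tendstoL1LocOn_grad hγ hM hQ hv hu hlimv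
  have hlocal (K) (hKQ : K ⊆ Q) (hK : IsCompact K) :
      IntegrableOn (fun z => ‖Du z‖ * γ ‖Du z‖) K ∧
        Tendsto (fun i => ∫ z in K, ‖A (D i z) - A (Du z)‖) atTop (𝓝 0) := by
    obtain ⟨B, hB⟩ := hA.exists_setIntegral_energy_le hγ hM hK hQ hKQ
    have hDK i : IntegrableOn (D i) K :=
      (hv i).weakGrad.locInt_grad.integrableOn_compact_subset hKQ hK
    have hDuK := hDu.integrableOn_compact_subset hKQ hK
    have henergy i := (hv i).locInt_energy.integrableOn_compact_subset hKQ hK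
    exact ⟨hγ.integrableOn_energy_of_tendsto hDK hDuK (hlimD K hKQ hK) henergy
      fun i => hB _ _ (hv i), hA.tendsto_setIntegral_norm_comp_sub hγ hK.measure_lt_top.ne hDK hDuK
      (hlimD K hKQ hK) henergy fun i => hB _ _ (hv i)⟩
  have henergy : LocallyIntegrableOn (fun z => ‖Du z‖ * γ ‖Du z‖) Q :=
    (locallyIntegrableOn_iff hQ.isLocallyClosed).2 fun K hKQ hK => (hlocal K hKQ hK).1
  exact ⟨Du, .of_tendstoL1LocOn (fun i => (hv i).toIsFluxSupersolution)
    (.of_tendstoL1LocOn (fun i => (hv i).weakGrad) hu hDu hlimv hlimD)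
    (hA.locallyIntegrableOn_comp hγ hDu.aestronglyMeasurable henergy) hlimv
    fun K hKQ hK => (hlocal K hKQ hK).2, henergy, hbound⟩

end LimitPassage

section Cutoffs

variable {s' s τ t' r : ℝ}

/-- A smooth function of time that rises from `0` to `1` on `[s', s]` and returns to `0` on
`[τ, t']`. -/
noncomputable def timeCutoff (s' s τ t' r : ℝ) : ℝ :=
  Real.smoothTransition ((r - s') / (s - s')) * Real.smoothTransition ((t' - r) / (t' - τ))

theorem contDiff_timeCutoff : ContDiff ℝ ∞ (timeCutoff s' s τ t') :=
  (Real.smoothTransition.contDiff.comp (by fun_prop)).mul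
    (Real.smoothTransition.contDiff.comp (by fun_prop))

theorem timeCutoff_nonneg : 0 ≤ timeCutoff s' s τ t' r :=
  mul_nonneg (Real.smoothTransition.nonneg _) (Real.smoothTransition.nonneg _)

theorem timeCutoff_le_one : timeCutoff s' s τ t' r ≤ 1 :=
  mul_le_one₀ (Real.smoothTransition.le_one _) (Real.smoothTransition.nonneg _)
    (Real.smoothTransition.le_one _)

theorem timeCutoff_eq_one (hs : s' < s) (hτ : τ < t') (hr : r ∈ Ioo s τ) :
    timeCutoff s' s τ t' r = 1 := by
  rw [timeCutoff,
    Real.smoothTransition.one_of_one_le ((one_le_div (sub_pos.2 hs)).2 (by linarith [hr.1])),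
    Real.smoothTransition.one_of_one_le ((one_le_div (sub_pos.2 hτ)).2 (by linarith [hr.2])),
    mul_one]

theorem tsupport_timeCutoff_subset (hs : s' < s) (hτ : τ < t') :
    tsupport (timeCutoff s' s τ t') ⊆ Icc s' t' := by
  refine closure_minimal (fun r hr => ?_) isClosed_Icc
  have hfactors := mul_ne_zero_iff.1 hr
  have hleft := mt Real.smoothTransition.zero_of_nonpos hfactors.1
  have hright := mt Real.smoothTransition.zero_of_nonpos hfactors.2
  rw [not_le, div_pos_iff_of_pos_right (sub_pos.2 hs), sub_pos] at hleft
  rw [not_le, div_pos_iff_of_pos_right (sub_pos.2 hτ), sub_pos] at hright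
  exact ⟨hleft.le, hright.le⟩

theorem exists_deriv_smoothTransition_le : ∃ B, ∀ x, ‖deriv Real.smoothTransition x‖ ≤ B := by
  have hsmooth : ContDiff ℝ 1 Real.smoothTransition := Real.smoothTransition.contDiff
  refine (hsmooth.continuous_deriv le_rfl).bounded_above_of_compact_support
    (HasCompactSupport.intro (isCompact_Icc (a := (0 : ℝ)) (b := 1)) fun x hx => ?_)
  rcases lt_or_ge x 0 with hx₀ | hx₀
  · have hzero : Real.smoothTransition =ᶠ[𝓝 x] fun _ => 0 := by
      filter_upwards [Iio_mem_nhds hx₀] with y hy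
      exact Real.smoothTransition.zero_of_nonpos (le_of_lt hy)
    simpa using hzero.deriv_eq
  · have hx₁ : 1 < x := not_le.1 fun h => hx ⟨hx₀, h⟩
    have hone : Real.smoothTransition =ᶠ[𝓝 x] fun _ => 1 := by
      filter_upwards [Ioi_mem_nhds hx₁] with y hy
      exact Real.smoothTransition.one_of_one_le (le_of_lt hy)
    simpa using hone.deriv_eq

-- Only the rise on `[s', s]` contributes to the upper bound: the fall may be arbitrarily steep.
theorem exists_deriv_timeCutoff_le :
    ∃ B, 0 ≤ B ∧ ∀ s' s τ t' r, s' < s → τ < t' →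
      deriv (timeCutoff s' s τ t') r ≤ B / (s - s') := by
  obtain ⟨B, hB⟩ := exists_deriv_smoothTransition_le
  refine ⟨B, (norm_nonneg _).trans (hB 0), fun s' s τ t' r hs hτ => ?_⟩
  have : 0 < s - s' := sub_pos.2 hs
  set S := Real.smoothTransition
  have hSdiff : Differentiable ℝ S :=
    (Real.smoothTransition.contDiff (n := 1)).differentiable one_ne_zero
  have hrise : HasDerivAt (fun r => S ((r - s') / (s - s')))
      (deriv S ((r - s') / (s - s')) * (1 / (s - s'))) r :=
    (hSdiff _).hasDerivAt.comp r (((hasDerivAt_id r).sub_const s').div_const _)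
  have hfall : Antitone fun r => S ((t' - r) / (t' - τ)) := fun r₁ r₂ hr =>
    Real.smoothTransition.monotone (by have := sub_pos.2 hτ; gcongr)
  have hfallDiff : DifferentiableAt ℝ (fun r => S ((t' - r) / (t' - τ))) r :=
    (hSdiff _).comp r (by fun_prop)
  have hslope : 0 ≤ deriv S ((r - s') / (s - s')) * (1 / (s - s')) :=
    mul_nonneg Real.smoothTransition.monotone.deriv_nonneg (by positivity)
  calc deriv (timeCutoff s' s τ t') r
      = deriv S ((r - s') / (s - s')) * (1 / (s - s')) * S ((t' - r) / (t' - τ)) +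
          S ((r - s') / (s - s')) * deriv (fun r => S ((t' - r) / (t' - τ))) r :=
        (hrise.mul hfallDiff.hasDerivAt).deriv
    _ ≤ deriv S ((r - s') / (s - s')) * (1 / (s - s')) * 1 + 0 :=
        add_le_add (mul_le_mul_of_nonneg_left (Real.smoothTransition.le_one _) hslope)
          (mul_nonpos_of_nonneg_of_nonpos (Real.smoothTransition.nonneg _) hfall.deriv_nonpos)
    _ ≤ B / (s - s') := by
        rw [mul_one, add_zero, mul_one_div]
        gcongr
        exact (le_abs_self _).trans (hB _)

theorem tsupport_fst_mul_snd_subset {X Y : Type*} [TopologicalSpace X] [TopologicalSpace Y]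
    (χ : X → ℝ) (ψ : Y → ℝ) :
    tsupport (fun z : X × Y => χ z.1 * ψ z.2) ⊆ tsupport χ ×ˢ tsupport ψ :=
  closure_minimal (fun _ hz => ⟨subset_tsupport χ (left_ne_zero_of_mul hz),
    subset_tsupport ψ (right_ne_zero_of_mul hz)⟩) ((isClosed_tsupport χ).prod (isClosed_tsupport ψ))

variable {n : ℕ} {χ : Space n → ℝ} {ψ : ℝ → ℝ}

theorem spaceGrad_fst_mul_snd (ψ : ℝ → ℝ) {z : SpaceTime n} (hχ : DifferentiableAt ℝ χ z.1) :
    spaceGrad (fun z => χ z.1 * ψ z.2) z = ψ z.2 • gradient χ z.1 := by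
  rw [spaceGrad, gradient, gradient, (hχ.hasFDerivAt.mul_const (ψ z.2)).fderiv, map_smul]

theorem timeDeriv_fst_mul_snd (χ : Space n → ℝ) (ψ : ℝ → ℝ) (z : SpaceTime n) :
    timeDeriv (fun z => χ z.1 * ψ z.2) z = χ z.1 * deriv ψ z.2 :=
  deriv_const_mul_field (χ z.1)

theorem isTestFunction_fst_mul_snd {Q : Set (SpaceTime n)} (hχ : ContDiff ℝ ∞ χ)
    (hχc : HasCompactSupport χ) (hψ : ContDiff ℝ ∞ ψ) (hψc : HasCompactSupport ψ)
    (hsupp : tsupport χ ×ˢ tsupport ψ ⊆ Q) : IsTestFunction Q fun z => χ z.1 * ψ z.2 where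
  smooth := (hχ.comp contDiff_fst).mul (hψ.comp contDiff_snd)
  compact := (hχc.isCompact.prod hψc.isCompact).of_isClosed_subset (isClosed_tsupport _)
    (tsupport_fst_mul_snd_subset χ ψ)
  support := (tsupport_fst_mul_snd_subset χ ψ).trans hsupp

end Cutoffs

section Cylinders

variable {n : ℕ} {γ : ℝ → ℝ} {P : ℕ} {A : Space n → Space n} {C c : ℝ}
  {Q : Set (SpaceTime n)} {M : ℝ} {u : SpaceTime n → ℝ} {Du : SpaceTime n → Space n}
  {D : Set (Space n)} {s t : ℝ}

namespace ParabolicallyInside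

theorem subset (h : ParabolicallyInside D s t Q) : timeCylinder D s t ⊆ Q := by
  obtain ⟨-, -, -, D', s', -, hDD', hs', hsub⟩ := h
  exact (prod_mono (subset_closure.trans hDD') (Ioo_subset_Ioo_left hs'.le)).trans hsub

theorem volume_ne_top (h : ParabolicallyInside D s t Q) : volume (timeCylinder D s t) ≠ ⊤ :=
  ne_top_of_le_ne_top (h.2.1.prod (isCompact_Icc (a := s) (b := t))).measure_lt_top.ne
    (measure_mono (prod_mono subset_closure Ioo_subset_Icc_self))

theorem exists_cutoff (h : ParabolicallyInside D s t Q) :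
    ∃ κ m : ℝ, 0 ≤ κ ∧ ∀ τ ∈ Ioo s t, ∃ φ : SpaceTime n → ℝ, IsTestFunction Q φ ∧
      (∀ z, 0 ≤ φ z) ∧ (∀ z, φ z ≤ 1) ∧ (∀ z, ‖spaceGrad φ z‖ ≤ κ) ∧ (∀ z, timeDeriv φ z ≤ κ) ∧
      volume.real (tsupport φ) ≤ m ∧ ∀ z ∈ timeCylinder D s τ, φ z = 1 := by
  obtain ⟨-, hDc, -, D', s', hD', hDD', hs', hsub⟩ := h
  obtain ⟨χ, hχ, hχc, hχs, hχ₀, hχ₁, hχD⟩ := exists_contDiff_cutoff hDc hD' hDD'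
  obtain ⟨X, hX⟩ := (hχ.continuous_fderiv (by simp)).bounded_above_of_compact_support
    (hχc.fderiv (𝕜 := ℝ))
  obtain ⟨B, hB₀, hB⟩ := exists_deriv_timeCutoff_le
  obtain ⟨a, hs'a, has⟩ := exists_between hs'
  have hslope : 0 ≤ B / (s - a) := div_nonneg hB₀ (sub_pos.2 has).le
  refine ⟨max X (B / (s - a)), volume.real (tsupport χ ×ˢ Icc a t), le_max_of_le_right hslope,
    fun τ hτ => ?_⟩
  obtain ⟨b, hτb, hbt⟩ := exists_between hτ.2
  have hψs := tsupport_timeCutoff_subset has hτb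
  refine ⟨fun z => χ z.1 * timeCutoff a s τ b z.2,
    isTestFunction_fst_mul_snd hχ hχc contDiff_timeCutoff
      (isCompact_Icc.of_isClosed_subset (isClosed_tsupport _) hψs)
      ((prod_mono hχs (hψs.trans (Icc_subset_Ioo hs'a hbt))).trans hsub),
    fun z => mul_nonneg (hχ₀ _) timeCutoff_nonneg,
    fun z => mul_le_one₀ (hχ₁ _) timeCutoff_nonneg timeCutoff_le_one, fun z => ?_, fun z => ?_,
    measureReal_mono ((tsupport_fst_mul_snd_subset _ _).trans
      (prod_mono_right (hψs.trans (Icc_subset_Icc_right hbt.le))))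
      (hχc.isCompact.prod isCompact_Icc).measure_lt_top.ne,
    fun z hz => by simp only [hχD _ (subset_closure hz.1), timeCutoff_eq_one has hτb hz.2, mul_one]⟩
  · rw [spaceGrad_fst_mul_snd _ (hχ.differentiable (by simp) _), norm_smul,
      Real.norm_of_nonneg timeCutoff_nonneg, gradient, LinearIsometryEquiv.norm_map]
    exact ((mul_le_of_le_one_left (norm_nonneg _) timeCutoff_le_one).trans (hX _)).trans
      (le_max_left _ _)
  · rw [timeDeriv_fst_mul_snd]
    calc χ z.1 * deriv (timeCutoff a s τ b) z.2 ≤ χ z.1 * (B / (s - a)) :=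
          mul_le_mul_of_nonneg_left (hB _ _ _ _ _ has hτb) (hχ₀ _)
      _ ≤ B / (s - a) := mul_le_of_le_one_left hslope (hχ₁ _)
      _ ≤ max X (B / (s - a)) := le_max_right _ _

end ParabolicallyInside

theorem setLIntegral_timeCylinder_le (hst : s < t) {f : SpaceTime n → ENNReal} {b : ENNReal}
    (hf : ∀ τ ∈ Ioo s t, ∫⁻ z in timeCylinder D s τ, f z ≤ b) :
    ∫⁻ z in timeCylinder D s t, f z ≤ b := by
  obtain ⟨τ, hτmono, hτ, hτlim⟩ := exists_seq_strictMono_tendsto' hst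
  have hmono : Monotone fun k => timeCylinder D s (τ k) := fun k l hkl =>
    prod_mono_right (Ioo_subset_Ioo_right (hτmono.monotone hkl))
  have hunion : timeCylinder D s t = ⋃ k, timeCylinder D s (τ k) := by
    refine Subset.antisymm (fun z hz => ?_)
      (iUnion_subset fun k => prod_mono_right (Ioo_subset_Ioo_right (hτ k).2.le))
    obtain ⟨k, hk⟩ := (hτlim.eventually_const_lt hz.2.2).exists
    exact mem_iUnion.2 ⟨k, hz.1, hz.2.1, hk⟩
  rw [hunion, setLIntegral_iUnion_of_directed _ hmono.directed_le]
  exact iSup_le fun k => hf _ (hτ k)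

theorem IsBoundedSupersolution.setLIntegral_energy_lt_top (hu : IsBoundedSupersolution A γ Q M u Du)
    (hA : IsMonotoneField A γ C c) (hγ : IsGrowthFunction γ P) (hM : 0 ≤ M) (hQ : IsOpen Q)
    (h : ParabolicallyInside D s t Q) :
    ∫⁻ z in timeCylinder D s t, ENNReal.ofReal (‖Du z‖ * γ ‖Du z‖) < ⊤ := by
  obtain ⟨κ, m, hκ, hcut⟩ := h.exists_cutoff
  obtain ⟨B, hB₀, hB⟩ := hA.exists_integral_energy_le hγ hM hκ
  refine (setLIntegral_timeCylinder_le (b := ENNReal.ofReal (B * m)) h.2.2.1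
    fun τ hτ => ?_).trans_lt ENNReal.ofReal_lt_top
  obtain ⟨φ, hφ, hφ₀, hφ₁, hspace, htime, hm, hφD⟩ := hcut τ hτ
  have henergy₀ z : 0 ≤ φ z ^ (P + 1) * (‖Du z‖ * γ ‖Du z‖) :=
    mul_nonneg (pow_nonneg (hφ₀ z) _) (hγ.mul_nonneg (norm_nonneg _))
  calc ∫⁻ z in timeCylinder D s τ, ENNReal.ofReal (‖Du z‖ * γ ‖Du z‖)
      = ∫⁻ z in timeCylinder D s τ, ENNReal.ofReal (φ z ^ (P + 1) * (‖Du z‖ * γ ‖Du z‖)) :=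
        setLIntegral_congr_fun (h.1.measurableSet.prod measurableSet_Ioo) fun z hz => by
          simp only [hφD z hz, one_pow, one_mul]
    _ ≤ ∫⁻ z, ENNReal.ofReal (φ z ^ (P + 1) * (‖Du z‖ * γ ‖Du z‖)) :=
        setLIntegral_le_lintegral _ _
    _ = ENNReal.ofReal (∫ z, φ z ^ (P + 1) * (‖Du z‖ * γ ‖Du z‖)) :=
        (ofReal_integral_eq_lintegral_ofReal ((hφ.pow P).integrable_smul hu.locInt_energy)
          (.of_forall henergy₀)).symm
    _ ≤ ENNReal.ofReal (B * m) := ENNReal.ofReal_le_ofReal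
        ((hB Q u φ Du hQ hu hφ hφ₀ hφ₁ hspace htime).trans (by gcongr))

theorem exists_ae_setLIntegral_sq_le (hD : volume D ≠ ⊤)
    (hu : ∀ᵐ z ∂volume.restrict (timeCylinder D s t), ‖u z‖ ≤ M) :
    ∃ R : ℝ≥0, ∀ᵐ τ ∂volume.restrict (Ioo s t), ∫⁻ x in D, ‖u (x, τ)‖ₑ ^ 2 ≤ R := by
  have hfinite : ENNReal.ofReal M ^ 2 * volume D ≠ ⊤ :=
    ENNReal.mul_ne_top (ENNReal.pow_ne_top ENNReal.ofReal_ne_top) hD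
  refine ⟨(ENNReal.ofReal M ^ 2 * volume D).toNNReal, ?_⟩
  rw [timeCylinder, Measure.volume_eq_prod, ← Measure.prod_restrict] at hu
  filter_upwards [Measure.ae_ae_of_ae_prod
    (Measure.measurePreserving_swap.quasiMeasurePreserving.ae hu)] with τ hτ
  rw [ENNReal.coe_toNNReal hfinite, ← setLIntegral_const]
  refine lintegral_mono_ae (hτ.mono fun x hx => ?_)
  rw [← ofReal_norm]
  gcongr
  exact hx

theorem IsBoundedSupersolution.memV2G (hu : IsBoundedSupersolution A γ Q M u Du)
    (hA : IsMonotoneField A γ C c) (hγ : IsGrowthFunction γ P) (hM : 0 ≤ M) (hQ : IsOpen Q)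
    {G : ℝ → ℝ} (hG : ∀ s, 0 ≤ s → G s ≤ s * γ s) (h : ParabolicallyInside D s t Q) :
    MemV2G G D s t u Du := by
  have hres : volume.restrict (timeCylinder D s t) ≤ volume.restrict Q :=
    Measure.restrict_mono h.subset le_rfl
  have hbound := ae_mono hres hu.bounded
  have hmeas := hu.weakGrad.locInt.aestronglyMeasurable.mono_measure hres
  have hmeasGrad := hu.weakGrad.locInt_grad.aestronglyMeasurable.mono_measure hres
  have hfinite := hu.setLIntegral_energy_lt_top hA hγ hM hQ h
  have henergy : IntegrableOn (fun z => ‖Du z‖ * γ ‖Du z‖) (timeCylinder D s t) := by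
    refine ⟨hu.locInt_energy.aestronglyMeasurable.mono_measure hres, ?_⟩
    rwa [hasFiniteIntegral_iff_ofReal (.of_forall fun z => hγ.mul_nonneg (norm_nonneg _))]
  refine ⟨hu.weakGrad.mono h.subset, ⟨hmeas, ?_⟩, ⟨hmeasGrad, ?_⟩, ?_, ?_, ?_⟩
  · refine (lintegral_mono_ae (g := fun _ => ENNReal.ofReal (M * γ M)) ?_).trans_lt ?_
    · filter_upwards [hbound] with z hz
      exact ENNReal.ofReal_le_ofReal ((hG _ (norm_nonneg _)).trans
        (mul_le_mul hz (hγ.monotone hz) (hγ.nonneg _) hM))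
    · rw [setLIntegral_const]
      exact ENNReal.mul_lt_top ENNReal.ofReal_lt_top h.volume_ne_top.lt_top
  · exact (lintegral_mono fun z => ENNReal.ofReal_le_ofReal (hG _ (norm_nonneg _))).trans_lt hfinite
  · exact (integrableOn_const h.volume_ne_top).mono' hmeas hbound
  · obtain ⟨R, -, hR⟩ := hγ.exists_le_mul_add one_pos
    exact ((henergy.const_mul 1).add (integrableOn_const h.volume_ne_top (C := R))).mono' hmeasGrad
      (.of_forall fun z => hR _ (norm_nonneg _))
  · exact exists_ae_setLIntegral_sq_le
      (ne_top_of_le_ne_top h.2.1.measure_lt_top.ne (measure_mono subset_closure)) hbound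

end Cylinders

section WeakSupersolutions

variable {n : ℕ} {γ g : ℝ → ℝ} {P : ℕ} {A : Space n → Space n} {C c R : ℝ}
  {Q : Set (SpaceTime n)} {M : ℝ} {u : SpaceTime n → ℝ} {Du : SpaceTime n → Space n}

theorem IsTestFunction.neg_setIntegral_add_setIntegral {η v : SpaceTime n → ℝ}
    {F : SpaceTime n → Space n} (hη : IsTestFunction Q η) (hv : LocallyIntegrableOn v Q)
    (hF : LocallyIntegrableOn F Q) :
    -(∫ z in Q, v z * timeDeriv η z) + ∫ z in Q, inner ℝ (F z) (spaceGrad η z) =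
      ∫ z, (inner ℝ (F z) (spaceGrad η z) - v z * timeDeriv η z) := by
  rw [hη.setIntegral_mul_timeDeriv, hη.setIntegral_inner_spaceGrad,
    integral_sub (hη.integrable_inner_spaceGrad hF) (hη.integrable_mul_timeDeriv hv),
    neg_add_eq_sub]

theorem IsTestFunction.setIntegral_inner_sub_const_spaceGrad {η : SpaceTime n → ℝ}
    (hη : IsTestFunction Q η) (F : SpaceTime n → Space n) (e : Space n) :
    ∫ z in Q, inner ℝ (F z - e) (spaceGrad η z) = ∫ z in Q, inner ℝ (F z) (spaceGrad η z) := by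
  have hconst : Integrable fun z => inner ℝ e (spaceGrad η z) :=
    hη.integrable_inner_spaceGrad (locallyIntegrableOn_const e)
  rw [hη.setIntegral_inner_spaceGrad, hη.setIntegral_inner_spaceGrad]
  simp only [inner_sub_left]
  by_cases hF : Integrable fun z => inner ℝ (F z) (spaceGrad η z)
  · rw [integral_sub hF hconst, hη.integral_inner_spaceGrad, sub_zero]
  · rw [integral_undef hF, integral_undef fun h => hF ?_]
    simpa only [Pi.add_def, sub_add_cancel] using h.add hconst

theorem isWeakSupersolution_sub_const_iff {e : Space n} :
    IsWeakSupersolution (fun ξ => A ξ - e) g Q u ↔ IsWeakSupersolution A g Q u := by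
  refine exists_congr fun Du => and_congr_right fun _ => forall₂_congr fun η hη => ?_
  rw [hη.setIntegral_inner_sub_const_spaceGrad]

theorem IsBoundedSupersolution.isWeakSupersolution (hu : IsBoundedSupersolution A γ Q M u Du)
    (hA : IsMonotoneField A γ C c) (hγ : IsGrowthFunction γ P) (hM : 0 ≤ M) (hQ : IsOpen Q)
    (hG : ∀ s, 0 ≤ s → youngPrimitive g s ≤ s * γ s) : IsWeakSupersolution A g Q u :=
  ⟨Du, ⟨hu.weakGrad, fun _ _ _ h => hu.memV2G hA hγ hM hQ hG h⟩, fun η hη hη₀ =>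
    (hu.nonneg η hη hη₀).trans_eq
      (hη.neg_setIntegral_add_setIntegral hu.weakGrad.locInt hu.locInt_flux).symm⟩

theorem exists_parabolicallyInside_mem_nhds (hQ : IsOpen Q) {z : SpaceTime n} (hz : z ∈ Q) :
    ∃ D s t, ParabolicallyInside D s t Q ∧ timeCylinder D s t ∈ 𝓝 z := by
  obtain ⟨ε, hε, hball⟩ := Metric.isOpen_iff.1 hQ z hz
  refine ⟨Metric.ball z.1 (ε / 2), z.2 - ε / 2, z.2 + ε / 2, ⟨Metric.isOpen_ball, ?_, by linarith,
    Metric.ball z.1 ε, z.2 - ε, Metric.isOpen_ball, ?_, by linarith, ?_⟩, ?_⟩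
  · exact (isCompact_closedBall z.1 (ε / 2)).of_isClosed_subset isClosed_closure
      Metric.closure_ball_subset_closedBall
  · exact Metric.closure_ball_subset_closedBall.trans (Metric.closedBall_subset_ball (by linarith))
  · refine Subset.trans (fun w hw => ?_) hball
    rw [Metric.mem_ball, Prod.dist_eq, max_lt_iff, Real.dist_eq, abs_lt]
    exact ⟨hw.1, by linarith [hw.2.1], by linarith [hw.2.2]⟩
  · exact prod_mem_nhds (Metric.ball_mem_nhds _ (by linarith))
      (Ioo_mem_nhds (by linarith) (by linarith))

theorem MemV2GLoc.locallyIntegrableOn_energy (hu : MemV2GLoc (youngPrimitive g) Q u Du)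
    (hγ : IsGrowthFunction γ P) (hQ : IsOpen Q) (hR : 0 ≤ R)
    (hG : ∀ s, 0 ≤ s → s * γ s ≤ R * youngPrimitive g s) :
    LocallyIntegrableOn (fun z => ‖Du z‖ * γ ‖Du z‖) Q := by
  intro z hz
  obtain ⟨D, s, t, h, hnhds⟩ := exists_parabolicallyInside_mem_nhds hQ hz
  obtain ⟨hmeas, hfinite⟩ := (hu.2 D s t h).memOrlicz_grad
  refine ⟨timeCylinder D s t, mem_nhdsWithin_of_mem_nhds hnhds,
    hmeas.norm.mul (hγ.continuous.comp_aestronglyMeasurable hmeas.norm), ?_⟩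
  rw [hasFiniteIntegral_iff_ofReal (.of_forall fun z => hγ.mul_nonneg (norm_nonneg _))]
  calc ∫⁻ z in timeCylinder D s t, ENNReal.ofReal (‖Du z‖ * γ ‖Du z‖)
      ≤ ∫⁻ z in timeCylinder D s t, ENNReal.ofReal R * ENNReal.ofReal (youngPrimitive g ‖Du z‖) :=
        lintegral_mono fun z => by
          rw [← ENNReal.ofReal_mul hR]
          exact ENNReal.ofReal_le_ofReal (hG _ (norm_nonneg _))
    _ = ENNReal.ofReal R * ∫⁻ z in timeCylinder D s t, ENNReal.ofReal (youngPrimitive g ‖Du z‖) :=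
        lintegral_const_mul' _ _ ENNReal.ofReal_ne_top
    _ < ⊤ := ENNReal.mul_lt_top ENNReal.ofReal_lt_top hfinite

theorem IsWeakSupersolution.exists_isBoundedSupersolution (hu : IsWeakSupersolution A g Q u)
    (hA : IsMonotoneField A γ C c) (hγ : IsGrowthFunction γ P) (hQ : IsOpen Q) (hR : 0 ≤ R)
    (hG : ∀ s, 0 ≤ s → s * γ s ≤ R * youngPrimitive g s)
    (hbound : ∀ᵐ z ∂volume.restrict Q, ‖u z‖ ≤ M) : ∃ Du, IsBoundedSupersolution A γ Q M u Du := by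
  obtain ⟨Du, hV, hnonneg⟩ := hu
  have henergy := hV.locallyIntegrableOn_energy hγ hQ hR hG
  have hflux := hA.locallyIntegrableOn_comp hγ hV.1.locInt_grad.aestronglyMeasurable henergy
  exact ⟨Du, ⟨hV.1, hflux, fun η hη hη₀ => (hnonneg η hη hη₀).trans_eq
    (hη.neg_setIntegral_add_setIntegral hV.1.locInt hflux)⟩, henergy, hbound⟩

end WeakSupersolutions

theorem mainTheorem3_general {n : ℕ} {g : ℝ → ℝ} {g₀ g₁ : ℝ} (h₀ : 1 < g₀)
    (hg : HasOrliczGrowth g g₀ g₁) {A : Space n → Space n} {ν L : ℝ} (hν : 0 < ν)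
    (hA : HasOrliczStructure A g ν L) {Q : Set (SpaceTime n)} (hQ : IsOpen Q) {M : ℝ}
    {v : ℕ → SpaceTime n → ℝ} {u : SpaceTime n → ℝ} (hv : ∀ i, IsWeakSupersolution A g Q (v i))
    (hvM : ∀ i, ∀ᵐ z ∂(volume.restrict Q), |v i z| ≤ M)
    (hlim : ∀ᵐ z ∂(volume.restrict Q), Tendsto (fun i => v i z) atTop (𝓝 (u z))) :
    IsWeakSupersolution A g Q u := by
  have hγ : IsGrowthFunction ((Ioi 0).indicator g) ⌈g₁ - 1⌉₊ :=
    hg.isGrowthFunction h₀ (Nat.le_ceil _)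
  have hfield := hA.isMonotoneField hg h₀ hν
  have hbounded i : ∃ D, IsBoundedSupersolution (fun ξ => A ξ - A 0) _ Q |M| (v i) D :=
    (isWeakSupersolution_sub_const_iff.2 (hv i)).exists_isBoundedSupersolution hfield hγ hQ
      (R := 2 ^ (⌈g₁ - 1⌉₊ + 1)) (by positivity)
      (fun s hs => by rw [youngPrimitive_eq_integral_indicator g hs]; exact hγ.mul_le_integral hs)
      ((hvM i).mono fun z hz => hz.trans (le_abs_self M))
  choose D hD using hbounded
  obtain ⟨Du, hDu⟩ :=
    hfield.exists_isBoundedSupersolution_of_tendsto hγ (abs_nonneg M) hQ hD hlim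
  exact isWeakSupersolution_sub_const_iff.1 <|
    hDu.isWeakSupersolution hfield hγ (abs_nonneg M) hQ fun s hs => by
      rw [youngPrimitive_eq_integral_indicator g hs]
      exact hγ.integral_le_mul hs

theorem mainTheorem3 (n : ℕ) (hn : 2 ≤ n)
    (g : ℝ → ℝ) (g₀ g₁ : ℝ) (hg₀ : 2 * (n : ℝ) / ((n : ℝ) + 2) < g₀) (hg₁ : g₀ ≤ g₁)
    (hg : HasOrliczGrowth g g₀ g₁)
    (A : Space n → Space n) (ν L : ℝ) (hν : 0 < ν) (hν₁ : ν ≤ 1) (hL : 1 ≤ L)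
    (hA : HasOrliczStructure A g ν L)
    (Ω : Set (Space n)) (hΩ : IsOpen Ω) (hΩc : IsConnected Ω) (hΩb : Bornology.IsBounded Ω)
    (T : ℝ) (hT : 0 < T)
    (Q : Set (SpaceTime n)) (hQ : IsOpen Q) (hQΩ : Q ⊆ timeCylinder Ω 0 T)
    (M : ℝ) (hM : 1 ≤ M)
    (v : ℕ → SpaceTime n → ℝ) (u : SpaceTime n → ℝ)
    (hv : ∀ i, IsWeakSupersolution A g Q (v i))
    (hvM : ∀ i, ∀ᵐ z ∂(volume.restrict Q), |v i z| ≤ M)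
    (hlim : ∀ᵐ z ∂(volume.restrict Q), Tendsto (fun i => v i z) atTop (𝓝 (u z))) :
    IsWeakSupersolution A g Q u := by
  have hn' : (2 : ℝ) ≤ n := by exact_mod_cast hn
  have h₀ : 1 < g₀ := ((one_le_div (by positivity)).2 (by linarith)).trans_lt hg₀
  exact mainTheorem3_general h₀ hg hν hA hQ hv hvM hlim
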